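/- Let $\mathfrak M$ be a (Hausdorff, $\sigma$-compact) complex manifold of dimension $n\ge 1$ with a smooth Riemannian metric, and let $\Omega\Subset\mathfrak M$ be a domain with generic corners: $\Omega=\bigcap_{j=1}^N\Omega_j$ is a relatively compact domain, each $\Omega_j\subset\mathfrak M$ is a domain with $\mathcal C^\infty$ boundary, and for every $S\subset\{1,\dots,N\}$ the set $B_S=\bigcap_{j\in S}\partial\Omega_j$, if nonempty, is a generic CR manifold of CR-dimension $n-|S|$; that is, at each $p\in B_S$ the real space $T=\bigcap_{j\in S}T_p(\partial\Omega_j)$ satisfies $\dim_{\mathbb C}(T\cap iT)=n-|S|$ (equivalently $\bigwedge_{j\in S}\overline\partial r_j\neq0$ at $p$ for local defining functions $r_j$ of $\Omega_j$). Let $f$ be a holomorphic function on $\Omega$ of polynomial growth, i.e. there are $C>0$ and an integer $k\ge0$ with $|f(z)|\le C\,\mathrm{dist}(z,\partial\Omega)^{-k}$ for all $z\in\Omega$, where $\mathrm{dist}$ is the Riemannian distance. Then there is a $(0,1)$-current $\mathsf{bc} f\in\mathcal D'_{0,1}(\mathfrak M)$, i.e. a continuous linear functional on the space $\mathcal D^{n,n-1}(\mathfrak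 M)$ of smooth compactly supported $(n,n-1)$-forms, with the following property. Let $U$ be the domain of a holomorphic coordinate chart of $\mathfrak M$, let $\psi\in\mathcal D^{n,n-1}(\mathfrak M)$ have support in $U$, and let $v\in\mathbb C^n$ be a vector which, in the coordinates on $U$, points outward along each face of $\Omega$ inside $U$ (that is, $dr_j(v)>0$ at every point of $U\cap\partial\Omega\cap\partial\Omega_j$, for $r_j$ a local defining function of $\Omega_j$). Write $f_\epsilon(z)=f(z-\epsilon v)$ in these coordinates. Then for all sufficiently small $\epsilon>0$ the function $f_\epsilon$ is defined on $\partial\Omega\cap\operatorname{supp}\psi$ and $f_\epsilon\psi$ is integrable over $\partial\Omega$, and $$\langle \mathsf{bc} f,\psi\rangle=\lim_{\epsilon\downarrow0}\int_{\partial\Omega} f_\epsilon\,\psi ,$$ where $\partial\Omega$ carries the boundary orientation. -/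

import Mathlib

open Set Filter Topology MeasureTheory Bundle
open scoped Manifold ContDiff ENNReal NNReal

noncomputable section

namespace BoundaryCurrent

/-- The model space `ℂⁿ` with its Euclidean norm. -/
abbrev Cn (n : ℕ) : Type := EuclideanSpace ℂ (Fin n)

section RealStructure

variable {n : ℕ} {M : Type*} [TopologicalSpace M] [ChartedSpace (Cn n) M]

/-- A complex manifold is a real-analytic manifold for the same atlas. -/
instance isManifold_real [IsManifold 𝓘(ℂ, Cn n) ω M] : IsManifold 𝓘(ℝ, Cn n) ω M := by
  apply isManifold_of_contDiffOn
  intro e e' he he'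
  have h := HasGroupoid.compatible (G := contDiffGroupoid ω 𝓘(ℂ, Cn n)) he he'
  rw [contDiffGroupoid, mem_groupoid_of_pregroupoid] at h
  have h1 : ContDiffOn ℂ ω _ _ := h.1
  exact h1.restrict_scalars ℝ

end RealStructure

variable (n : ℕ) (M : Type*) [TopologicalSpace M] [ChartedSpace (Cn n) M]

/-- The holomorphic coordinate charts of `M`. -/
abbrev holCharts : Set (OpenPartialHomeomorph M (Cn n)) :=
  IsManifold.maximalAtlas 𝓘(ℂ, Cn n) ω M

/-- Complex-valued differential forms of degree `k` (no regularity): at each `x`, an alternating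
`ℝ`-multilinear form on the tangent space `TangentSpace 𝓘(ℝ, ℂⁿ) x`, which is `ℂⁿ` by definition. -/
abbrev Form (k : ℕ) : Type _ := M → (Cn n) [⋀^Fin k]→L[ℝ] ℂ

variable {n M}

/-- The expression of a form in a chart: its pullback under `e.symm`, a form on `e.target ⊆ ℂⁿ`. -/
def Form.inChart {k : ℕ} (e : OpenPartialHomeomorph M (Cn n)) (ψ : Form n M k) (y : Cn n) :
    (Cn n) [⋀^Fin k]→L[ℝ] ℂ :=
  (ψ (e.symm y)).compContinuousLinearMap (mfderiv 𝓘(ℝ, Cn n) 𝓘(ℝ, Cn n) e.symm y)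

variable (n M)

/-- `𝒟^{p,q}(M)`: smooth compactly supported forms of bidegree `(p,q)`. A form of degree `p + q`
has bidegree `(p,q)` iff scaling all its arguments by `c ∈ ℂ` multiplies it by `c ^ p * c̄ ^ q`. -/
def testForms (p q : ℕ) : Submodule ℂ (Form n M (p + q)) where
  carrier := {ψ | (∀ e ∈ holCharts n M, ContDiffOn ℝ ∞ (Form.inChart e ψ) e.target) ∧
    (∀ x (c : ℂ) (w : Fin (p + q) → Cn n),
      ψ x (fun i => c • w i) = c ^ p * (starRingEnd ℂ c) ^ q * ψ x w) ∧
    HasCompactSupport ψ}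
  add_mem' := by
    rintro a b ⟨ha, ha', ha''⟩ ⟨hb, hb', hb''⟩
    refine ⟨fun e he => ?_, fun x c w => ?_, ha''.add hb''⟩
    · exact (ha e he).add (hb e he)
    · simp only [Pi.add_apply, ContinuousAlternatingMap.add_apply, ha', hb']; ring
  zero_mem' := by
    refine ⟨fun e he => ?_, fun x c w => by simp, HasCompactSupport.zero⟩
    exact contDiffOn_const (c := (0 : (Cn n) [⋀^Fin (p + q)]→L[ℝ] ℂ))
  smul_mem' := by
    rintro t a ⟨ha, ha', ha''⟩
    refine ⟨fun e he => ?_, fun x c w => ?_, ?_⟩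
    · exact (ha e he).const_smul t
    · simp only [Pi.smul_apply, ContinuousAlternatingMap.smul_apply, ha', smul_eq_mul]; ring
    · exact ha''.mono (fun x hx => by
        simp only [Function.mem_support, Pi.smul_apply] at hx ⊢
        exact fun h => hx (by rw [h]; ext w; simp))

/-- `𝒟'_{p,q}(M)`, for `p, q ≤ n = dim M`: continuous linear functionals on `𝒟^{n-p,n-q}(M)`.
Continuity for the inductive limit topology is continuity on the Fréchet space of test forms
supported in `K`, for each compact `K ⊆ M`, i.e. a bound by finitely many of the seminorms
`sup_{y ∈ L, i ≤ m} ‖Dⁱ(ψ in the chart e)(y)‖`, `L` a compact subset of the range of the chart `e`. -/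
structure Current (p q : ℕ) where
  toLinearMap : testForms n M (n - p) (n - q) →ₗ[ℂ] ℂ
  continuous' : ∀ K : Set M, IsCompact K →
    ∃ s : Finset (OpenPartialHomeomorph M (Cn n) × Set (Cn n)),
      (∀ a ∈ s, a.1 ∈ holCharts n M ∧ IsCompact a.2 ∧ a.2 ⊆ a.1.target) ∧
      ∃ (m : ℕ) (C : ℝ), ∀ ψ : testForms n M (n - p) (n - q),
        tsupport (ψ : Form n M (n - p + (n - q))) ⊆ K → ∀ A : ℝ, 0 ≤ A →
        (∀ a ∈ s, ∀ y ∈ a.2, ∀ i ≤ m,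
          ‖iteratedFDeriv ℝ i (Form.inChart a.1 (ψ : Form n M (n - p + (n - q)))) y‖ ≤ A) →
        ‖toLinearMap ψ‖ ≤ C * A

variable {n M}

/-- `r` is a smooth defining function of `Ω` on some open neighbourhood `W` of `p`:
`dr ≠ 0` on `W` and `Ω ∩ W = {r < 0}`. -/
def IsLocalDefiningFunction (Ω : Set M) (p : M) (r : M → ℝ) : Prop :=
  ∃ W : Set M, IsOpen W ∧ p ∈ W ∧ ContMDiffOn 𝓘(ℝ, Cn n) 𝓘(ℝ, ℝ) ∞ r W ∧
    (∀ z ∈ W, mfderiv 𝓘(ℝ, Cn n) 𝓘(ℝ, ℝ) r z ≠ 0) ∧ Ω ∩ W = {z ∈ W | r z < 0}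

variable (n) in
/-- A domain (nonempty connected open set) with smooth boundary. -/
structure IsSmoothlyBoundedDomain (Ω : Set M) : Prop where
  isOpen : IsOpen Ω
  isConnected : IsConnected Ω
  smooth_boundary : ∀ p ∈ frontier Ω, ∃ r, IsLocalDefiningFunction (n := n) Ω p r

/-- `H ∩ iH`, the largest complex subspace contained in a real subspace `H` of `ℂⁿ`: the `w` with
`ℂ w ⊆ H`. -/
def maxComplexSubspace (H : Submodule ℝ (Cn n)) : Submodule ℂ (Cn n) where
  carrier := {w | ∀ c : ℂ, c • w ∈ H}
  add_mem' := fun ha hb c => by rw [smul_add]; exact H.add_mem (ha c) (hb c)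
  zero_mem' := fun c => by rw [smul_zero]; exact H.zero_mem
  smul_mem' := fun t _ hw c => by rw [smul_smul]; exact hw (c * t)

variable (n) in
/-- `Ω = ⋂ⱼ Ωⱼ` is a relatively compact domain with generic corners: each `Ωⱼ` is a smoothly
bounded domain and every nonempty corner `B_S = ⋂_{j ∈ S} bΩⱼ` is a generic CR manifold of
CR-dimension `n - |S|`: at each of its points the space `T = ⋂_{j ∈ S} T_p(bΩⱼ)`,
`T_p(bΩⱼ) = ker drⱼ`, has `dim_ℂ (T ∩ iT) = n - |S|`. (This forces the `drⱼ`, `j ∈ S`, to be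
linearly independent, so that `B_S` is a submanifold with tangent space `T`.) -/
structure IsDomainWithGenericCorners {N : ℕ} (Ωs : Fin N → Set M) : Prop where
  isConnected : IsConnected (⋂ j, Ωs j)
  isCompact_closure : IsCompact (closure (⋂ j, Ωs j))
  smoothlyBounded : ∀ j, IsSmoothlyBoundedDomain n (Ωs j)
  generic : ∀ (S : Finset (Fin N)) (p : M), (∀ j ∈ S, p ∈ frontier (Ωs j)) →
    ∀ r : Fin N → M → ℝ, (∀ j ∈ S, IsLocalDefiningFunction (n := n) (Ωs j) p (r j)) →
      Module.finrank ℂ (maxComplexSubspace (n := n)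
        (⨅ j ∈ S, (mfderiv 𝓘(ℝ, Cn n) 𝓘(ℝ, ℝ) (r j) p : Cn n →L[ℝ] ℝ).ker)) + S.card = n

/-- Smooth Riemannian metrics on `M`. -/
abbrev RiemannianMetricOn (n : ℕ) (M : Type*) [TopologicalSpace M] [ChartedSpace (Cn n) M]
    [IsManifold 𝓘(ℂ, Cn n) ω M] : Type _ :=
  ContMDiffRiemannianMetric 𝓘(ℝ, Cn n) ∞ (Cn n) (fun x : M => TangentSpace 𝓘(ℝ, Cn n) x)

/-- Riemannian distance from a point to a set (`∞` if the set is empty). -/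
def distTo [IsManifold 𝓘(ℂ, Cn n) ω M] (g : RiemannianMetricOn n M) (z : M) (A : Set M) : ℝ≥0∞ :=
  letI : RiemannianBundle (fun x : M => TangentSpace 𝓘(ℝ, Cn n) x) := ⟨g.toRiemannianMetric⟩
  ⨅ w ∈ A, Manifold.riemannianEDist 𝓘(ℝ, Cn n) z w

/-- `f` is of polynomial growth on `Ω`: `|f(z)| ≤ C / dist(z, ∂Ω)^k` on `Ω`. -/
def HasPolynomialGrowth [IsManifold 𝓘(ℂ, Cn n) ω M] (g : RiemannianMetricOn n M)
    (Ω : Set M) (f : M → ℂ) : Prop :=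
  ∃ (C : ℝ≥0) (k : ℕ), ∀ z ∈ Ω, ‖f z‖ₑ ≤ C / distTo g z (frontier Ω) ^ k

/-- The constant vector `v`, in the coordinates of the chart `e`, points outward from `Ω = ⋂ⱼ Ωⱼ`
along each face `∂Ω ∩ ∂Ωⱼ` inside the chart. -/
def PointsOutward {N : ℕ} (Ωs : Fin N → Set M) (e : OpenPartialHomeomorph M (Cn n))
    (v : Cn n) : Prop :=
  ∀ (j : Fin N), ∀ p ∈ e.source ∩ (frontier (⋂ i, Ωs i) ∩ frontier (Ωs j)), ∀ r : M → ℝ,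
    IsLocalDefiningFunction (n := n) (Ωs j) p r → 0 < fderiv ℝ (r ∘ e.symm) (e p) v

variable (n) in
/-- The positively oriented real orthonormal frame `e₁, i e₁, …, eₙ, i eₙ` of `ℂⁿ`, indexed by
`0, …, 2n-1`. -/
def realFrame (i : ℕ) : Cn n :=
  WithLp.toLp 2 fun j => if i = 2 * (j : ℕ) then 1 else if i = 2 * (j : ℕ) + 1 then Complex.I else 0

/-- `(ν ∧ η)(e₁, i e₁, …, eₙ, i eₙ)` for a real covector `ν` and a form `η` of degree
`k = 2n - 1`. If `ν` is the outward unit conormal of a hypersurface, this is the value of `η` on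
an orthonormal basis of the tangent space, positive for the boundary orientation (outward normal
first), i.e. the density of `η` with respect to surface measure. -/
def surfaceDensity {k : ℕ} (ν : Cn n →L[ℝ] ℝ) (η : (Cn n) [⋀^Fin k]→L[ℝ] ℂ) : ℂ :=
  ∑ i : Fin (k + 1), (-1) ^ (i : ℕ) * (ν (realFrame n i) : ℂ) *
    η (fun a : Fin k => realFrame n (i.succAbove a))

open Classical in
/-- The outward unit conormal `dr / |dr|` of `Ω`, read in the chart `e`, at a point `y ∈ e.target`
over `∂Ω`; it does not depend on the local defining function `r`. -/
def outwardConormal (Ω : Set M) (e : OpenPartialHomeomorph M (Cn n)) (y : Cn n) : Cn n →L[ℝ] ℝ :=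
  if h : ∃ r, IsLocalDefiningFunction (n := n) Ω (e.symm y) r then
    ‖fderiv ℝ (h.choose ∘ e.symm) y‖⁻¹ • fderiv ℝ (h.choose ∘ e.symm) y
  else 0

/-- The face `∂Ω ∩ ∂Ωⱼ` of `Ω = ⋂ⱼ Ωⱼ`, read in the chart `e`. -/
def faceInChart {N : ℕ} (Ωs : Fin N → Set M) (e : OpenPartialHomeomorph M (Cn n)) (j : Fin N) :
    Set (Cn n) :=
  e.target ∩ e.symm ⁻¹' (frontier (⋂ i, Ωs i) ∩ frontier (Ωs j))

/-- `η` is absolutely integrable over each face of `∂Ω` inside the chart `e`; here `η` is a form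
of degree `k = 2n - 1` on `e.target` and `μHE[k]` is surface measure in `ℂⁿ = ℝ²ⁿ`. -/
def BoundaryIntegrable {N k : ℕ} (Ωs : Fin N → Set M) (e : OpenPartialHomeomorph M (Cn n))
    (η : Cn n → (Cn n) [⋀^Fin k]→L[ℝ] ℂ) : Prop :=
  ∀ j, IntegrableOn (fun y => surfaceDensity (outwardConormal (Ωs j) e y) (η y))
    (faceInChart Ωs e j) μHE[k]

/-- `∫_{∂Ω} η` for a form `η` of degree `k = 2n - 1` supported in the chart `e` and expressed in
its coordinates: the sum over the faces, with boundary orientation, of the integrals of `η`. -/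
def boundaryIntegral {N k : ℕ} (Ωs : Fin N → Set M) (e : OpenPartialHomeomorph M (Cn n))
    (η : Cn n → (Cn n) [⋀^Fin k]→L[ℝ] ℂ) : ℂ :=
  ∑ j, ∫ y in faceInChart Ωs e j, surfaceDensity (outwardConormal (Ωs j) e y) (η y) ∂μHE[k]

/-- The form `f_ε ψ` in the coordinates of the chart `e`, where `f_ε(z) = f(z - ε v)`. -/
def shiftedForm {k : ℕ} (e : OpenPartialHomeomorph M (Cn n)) (f : M → ℂ) (v : Cn n)
    (ψ : Form n M k) (ε : ℝ) (y : Cn n) : (Cn n) [⋀^Fin k]→L[ℝ] ℂ :=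
  f (e.symm (y - ε • v)) • Form.inChart e ψ y

end BoundaryCurrent

end

open BoundaryCurrent

/-! Since `f` may blow up at ∂Ω, the shifted boundary integrals are turned into volume integrals
whose integrands stay bounded uniformly in ε. For ψ supported near a boundary point, `f_ε` is
holomorphic near the part of the closure of Ω that meets supp ψ, and ∂f_ε ∧ ψ = 0 because ψ has
bidegree (n,n-1). Stokes' theorem therefore gives ∫_{∂Ω} f_ε ψ = ∫_Ω f_ε dψ
(`CornerChart.boundaryIntegral_eq`).

Let dψ = u dV in a chart, near a point where the faces r_j = 0, j ∈ J, meet. Genericity says that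
the ∂̄r_j are linearly independent, so there are antiholomorphic vector fields L_j with L_j r_i =
δ_ij (`exists_isDualTo`, `exists_dualFields`). They annihilate f_ε and satisfy L_j r^(α+e_j) =
(α_j+1) r^α. Integration by parts along L_j thus trades one derivative of u for one more factor r_j.
No boundary term appears: r_j vanishes on its own face and L_j is tangent to the other faces.
Iterating, ∫ f_ε u = ∫ f_ε ∏ r_j^k · Pu with an operator P that depends neither on ε nor on v
(`exists_regularization`).

The function ∏ r_j, cut off, is Lipschitz for the Riemannian distance and vanishes on ∂Ω, so
polynomial growth of order k makes f ∏ r_j^k bounded (`CornerNbhd.exists_growth`). A shift by -εv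
decreases the r_j of the faces through the point, hence |r_j(z)| ≤ 3|r_j(z-εv)|, and f_ε ∏ r_j^k is
bounded uniformly in ε. Dominated convergence gives the limit ∫_Ω f ∏ r_j^k · Pu
(`LocalModel.exists_nbhd_of_mem_frontier`). Neither v nor the chart of the shift occurs in this
expression, and finitely many derivatives of ψ bound it. It is the local boundary current; a
partition of unity on the compact set ∂Ω glues the pieces (`exists_boundaryCurrent`). The
regularization lives in one fixed chart and the shift in an arbitrary one; the two are compared
through ∫_Ω G dψ, which does not depend on the chart (`setIntegral_topCoeff_chartForm`).

The divergence theorem on a corner rests on the following picture. In coordinates x + tv, with v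
outward, the faces are graphs t = g_j(x) and the domain is t < min_j g_j(x). Fubini reduces the
v-derivative to an integral over x of the value at the minimum, and the area formula turns it into
surface integrals over the faces; transversality makes the overlaps negligible
(`stokes_of_transverse`). Arbitrary directions follow by linearity (`exists_stokesNbhd`). -/

noncomputable section

namespace BoundaryCurrent

set_option linter.unusedSectionVars false

/-! ### Area formula for injective immersions -/

section Area

open Measure

/-- Comparison of two set functions which are comparable, locally, up to factors close to `1`. -/
theorem le_of_locally_le_mul {X : Type*} [TopologicalSpace X] [SecondCountableTopology X]
    [MeasurableSpace X] [OpensMeasurableSpace X] {s : Set X} (a b : Set X → ℝ≥0∞) (ha0 : a ∅ = 0)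
    (ha : ∀ A : ℕ → Set X, (∀ i, MeasurableSet (A i)) → Pairwise (Function.onFun Disjoint A) →
      (∀ i, A i ⊆ s) → a (⋃ i, A i) ≤ ∑' i, a (A i))
    (hb : ∀ A : ℕ → Set X, (∀ i, MeasurableSet (A i)) → Pairwise (Function.onFun Disjoint A) →
      (∀ i, A i ⊆ s) → ∑' i, b (A i) ≤ b (⋃ i, A i))
    (h : ∀ x ∈ s, ∀ c : ℝ≥0, 1 < c → ∃ u ∈ 𝓝 x, ∀ A ⊆ u ∩ s, MeasurableSet A → a A ≤ c * b A)
    {A : Set X} (hA : MeasurableSet A) (hAs : A ⊆ s) : a A ≤ b A := by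
  rcases A.eq_empty_or_nonempty with rfl | ⟨x₀, hx₀⟩
  · simp [ha0]
  have key : ∀ c : ℝ≥0, 1 < c → a A ≤ c * b A := by
    intro c hc
    choose! u hu hu' using fun x hx => h x hx c hc
    obtain ⟨t, hts, htc, ht⟩ := TopologicalSpace.countable_cover_nhdsWithin
      (s := s) (f := fun x => interior (u x))
      (fun x hx => nhdsWithin_le_nhds (interior_mem_nhds.2 (hu x hx)))
    have htne : t.Nonempty := by
      have := ht (hAs hx₀)
      simp only [mem_iUnion] at this
      obtain ⟨i, hi, -⟩ := this
      exact ⟨i, hi⟩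
    obtain ⟨φ, hφ⟩ := htc.exists_eq_range htne
    let B : ℕ → Set X := fun i => A ∩ disjointed (fun i => interior (u (φ i))) i
    have hφs : ∀ i, φ i ∈ s := fun i => hts (hφ ▸ mem_range_self i)
    have hBm : ∀ i, MeasurableSet (B i) := fun i =>
      hA.inter (MeasurableSet.disjointed (fun i => isOpen_interior.measurableSet) i)
    have hBd : Pairwise (Function.onFun Disjoint B) := fun i j hij =>
      ((disjoint_disjointed _) hij).mono inter_subset_right inter_subset_right
    have hBs : ∀ i, B i ⊆ s := fun i => inter_subset_left.trans hAs
    have hBu : ⋃ i, B i = A := by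
      rw [← inter_iUnion, iUnion_disjointed, inter_eq_left]
      refine hAs.trans (ht.trans ?_)
      rw [hφ]; simp
    have hle : ∀ i, a (B i) ≤ c * b (B i) := fun i =>
      hu' _ (hφs i) _ (subset_inter (inter_subset_right.trans
        ((disjointed_subset _ i).trans interior_subset)) (hBs i)) (hBm i)
    calc a A = a (⋃ i, B i) := by rw [hBu]
      _ ≤ ∑' i, a (B i) := ha B hBm hBd hBs
      _ ≤ ∑' i, c * b (B i) := ENNReal.tsum_le_tsum hle
      _ = c * ∑' i, b (B i) := ENNReal.tsum_mul_left
      _ ≤ c * b (⋃ i, B i) := by gcongr; exact hb B hBm hBd hBs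
      _ = c * b A := by rw [hBu]
  -- Let `c` decrease to `1` in `key`. The infinite case is trivial, and is split off because
  -- multiplication has to be continuous at `b A`.
  by_cases hbt : b A = ⊤
  · simp [hbt]
  have hlim : Tendsto (fun c : ℝ≥0 => (c : ℝ≥0∞) * b A) (𝓝[>] 1) (𝓝 ((1 : ℝ≥0) * b A)) :=
    (ENNReal.Tendsto.mul_const (ENNReal.tendsto_coe.2 tendsto_id) (Or.inr hbt)).mono_left
      nhdsWithin_le_nhds
  rw [ENNReal.coe_one, one_mul] at hlim
  exact ge_of_tendsto hlim (by filter_upwards [self_mem_nhdsWithin] with c hc using key c hc)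

/-- On `A` the map `G` factors as `φ ∘ H` with `φ` Lipschitz of constant `K` on `H '' A`: points
with equal image under `H` have equal image under `G`, so choosing preimages does no harm. -/
theorem euclideanHausdorffMeasure_image_le_of_dist_le {X Y Z : Type*} [MetricSpace Y]
    [MetricSpace Z] [MeasurableSpace Y] [BorelSpace Y] [MeasurableSpace Z] [BorelSpace Z]
    {G : X → Y} {H : X → Z} {A : Set X} {K : ℝ≥0} (d : ℕ)
    (h : ∀ x ∈ A, ∀ y ∈ A, dist (G x) (G y) ≤ K * dist (H x) (H y)) :
    μHE[d] (G '' A) ≤ (K : ℝ≥0∞) ^ d * μHE[d] (H '' A) := by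
  rcases A.eq_empty_or_nonempty with rfl | ⟨x₀, hx₀⟩
  · simp
  have : Nonempty X := ⟨x₀⟩
  let φ : Z → Y := fun z => G (Function.invFunOn H A z)
  have hinv : ∀ z ∈ H '' A, Function.invFunOn H A z ∈ A ∧ H (Function.invFunOn H A z) = z :=
    fun z hz => ⟨Function.invFunOn_mem hz, Function.invFunOn_eq hz⟩
  have hφ : LipschitzOnWith K φ (H '' A) := by
    refine LipschitzOnWith.of_dist_le_mul fun z hz w hw => ?_
    have := h _ (hinv z hz).1 _ (hinv w hw).1
    rwa [(hinv z hz).2, (hinv w hw).2] at this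
  have himg : φ '' (H '' A) = G '' A := by
    rw [image_image]
    refine image_congr fun x hx => ?_
    have hx' := hinv _ (mem_image_of_mem H hx)
    have := h _ hx'.1 _ hx
    rw [hx'.2, dist_self, mul_zero] at this
    exact dist_le_zero.1 this
  have := hφ.hausdorffMeasure_image_le (d := d) (by positivity)
  rw [himg, ENNReal.rpow_natCast] at this
  rw [euclideanHausdorffMeasure_def, euclideanHausdorffMeasure_def, Measure.smul_apply,
    Measure.smul_apply, ENNReal.smul_def, ENNReal.smul_def, smul_eq_mul, smul_eq_mul,
    mul_left_comm]
  gcongr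

variable {U V : Type*} [NormedAddCommGroup U] [InnerProductSpace ℝ U] [FiniteDimensional ℝ U]
  [MeasurableSpace U] [BorelSpace U] [NormedAddCommGroup V] [InnerProductSpace ℝ V]
  [MeasurableSpace V] [BorelSpace V]

/-- Near a point, an immersion distorts Hausdorff measure almost as its derivative does. -/
theorem exists_nhds_euclideanHausdorffMeasure_image_comparable {G : U → V} {L : U →L[ℝ] V} {x : U}
    (hG : HasStrictFDerivAt G L x) (hL : Function.Injective L) {c : ℝ≥0} (hc : 1 < c) :
    ∃ u ∈ 𝓝 x, ∀ A ⊆ u,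
      μHE[Module.finrank ℝ U] (G '' A) ≤ c * μHE[Module.finrank ℝ U] (L '' A) ∧
      μHE[Module.finrank ℝ U] (L '' A) ≤ c * μHE[Module.finrank ℝ U] (G '' A) := by
  set d := Module.finrank ℝ U
  -- A Lipschitz constant enters a `d`-dimensional measure through its `d`-th power.
  obtain ⟨c', hc'1, hc'⟩ : ∃ c' : ℝ≥0, 1 < c' ∧ c' ^ d ≤ c := by
    have : Tendsto (fun t : ℝ≥0 => t ^ d) (𝓝[>] 1) (𝓝 (1 ^ d)) :=
      ((continuous_pow d).tendsto 1).mono_left nhdsWithin_le_nhds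
    rw [one_pow] at this
    obtain ⟨t, ht, ht1⟩ := ((this.eventually (ge_mem_nhds hc)).and self_mem_nhdsWithin).exists
    exact ⟨t, ht1, ht⟩
  obtain ⟨κ, hκ, hanti⟩ := LinearMap.exists_antilipschitzWith (L : U →ₗ[ℝ] V)
    (LinearMap.ker_eq_bot.2 hL)
  -- `δ κ ≤ 1 - 1 / c'`
  have hc'0 : (0 : ℝ) < c' := by have := hc'1; positivity
  have hc'1' : (1 : ℝ) < c' := by exact_mod_cast hc'1
  have hpos : 0 < (1 - 1 / (c' : ℝ)) / κ := by
    apply div_pos _ (by exact_mod_cast hκ)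
    rw [sub_pos, div_lt_one hc'0]; exact hc'1'
  -- With this linearization error, |G y - G z| differs from |L(y-z)| by at most (1 - 1/c')|L(y-z)|.
  -- Hence it is at least |L(y-z)|/c', and at most c'|L(y-z)| because c' + 1/c' ≥ 2.
  obtain ⟨u, hu, happ⟩ := hG.approximates_deriv_on_nhds
    (c := ⟨(1 - 1 / (c' : ℝ)) / κ, hpos.le⟩) (Or.inr (by exact_mod_cast hpos))
  have hest : ∀ y ∈ u, ∀ z ∈ u, ‖G y - G z - L (y - z)‖ ≤ (1 - 1 / (c' : ℝ)) * dist (L y) (L z) := by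
    intro y hy z hz
    have h1 := happ y hy z hz
    have h2 : ‖y - z‖ ≤ κ * dist (L y) (L z) := by
      have := hanti.le_mul_dist y z
      rwa [dist_eq_norm] at this
    refine h1.trans ?_
    calc _ ≤ (1 - 1 / (c' : ℝ)) / κ * (κ * dist (L y) (L z)) := by
          apply mul_le_mul_of_nonneg_left h2 hpos.le
      _ = _ := by
        have : (κ : ℝ) ≠ 0 := by exact_mod_cast hκ.ne'
        field_simp
  have hinv : 1 - 1 / (c' : ℝ) ≤ c' - 1 := by
    rw [sub_le_sub_iff, ← sub_nonneg]
    have : (c' : ℝ) + 1 / c' - (1 + 1) = (c' - 1) ^ 2 / c' := by field_simp; ring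
    rw [this]; positivity
  have hpow : ∀ t : ℝ≥0∞, (c' : ℝ≥0∞) ^ d * t ≤ c * t := fun t => by
    gcongr; exact_mod_cast hc'
  refine ⟨u, hu, fun A hA => ⟨?_, ?_⟩⟩
  · refine (euclideanHausdorffMeasure_image_le_of_dist_le (K := c') d fun y hy z hz => ?_).trans
      (hpow _)
    have h1 := hest y (hA hy) z (hA hz)
    have h2 : dist (G y) (G z) ≤ ‖G y - G z - L (y - z)‖ + dist (L y) (L z) := by
      rw [dist_eq_norm, dist_eq_norm, ← map_sub]
      simpa using norm_add_le (G y - G z - L (y - z)) (L (y - z))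
    nlinarith [dist_nonneg (x := L y) (y := L z)]
  · refine (euclideanHausdorffMeasure_image_le_of_dist_le (K := c') d fun y hy z hz => ?_).trans
      (hpow _)
    have h1 := hest y (hA hy) z (hA hz)
    have h2 : dist (L y) (L z) ≤ ‖G y - G z - L (y - z)‖ + dist (G y) (G z) := by
      rw [dist_eq_norm, dist_eq_norm, ← map_sub]
      simpa using norm_sub_le (G y - G z) (G y - G z - L (y - z)) |>.trans_eq (add_comm _ _)
    have h3 : dist (L y) (L z) / c' ≤ dist (G y) (G z) := by
      rw [div_eq_mul_one_div, mul_comm]; linarith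
    rwa [div_le_iff₀' hc'0] at h3

/-- Area formula for an injective immersion. -/
theorem euclideanHausdorffMeasure_image_eq_lintegral {G : U → V} {G' : U → U →L[ℝ] V} {s : Set U}
    {J : U → ℝ} (hG : ∀ x ∈ s, HasStrictFDerivAt G (G' x) x) (hinj : InjOn G s)
    (hJc : ContinuousOn J s) (hJ : ∀ x ∈ s, J x = (G' x : U →ₗ[ℝ] V).normDet)
    (hJ0 : ∀ x ∈ s, 0 < J x) {A : Set U} (hA : MeasurableSet A) (hAs : A ⊆ s) :
    μHE[Module.finrank ℝ U] (G '' A) = ∫⁻ x in A, ENNReal.ofReal (J x) := by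
  set d := Module.finrank ℝ U
  have hGc : ContinuousOn G s := fun x hx => (hG x hx).continuousAt.continuousWithinAt
  have hinjL : ∀ x ∈ s, Function.Injective (G' x) := by
    intro x hx
    have h0 : (G' x : U →ₗ[ℝ] V).normDet ≠ 0 := by rw [← hJ x hx]; exact (hJ0 x hx).ne'
    by_contra hcon
    exact h0 (((G' x : U →ₗ[ℝ] V).normDet_eq_zero_tfae.out 5 0).1 hcon)
  have himg_add : ∀ B : ℕ → Set U, (∀ i, MeasurableSet (B i)) →
      Pairwise (Function.onFun Disjoint B) → (∀ i, B i ⊆ s) →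
      (μHE[d] : Measure V) (G '' ⋃ i, B i) = ∑' i, μHE[d] (G '' B i) := by
    intro B hB hBd hBs
    rw [image_iUnion]
    refine measure_iUnion (fun i j hij => ?_) fun i => (hB i).image_of_continuousOn_injOn
      (hGc.mono (hBs i)) (hinj.mono (hBs i))
    refine disjoint_left.2 ?_
    rintro _ ⟨x, hx, rfl⟩ ⟨y, hy, hxy⟩
    exact disjoint_left.1 (hBd hij) hx (hinj (hBs j hy) (hBs i hx) hxy ▸ hy)
  have hint_add : ∀ B : ℕ → Set U, (∀ i, MeasurableSet (B i)) →
      Pairwise (Function.onFun Disjoint B) → (∀ i, B i ⊆ s) →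
      ∫⁻ x in ⋃ i, B i, ENNReal.ofReal (J x) = ∑' i, ∫⁻ x in B i, ENNReal.ofReal (J x) :=
    fun B hB hBd _ => lintegral_iUnion hB hBd _
  -- local comparison
  have hloc : ∀ x ∈ s, ∀ c : ℝ≥0, 1 < c → ∃ u ∈ 𝓝 x, ∀ A ⊆ u ∩ s, MeasurableSet A →
      μHE[d] (G '' A) ≤ c * ∫⁻ x in A, ENNReal.ofReal (J x) ∧
      ∫⁻ x in A, ENNReal.ofReal (J x) ≤ c * μHE[d] (G '' A) := by
    intro x hx c hc
    -- One factor `b` pays for replacing `G` by its derivative at `x`, the other for replacing `J y`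
    -- by `J x`.
    obtain ⟨b, hb1, hbc⟩ : ∃ b : ℝ≥0, 1 < b ∧ b * b ≤ c := by
      have : Tendsto (fun t : ℝ≥0 => t * t) (𝓝[>] 1) (𝓝 (1 * 1)) :=
        ((continuous_id.mul continuous_id).tendsto 1).mono_left nhdsWithin_le_nhds
      rw [one_mul] at this
      obtain ⟨t, ht, ht1⟩ := ((this.eventually (ge_mem_nhds hc)).and self_mem_nhdsWithin).exists
      exact ⟨t, ht1, ht⟩
    have hb1' : (1 : ℝ) < b := by exact_mod_cast hb1
    obtain ⟨u, hu, hcomp⟩ := exists_nhds_euclideanHausdorffMeasure_image_comparable (hG x hx)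
      (hinjL x hx) hb1
    have hev : ∀ᶠ y in 𝓝[s] x, J x ≤ b * J y ∧ J y ≤ b * J x := by
      have h1 : Tendsto (fun y => b * J y) (𝓝[s] x) (𝓝 (b * J x)) :=
        (hJc x hx).tendsto.const_mul _
      have h2 := (hJc x hx).tendsto
      have h3 : J x < b * J x := by nlinarith [hJ0 x hx]
      filter_upwards [h1.eventually (le_mem_nhds h3), h2.eventually (ge_mem_nhds h3)] with y hy hy'
        using ⟨hy, hy'⟩
    obtain ⟨w, hw, hws⟩ := mem_nhdsWithin_iff_exists_mem_nhds_inter.1 hev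
    refine ⟨u ∩ w, inter_mem hu hw, fun A hA hAm => ?_⟩
    have hLA : (μHE[d] : Measure V) (G' x '' A) = ENNReal.ofReal (J x) * volume A := by
      rw [hJ x hx]
      exact LinearMap.euclideanHausdorffMeasure_image_eq_normDet_mul_volume
        (G' x : U →ₗ[ℝ] V) A
    have hAJ : ∀ y ∈ A, J x ≤ b * J y ∧ J y ≤ b * J x := fun y hy =>
      hws ⟨(hA hy).1.2, (hA hy).2⟩
    have hcst : ENNReal.ofReal (J x) * volume A = ∫⁻ _ in A, ENNReal.ofReal (J x) := by simp
    have hbnn : ENNReal.ofReal (b : ℝ) = b := ENNReal.ofReal_coe_nnreal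
    have hle1 : ENNReal.ofReal (J x) * volume A ≤ b * ∫⁻ y in A, ENNReal.ofReal (J y) := by
      rw [hcst, ← lintegral_const_mul' _ _ ENNReal.coe_ne_top]
      refine setLIntegral_mono' hAm fun y hy => ?_
      rw [← hbnn, ← ENNReal.ofReal_mul b.coe_nonneg]
      exact ENNReal.ofReal_le_ofReal (hAJ y hy).1
    have hle2 : ∫⁻ y in A, ENNReal.ofReal (J y) ≤ b * (ENNReal.ofReal (J x) * volume A) := by
      rw [hcst, ← lintegral_const_mul' _ _ ENNReal.coe_ne_top]
      refine setLIntegral_mono' hAm fun y hy => ?_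
      rw [← hbnn, ← ENNReal.ofReal_mul b.coe_nonneg]
      exact ENNReal.ofReal_le_ofReal (hAJ y hy).2
    obtain ⟨hc1, hc2⟩ := hcomp A (hA.trans (inter_subset_left.trans inter_subset_left))
    rw [hLA] at hc1 hc2
    have hbc' : ∀ t : ℝ≥0∞, (b : ℝ≥0∞) * (b * t) ≤ c * t := fun t => by
      rw [← mul_assoc]; gcongr; exact_mod_cast hbc
    exact ⟨(hc1.trans (by gcongr)).trans (hbc' _), (hle2.trans (by gcongr)).trans (hbc' _)⟩
  refine le_antisymm ?_ ?_
  · refine le_of_locally_le_mul (s := s) (fun A => μHE[d] (G '' A))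
      (fun A => ∫⁻ x in A, ENNReal.ofReal (J x)) (by simp)
      (fun B h1 h2 h3 => (himg_add B h1 h2 h3).le) (fun B h1 h2 h3 => (hint_add B h1 h2 h3).ge)
      (fun x hx c hc => ?_) hA hAs
    obtain ⟨u, hu, h⟩ := hloc x hx c hc
    exact ⟨u, hu, fun A hA hAm => (h A hA hAm).1⟩
  · refine le_of_locally_le_mul (s := s) (fun A => ∫⁻ x in A, ENNReal.ofReal (J x))
      (fun A => μHE[d] (G '' A)) (by simp)
      (fun B h1 h2 h3 => (hint_add B h1 h2 h3).le) (fun B h1 h2 h3 => (himg_add B h1 h2 h3).ge)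
      (fun x hx c hc => ?_) hA hAs
    obtain ⟨u, hu, h⟩ := hloc x hx c hc
    exact ⟨u, hu, fun A hA hAm => (h A hA hAm).2⟩

/-- Area formula: the pushforward of the Jacobian density is surface measure on the image. -/
theorem map_withDensity_eq_euclideanHausdorffMeasure {G : U → V} {G' : U → U →L[ℝ] V} {s : Set U}
    {J : U → ℝ} (hs : MeasurableSet s) (hG : ∀ x ∈ s, HasStrictFDerivAt G (G' x) x)
    (hinj : InjOn G s)
    (hJc : ContinuousOn J s) (hJ : ∀ x ∈ s, J x = (G' x : U →ₗ[ℝ] V).normDet)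
    (hJ0 : ∀ x ∈ s, 0 < J x) :
    Measure.map (s.domRestrict G)
      (comap (↑) (volume.withDensity fun x => ENNReal.ofReal (J x))) =
      μHE[Module.finrank ℝ U].restrict (G '' s) := by
  have hGc : ContinuousOn G s := fun x hx => (hG x hx).continuousAt.continuousWithinAt
  have hemb : MeasurableEmbedding (s.domRestrict G) := hGc.measurableEmbedding hs hinj
  ext t ht
  have hpre : MeasurableSet ((s.domRestrict G) ⁻¹' t) := hemb.measurable ht
  rw [Measure.map_apply hemb.measurable ht, (MeasurableEmbedding.subtype_coe hs).comap_apply,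
    withDensity_apply _ ((MeasurableEmbedding.subtype_coe hs).measurableSet_image.2 hpre),
    Measure.restrict_apply ht]
  rw [← euclideanHausdorffMeasure_image_eq_lintegral hG hinj hJc hJ hJ0
    ((MeasurableEmbedding.subtype_coe hs).measurableSet_image.2 hpre)
    (by rintro _ ⟨x, -, rfl⟩; exact x.2)]
  congr 1
  ext y
  simp only [mem_image, mem_preimage, Set.domRestrict_apply, Subtype.exists, exists_and_right,
    exists_eq_right, mem_inter_iff]
  constructor
  · rintro ⟨x, ⟨hx, hxt⟩, rfl⟩; exact ⟨hxt, x, hx, rfl⟩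
  · rintro ⟨hyt, x, hx, rfl⟩; exact ⟨x, ⟨hx, hyt⟩, rfl⟩

/-- No regularity of `φ` is needed, since `G` restricted to `s` is a measurable embedding and
transports arbitrary integrals. -/
theorem setIntegral_image_eq_normDet {W : Type*} [NormedAddCommGroup W] [NormedSpace ℝ W]
    {G : U → V} {G' : U → U →L[ℝ] V} {s : Set U}
    {J : U → ℝ} (hs : MeasurableSet s) (hG : ∀ x ∈ s, HasStrictFDerivAt G (G' x) x)
    (hinj : InjOn G s)
    (hJc : ContinuousOn J s) (hJ : ∀ x ∈ s, J x = (G' x : U →ₗ[ℝ] V).normDet)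
    (hJ0 : ∀ x ∈ s, 0 < J x) (φ : V → W) :
    ∫ y in G '' s, φ y ∂μHE[Module.finrank ℝ U] = ∫ x in s, J x • φ (G x) := by
  have hGc : ContinuousOn G s := fun x hx => (hG x hx).continuousAt.continuousWithinAt
  have hemb : MeasurableEmbedding (s.domRestrict G) := hGc.measurableEmbedding hs hinj
  rw [← map_withDensity_eq_euclideanHausdorffMeasure hs hG hinj hJc hJ hJ0, hemb.integral_map]
  simp only [Set.domRestrict_apply, ← Function.comp_apply (f := φ), ENNReal.ofReal]
  rw [← (MeasurableEmbedding.subtype_coe hs).integral_map, map_comap_subtype_coe hs,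
    setIntegral_withDensity_eq_setIntegral_smul₀ (hJc.aemeasurable hs).real_toNNReal _ hs]
  refine setIntegral_congr_fun hs fun x hx => ?_
  simp [NNReal.smul_def, Real.coe_toNNReal _ (hJ0 x hx).le]

/-- The regular zero set of a differentiable function is negligible. -/
theorem volume_zero_set_eq_zero {h : U → ℝ} {h' : U → U →L[ℝ] ℝ} {Z : Set U}
    (hZ : ∀ x ∈ Z, h x = 0) (hd : ∀ x ∈ Z, HasFDerivAt h (h' x) x) (hne : ∀ x ∈ Z, h' x ≠ 0) :
    volume Z = 0 := by
  have hw : ∀ x ∈ Z, ∃ w, h' x w = 1 := by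
    intro x hx
    obtain ⟨w, hw⟩ : ∃ w, h' x w ≠ 0 := by
      by_contra! hcon; exact hne x hx (ContinuousLinearMap.ext hcon)
    exact ⟨(h' x w)⁻¹ • w, by simp [hw]⟩
  -- Since `h` vanishes on `Z`, the identity also has the derivative id - h'(x) ⊗ w(x) within `Z`.
  -- This map kills w(x), so its determinant vanishes, and the image of `Z` under the identity is
  -- null.
  choose! w hw using hw
  have := addHaar_image_eq_zero_of_det_fderivWithin_eq_zero volume (f := id) (s := Z)
    (f' := fun x => ContinuousLinearMap.id ℝ U - (h' x).smulRight (w x)) ?_ ?_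
  · simpa using this
  · intro x hx
    have h0 : HasFDerivWithinAt (fun _ : U => (0 : ℝ)) (h' x) Z x :=
      (hd x hx).hasFDerivWithinAt.congr (fun y hy => (hZ y hy).symm) (hZ x hx).symm
    have h1 := (hasFDerivWithinAt_id x Z).sub (h0.smul_const (w x))
    refine h1.congr (fun y _ => by simp) (by simp)
  · intro x hx
    rw [ContinuousLinearMap.det, LinearMap.det_eq_zero_iff_ker_ne_bot]
    intro hbot
    have hmem : w x ∈ ((ContinuousLinearMap.id ℝ U - (h' x).smulRight (w x) : U →L[ℝ] U) :
        U →ₗ[ℝ] U).ker := by simp [hw x hx]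
    rw [hbot, Submodule.mem_bot] at hmem
    have := hw x hx
    rw [hmem, map_zero] at this
    exact zero_ne_one this

end Area

/-! ### The divergence theorem on a domain with transverse corners -/

section Stokes

variable {E : Type*} [NormedAddCommGroup E] [InnerProductSpace ℝ E]

theorem inner_eq_zero_of_mem_orthogonal_span {v : E} (x : (ℝ ∙ v)ᗮ) : inner ℝ v (x : E) = 0 :=
  Submodule.mem_orthogonal_singleton_iff_inner_right.1 x.2

variable [FiniteDimensional ℝ E]

/-- Orthogonal coordinates `(x, t) ↦ x + t v` given by a unit vector `v`. -/
def orthCoord (v : E) (hv : ‖v‖ = 1) : WithLp 2 ((ℝ ∙ v)ᗮ × ℝ) ≃ₗᵢ[ℝ] E :=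
  LinearIsometry.toLinearIsometryEquiv
    { toFun := fun z => (z.fst : E) + z.snd • v
      map_add' := fun z w => by
        change ((z.fst + w.fst : (ℝ ∙ v)ᗮ) : E) + (z.snd + w.snd) • v = _
        rw [Submodule.coe_add, add_smul]; abel
      map_smul' := fun c z => by
        change ((c • z.fst : (ℝ ∙ v)ᗮ) : E) + (c * z.snd) • v = c • ((z.fst : E) + z.snd • v)
        rw [Submodule.coe_smul, mul_smul, smul_add]
      norm_map' := fun z => by
        have h0 : inner ℝ (z.fst : E) (z.snd • v) = 0 := by
          rw [inner_smul_right, real_inner_comm, inner_eq_zero_of_mem_orthogonal_span, mul_zero]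
        rw [← sq_eq_sq₀ (norm_nonneg _) (norm_nonneg _), WithLp.prod_norm_sq_eq_of_L2]
        have := norm_add_sq_eq_norm_sq_add_norm_sq_of_inner_eq_zero _ _ h0
        simp only [LinearMap.coe_mk, AddHom.coe_mk]
        rw [sq, this, norm_smul, hv]
        simp [sq] }
    (by
      have h1 : Module.finrank ℝ (ℝ ∙ v) = 1 :=
        finrank_span_singleton (by rintro rfl; simp at hv)
      have h2 := (ℝ ∙ v).finrank_add_finrank_orthogonal
      have h3 : Module.finrank ℝ (WithLp 2 ((ℝ ∙ v)ᗮ × ℝ)) = Module.finrank ℝ ((ℝ ∙ v)ᗮ × ℝ) :=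
        (WithLp.linearEquiv 2 ℝ ((ℝ ∙ v)ᗮ × ℝ)).finrank_eq
      rw [h3, Module.finrank_prod, Module.finrank_self]
      omega)

/-- `orthCoord` as a continuous linear equivalence with the product space. -/
def orthProd (v : E) (hv : ‖v‖ = 1) : ((ℝ ∙ v)ᗮ × ℝ) ≃L[ℝ] E :=
  (WithLp.prodContinuousLinearEquiv 2 ℝ (ℝ ∙ v)ᗮ ℝ).symm.trans
    (orthCoord v hv).toContinuousLinearEquiv

@[simp]
theorem orthProd_apply (v : E) (hv : ‖v‖ = 1) (z : (ℝ ∙ v)ᗮ × ℝ) :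
    orthProd v hv z = (z.1 : E) + z.2 • v := rfl

theorem measurePreserving_orthProd [MeasurableSpace E] [BorelSpace E] (v : E) (hv : ‖v‖ = 1) :
    MeasurePreserving (orthProd v hv) := by
  have h1 := (orthCoord v hv).measurePreserving
  have h2 := WithLp.volume_preserving_toLp (ℝ ∙ v)ᗮ ℝ
  exact h1.comp h2

/-- The Jacobian of the parametrization of a graph over `v^⊥`, when the tangent space is `ker l`. -/
theorem normDet_graph {v : E} (hv : ‖v‖ = 1) {l : E →L[ℝ] ℝ} (hl : 0 < l v)
    {a : (ℝ ∙ v)ᗮ →L[ℝ] ℝ} (ha : ∀ ξ : (ℝ ∙ v)ᗮ, l ξ + a ξ * l v = 0) :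
    (((ℝ ∙ v)ᗮ.subtypeL + a.smulRight v : (ℝ ∙ v)ᗮ →L[ℝ] E) : (ℝ ∙ v)ᗮ →ₗ[ℝ] E).normDet =
      ‖l‖ / l v := by
  classical
  set b := stdOrthonormalBasis ℝ (ℝ ∙ v)ᗮ
  set L := (((ℝ ∙ v)ᗮ.subtypeL + a.smulRight v : (ℝ ∙ v)ᗮ →L[ℝ] E) : (ℝ ∙ v)ᗮ →ₗ[ℝ] E) with hL
  have hvv : inner ℝ v v = (1 : ℝ) := by rw [real_inner_self_eq_norm_sq, hv]; norm_num
  -- The Gram matrix is I + aaᵀ, with determinant 1 + |a|². If `l` is represented by ξ + tv, then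
  -- `ha` says ξ = -ta, so |l|² = t²(1 + |a|²) while l(v) = t.
  have hgram : Matrix.gram ℝ (fun i => L (b i)) =
      1 + Matrix.replicateCol Unit (fun i => a (b i)) * Matrix.replicateRow Unit (fun i => a (b i)) := by
    ext i j
    have hij : inner ℝ (b i : E) (b j : E) = (1 : Matrix _ _ ℝ) i j := by
      have := orthonormal_iff_ite.1 b.orthonormal i j
      rw [Submodule.coe_inner] at this
      rw [this, Matrix.one_apply]
    have hi := inner_eq_zero_of_mem_orthogonal_span (b i)
    have hj := inner_eq_zero_of_mem_orthogonal_span (b j)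
    simp [Matrix.gram, hL, inner_add_left, inner_add_right, inner_smul_left, inner_smul_right, hij,
      hj, real_inner_comm v, hi, Matrix.mul_apply, hv, mul_comm]
  have h1 : L.normDet ^ 2 = 1 + ∑ i, a (b i) ^ 2 := by
    have := L.normDet_sq_eq_det_gram b
    rw [hgram, Matrix.det_one_add_replicateCol_mul_replicateRow] at this
    simpa [dotProduct, sq] using this
  obtain ⟨w, rfl⟩ := (InnerProductSpace.toDual ℝ E).surjective l
  have hwn : ‖(InnerProductSpace.toDual ℝ E) w‖ = ‖w‖ := LinearIsometryEquiv.norm_map _ _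
  simp only [InnerProductSpace.toDual_apply_apply] at hl ha
  obtain ⟨⟨ξ, t⟩, hw⟩ := (orthProd v hv).surjective w
  simp only [orthProd_apply] at hw
  have hwv : inner ℝ w v = t := by
    rw [← hw, inner_add_left, inner_smul_left, hvv, real_inner_comm,
      inner_eq_zero_of_mem_orthogonal_span]; simp
  have hwξ : ∀ ζ : (ℝ ∙ v)ᗮ, inner ℝ w (ζ : E) = inner ℝ ξ ζ := by
    intro ζ
    rw [← hw, inner_add_left, inner_smul_left, inner_eq_zero_of_mem_orthogonal_span, mul_zero,
      add_zero]; rfl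
  have h2 : ‖w‖ ^ 2 = ‖ξ‖ ^ 2 + t ^ 2 := by
    have h0 : inner ℝ (ξ : E) (t • v) = 0 := by
      rw [inner_smul_right, real_inner_comm, inner_eq_zero_of_mem_orthogonal_span, mul_zero]
    rw [← hw, sq, norm_add_sq_eq_norm_sq_add_norm_sq_of_inner_eq_zero _ _ h0, norm_smul, hv]
    simp [sq]
  have h3 : ‖ξ‖ ^ 2 = t ^ 2 * ∑ i, a (b i) ^ 2 := by
    rw [← b.sum_sq_norm_inner_left ξ, Finset.mul_sum]
    refine Finset.sum_congr rfl fun i _ => ?_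
    have := ha (b i)
    rw [hwv, hwξ] at this
    rw [Real.norm_eq_abs, sq_abs, ← mul_pow]
    rw [show inner ℝ ξ (b i) = -(a (b i) * t) by linarith]
    ring
  rw [InnerProductSpace.toDual_apply_apply, hwv, hwn, ← sq_eq_sq₀ (LinearMap.normDet_nonneg _)
    (by rw [hwv] at hl; positivity), h1, div_pow, h2, h3]
  rw [hwv] at hl
  field_simp
  ring

/-- The zero set of `r` in a box is a `C¹` graph in the direction `v`. -/
theorem exists_graph {v p : E} (hv : ‖v‖ = 1) {O : Set E} (hO : IsOpen O) {r : E → ℝ}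
    (hr : ContDiffOn ℝ 1 r O) (hrv : ∀ y ∈ O, 0 < fderiv ℝ r y v) {a δ : ℝ} (ha : 0 < a)
    (hbox : ∀ x : (ℝ ∙ v)ᗮ, ‖x‖ < δ → ∀ t ∈ Icc (-a) a, p + (x : E) + t • v ∈ O)
    (hneg : ∀ x : (ℝ ∙ v)ᗮ, ‖x‖ < δ → r (p + (x : E) + (-a) • v) < 0)
    (hpos : ∀ x : (ℝ ∙ v)ᗮ, ‖x‖ < δ → 0 < r (p + (x : E) + a • v)) :
    ∃ g : (ℝ ∙ v)ᗮ → ℝ, ∀ x : (ℝ ∙ v)ᗮ, ‖x‖ < δ → g x ∈ Ioo (-a) a ∧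
      (∀ t ∈ Icc (-a) a, (r (p + (x : E) + t • v) < 0 ↔ t < g x) ∧
        (r (p + (x : E) + t • v) = 0 ↔ t = g x)) ∧
      ∃ g' : (ℝ ∙ v)ᗮ →L[ℝ] ℝ, HasStrictFDerivAt g g' x ∧
        ∀ ξ : (ℝ ∙ v)ᗮ, fderiv ℝ r (p + (x : E) + g x • v) ξ +
          g' ξ * fderiv ℝ r (p + (x : E) + g x • v) v = 0 := by
  have hstrict : ∀ y ∈ O, HasStrictFDerivAt r (fderiv ℝ r y) y := fun y hy =>
    (hr.contDiffAt (hO.mem_nhds hy)).hasStrictFDerivAt one_ne_zero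
  have hline : ∀ x : (ℝ ∙ v)ᗮ, ‖x‖ < δ → ∀ t ∈ Icc (-a) a,
      HasDerivAt (fun t : ℝ => r (p + (x : E) + t • v)) (fderiv ℝ r (p + (x : E) + t • v) v) t := by
    intro x hx t ht
    have h1 := (hstrict _ (hbox x hx t ht)).hasFDerivAt
    have h2 : HasDerivAt (fun t : ℝ => p + (x : E) + t • v) v t := by
      simpa using ((hasDerivAt_id t).smul_const v).const_add (p + (x : E))
    exact h1.comp_hasDerivAt t h2
  have hmono : ∀ x : (ℝ ∙ v)ᗮ, ‖x‖ < δ →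
      StrictMonoOn (fun t : ℝ => r (p + (x : E) + t • v)) (Icc (-a) a) := by
    intro x hx
    refine strictMonoOn_of_deriv_pos (convex_Icc _ _)
      (fun t ht => (hline x hx t ht).continuousAt.continuousWithinAt) fun t ht => ?_
    rw [(hline x hx t (interior_subset ht)).deriv]
    exact hrv _ (hbox x hx t (interior_subset ht))
  have hex : ∀ x : (ℝ ∙ v)ᗮ, ‖x‖ < δ → ∃ t ∈ Ioo (-a) a, r (p + (x : E) + t • v) = 0 := by
    intro x hx
    have := intermediate_value_Ioo (by linarith : -a ≤ a)
      (fun t ht => (hline x hx t ht).continuousAt.continuousWithinAt)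
    obtain ⟨t, ht, h⟩ := this ⟨hneg x hx, hpos x hx⟩
    exact ⟨t, ht, h⟩
  choose! g hg hg0 using hex
  refine ⟨g, fun x hx => ⟨hg x hx, fun t ht => ⟨?_, ?_⟩, ?_⟩⟩
  · rw [← hg0 x hx]; exact (hmono x hx).lt_iff_lt ht (Ioo_subset_Icc_self (hg x hx))
  · rw [← hg0 x hx]; exact (hmono x hx).eq_iff_eq ht (Ioo_subset_Icc_self (hg x hx))
  · have hy := hbox x hx _ (Ioo_subset_Icc_self (hg x hx))
    set y := p + (x : E) + g x • v with hydef
    let A : ((ℝ ∙ v)ᗮ × ℝ) →L[ℝ] E := (orthProd v hv : ((ℝ ∙ v)ᗮ × ℝ) →L[ℝ] E)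
    have hA : HasStrictFDerivAt (fun z : (ℝ ∙ v)ᗮ × ℝ => p + (z.1 : E) + z.2 • v) A (x, g x) := by
      have := (A.hasStrictFDerivAt (x := (x, g x))).const_add p
      refine this.congr_of_eventuallyEq (Eventually.of_forall fun z => ?_)
      simp [A, add_assoc]
    have hf : HasStrictFDerivAt (fun z : (ℝ ∙ v)ᗮ × ℝ => r (p + (z.1 : E) + z.2 • v))
        (fderiv ℝ r y ∘L A) (x, g x) := (hstrict y hy).comp (x, g x) hA
    have hAinr : ∀ s : ℝ, ((fderiv ℝ r y ∘L A) ∘L .inr ℝ (ℝ ∙ v)ᗮ ℝ) s = fderiv ℝ r y v * s := by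
      intro s; simp [A, mul_comm]
    have hinv : ((fderiv ℝ r y ∘L A) ∘L .inr ℝ (ℝ ∙ v)ᗮ ℝ).IsInvertible := by
      refine ⟨ContinuousLinearEquiv.unitsEquivAut ℝ (Units.mk0 _ (hrv y hy).ne'), ?_⟩
      ext
      rw [hAinr]
      simp [mul_comm]
    have hψ := hf.hasStrictFDerivAt_implicitFunctionOfProdDomain hinv
    -- `g` was merely chosen pointwise. Strict monotonicity along `v` makes the zero in the box
    -- unique, which identifies `g` with the smooth implicit function.
    have hev : g =ᶠ[𝓝 x] hf.implicitFunctionOfProdDomain hinv := by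
      have h1 := hf.eventually_apply_implicitFunctionOfProdDomain hinv
      have h2 := (hf.tendsto_implicitFunctionOfProdDomain hinv).eventually
        (Ioo_mem_nhds (hg x hx).1 (hg x hx).2)
      have h3 : ∀ᶠ x' : (ℝ ∙ v)ᗮ in 𝓝 x, ‖x'‖ < δ :=
        continuous_norm.continuousAt.eventually (gt_mem_nhds hx)
      filter_upwards [h1, h2, h3] with x' h1 h2 h3
      refine (hmono x' h3).injOn (Ioo_subset_Icc_self (hg x' h3)) (Ioo_subset_Icc_self h2) ?_
      rw [hg0 x' h3, h1]
      exact (hg0 x hx).symm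
    have hg' := hψ.congr_of_eventuallyEq hev.symm
    refine ⟨_, hg', fun ξ => ?_⟩
    -- differentiate `r (G x) = 0`
    set g' := -((fderiv ℝ r y ∘L A) ∘L .inr ℝ (ℝ ∙ v)ᗮ ℝ).inverse ∘L
      ((fderiv ℝ r y ∘L A) ∘L .inl ℝ (ℝ ∙ v)ᗮ ℝ)
    have hcomp : HasFDerivAt (fun x' : (ℝ ∙ v)ᗮ => r (p + (x' : E) + g x' • v))
        ((fderiv ℝ r y ∘L A) ∘L (ContinuousLinearMap.id ℝ (ℝ ∙ v)ᗮ).prod g') x :=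
      HasFDerivAt.comp x (f := fun x' : (ℝ ∙ v)ᗮ => (x', g x')) hf.hasFDerivAt
        ((hasFDerivAt_id x).prodMk hg'.hasFDerivAt)
    have hzero : (fun x' : (ℝ ∙ v)ᗮ => r (p + (x' : E) + g x' • v)) =ᶠ[𝓝 x] fun _ => 0 := by
      have h3 : ∀ᶠ x' : (ℝ ∙ v)ᗮ in 𝓝 x, ‖x'‖ < δ :=
        continuous_norm.continuousAt.eventually (gt_mem_nhds hx)
      filter_upwards [h3] with x' h3 using hg0 x' h3
    have h0 := hcomp.unique ((hasFDerivAt_const (0 : ℝ) x).congr_of_eventuallyEq hzero)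
    have := congr($h0 ξ)
    simpa [A] using this

end Stokes

section Stokes

variable {E : Type*} [NormedAddCommGroup E]

/-- The part in `O` of the domain with corners `⋂ⱼ {rⱼ < 0}`. -/
def cornerDomain {ι : Type*} (r : ι → E → ℝ) (O : Set E) : Set E := {y ∈ O | ∀ j, r j y < 0}

/-- The part in `O` of the face `{rⱼ = 0}` of the domain with corners `⋂ⱼ {rⱼ < 0}`. -/
def cornerFace {ι : Type*} (r : ι → E → ℝ) (O : Set E) (j : ι) : Set E :=
  {y ∈ O | r j y = 0 ∧ ∀ i, r i y ≤ 0}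

variable [InnerProductSpace ℝ E] [FiniteDimensional ℝ E] [MeasurableSpace E] [BorelSpace E]

/-- A box around `p` with an axis `v`, in which all `rⱼ` are increasing along `v`. -/
theorem exists_box {ι : Type*} [Finite ι] {v p : E} {O : Set E} (hO : IsOpen O)
    (hp : p ∈ O) {r : ι → E → ℝ} (hr : ∀ j, ContDiffOn ℝ 1 (r j) O)
    (hrv : ∀ j, ∀ y ∈ O, 0 < fderiv ℝ (r j) y v) (hrp : ∀ j, r j p = 0) :
    ∃ a δ : ℝ, 0 < a ∧ 0 < δ ∧
      (∀ x : (ℝ ∙ v)ᗮ, ‖x‖ < δ → ∀ t ∈ Icc (-a) a, p + (x : E) + t • v ∈ O) ∧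
      (∀ j, ∀ x : (ℝ ∙ v)ᗮ, ‖x‖ < δ → r j (p + (x : E) + (-a) • v) < 0) ∧
      (∀ j, ∀ x : (ℝ ∙ v)ᗮ, ‖x‖ < δ → 0 < r j (p + (x : E) + a • v)) := by
  have hcont : Continuous fun z : (ℝ ∙ v)ᗮ × ℝ => p + (z.1 : E) + z.2 • v := by fun_prop
  have hnhds : (fun z : (ℝ ∙ v)ᗮ × ℝ => p + (z.1 : E) + z.2 • v) ⁻¹' O ∈ 𝓝 ((0 : (ℝ ∙ v)ᗮ), (0 : ℝ)) :=
    hcont.continuousAt.preimage_mem_nhds (hO.mem_nhds (by simpa using hp))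
  obtain ⟨η, hη, hball⟩ := Metric.mem_nhds_iff.1 hnhds
  set a := η / 2 with ha
  have ha0 : 0 < a := by positivity
  have hbox : ∀ x : (ℝ ∙ v)ᗮ, ‖x‖ < η → ∀ t ∈ Icc (-a) a, p + (x : E) + t • v ∈ O := by
    intro x hx t ht
    have hmem : (x, t) ∈ Metric.ball ((0 : (ℝ ∙ v)ᗮ), (0 : ℝ)) η := by
      rw [Metric.mem_ball, ← Prod.zero_eq_mk, dist_zero_right, Prod.norm_mk, max_lt_iff]
      refine ⟨hx, ?_⟩
      rw [Real.norm_eq_abs, abs_lt]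
      constructor <;> linarith [ht.1, ht.2]
    exact hball hmem
  have hline : ∀ j, ∀ t ∈ Icc (-a) a,
      HasDerivAt (fun t : ℝ => r j (p + t • v)) (fderiv ℝ (r j) (p + t • v) v) t := by
    intro j t ht
    have hy : p + t • v ∈ O := by simpa using hbox 0 (by simpa using hη) t ht
    have h1 := (((hr j).contDiffAt (hO.mem_nhds hy)).differentiableAt one_ne_zero).hasFDerivAt
    have h2 : HasDerivAt (fun t : ℝ => p + t • v) v t := by
      simpa using ((hasDerivAt_id t).smul_const v).const_add p
    exact h1.comp_hasDerivAt t h2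
  have hmono : ∀ j, StrictMonoOn (fun t : ℝ => r j (p + t • v)) (Icc (-a) a) := by
    intro j
    refine strictMonoOn_of_deriv_pos (convex_Icc _ _)
      (fun t ht => (hline j t ht).continuousAt.continuousWithinAt) fun t ht => ?_
    rw [(hline j t (interior_subset ht)).deriv]
    exact hrv j _ (by simpa using hbox 0 (by simpa using hη) t (interior_subset ht))
  have hneg : ∀ j, r j (p + (-a) • v) < 0 := by
    intro j
    have := hmono j ⟨le_rfl, by linarith⟩ (show (0 : ℝ) ∈ Icc (-a) a from ⟨by linarith, ha0.le⟩)
      (by linarith)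
    simpa [hrp] using this
  have hpos : ∀ j, 0 < r j (p + a • v) := by
    intro j
    have := hmono j (show (0 : ℝ) ∈ Icc (-a) a from ⟨by linarith, ha0.le⟩) ⟨by linarith, le_rfl⟩
      ha0
    simpa [hrp] using this
  have hct : ∀ j, ∀ t ∈ Icc (-a) a,
      ContinuousAt (fun x : (ℝ ∙ v)ᗮ => r j (p + (x : E) + t • v)) 0 := by
    intro j t ht
    have hy : p + ((0 : (ℝ ∙ v)ᗮ) : E) + t • v ∈ O := hbox 0 (by simpa using hη) t ht
    have h1 := ((hr j).contDiffAt (hO.mem_nhds hy)).continuousAt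
    exact ContinuousAt.comp (f := fun x : (ℝ ∙ v)ᗮ => p + (x : E) + t • v) h1
      (by fun_prop)
  have hev : ∀ᶠ x : (ℝ ∙ v)ᗮ in 𝓝 0, ‖x‖ < η ∧ ∀ j, r j (p + (x : E) + (-a) • v) < 0 ∧
      0 < r j (p + (x : E) + a • v) := by
    refine Eventually.and ?_ (eventually_all.2 fun j => Eventually.and ?_ ?_)
    · exact continuous_norm.continuousAt.eventually (gt_mem_nhds (by simpa using hη))
    · exact (hct j (-a) ⟨le_rfl, by linarith⟩).eventually (gt_mem_nhds (by simpa using hneg j))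
    · exact (hct j a ⟨by linarith, le_rfl⟩).eventually (lt_mem_nhds (by simpa using hpos j))
  obtain ⟨δ, hδ, h⟩ := Metric.eventually_nhds_iff.1 hev
  refine ⟨a, δ, ha0, hδ, fun x hx => hbox x (h (by simpa using hx)).1,
    fun j x hx => ((h (by simpa using hx)).2 j).1, fun j x hx => ((h (by simpa using hx)).2 j).2⟩

theorem measurableSet_inter_preimage_of_continuousOn {X : Type*} [TopologicalSpace X]
    [MeasurableSpace X] [OpensMeasurableSpace X] {f : X → ℝ} {O : Set X} (hO : IsOpen O)
    (hf : ContinuousOn f O) {s : Set ℝ} (hs : IsClosed s) : MeasurableSet (O ∩ f ⁻¹' s) := by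
  have : O ∩ f ⁻¹' s = O \ (O ∩ f ⁻¹' sᶜ) := by ext y; simp
  rw [this]
  exact hO.measurableSet.diff (hf.isOpen_inter_preimage hO hs.isOpen_compl).measurableSet

theorem isOpen_cornerDomain {ι : Type*} [Finite ι] {r : ι → E → ℝ} {O : Set E} (hO : IsOpen O)
    (hr : ∀ j, ContinuousOn (r j) O) : IsOpen (cornerDomain r O) := by
  have : cornerDomain r O = O ∩ ⋂ j, (O ∩ r j ⁻¹' Iio 0) := by
    ext y; simp only [cornerDomain, mem_ofPred_eq, mem_inter_iff, mem_iInter, mem_preimage, mem_Iio]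
    exact ⟨fun h => ⟨h.1, fun j => ⟨h.1, h.2 j⟩⟩, fun h => ⟨h.1, fun j => (h.2 j).2⟩⟩
  rw [this]
  exact hO.inter (isOpen_iInter_of_finite fun j => (hr j).isOpen_inter_preimage hO isOpen_Iio)

theorem measurableSet_cornerFace {ι : Type*} [Finite ι] {r : ι → E → ℝ} {O : Set E} (hO : IsOpen O)
    (hr : ∀ j, ContinuousOn (r j) O) (j : ι) : MeasurableSet (cornerFace r O j) := by
  have : cornerFace r O j = O ∩ (O ∩ r j ⁻¹' {0}) ∩ ⋂ j, (O ∩ r j ⁻¹' Iic 0) := by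
    ext y
    simp only [cornerFace, mem_ofPred_eq, mem_inter_iff, mem_iInter, mem_preimage, mem_Iic,
      mem_singleton_iff]
    exact ⟨fun h => ⟨⟨h.1, h.1, h.2.1⟩, fun j => ⟨h.1, h.2.2 j⟩⟩,
      fun h => ⟨h.1.1, h.1.2.2, fun j => (h.2 j).2⟩⟩
  rw [this]
  have : Countable ι := Finite.to_countable
  exact (hO.measurableSet.inter
    (measurableSet_inter_preimage_of_continuousOn hO (hr j) isClosed_singleton)).inter
    (MeasurableSet.iInter fun j => measurableSet_inter_preimage_of_continuousOn hO (hr j) isClosed_Iic)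

/-- Divergence theorem near a transverse corner, for a vector field of constant direction `v`
which is transverse to all faces. -/
theorem stokes_of_transverse {ι : Type*} [Fintype ι] [Nonempty ι] {k : ℕ}
    (hk : Module.finrank ℝ E = k + 1) {v p : E} (hv : ‖v‖ = 1) {O : Set E} (hO : IsOpen O)
    (hp : p ∈ O) {r : ι → E → ℝ} (hr : ∀ j, ContDiffOn ℝ 1 (r j) O)
    (hrv : ∀ j, ∀ y ∈ O, 0 < fderiv ℝ (r j) y v) (hrp : ∀ j, r j p = 0)
    (hpair : ∀ i j, i ≠ j → ∀ y ∈ O,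
      fderiv ℝ (r i) y v • fderiv ℝ (r j) y ≠ fderiv ℝ (r j) y v • fderiv ℝ (r i) y) :
    ∃ W ⊆ O, IsOpen W ∧ p ∈ W ∧
      (∀ j, ∀ K ⊆ W, IsCompact K → μHE[k] (cornerFace r O j ∩ K) < ⊤) ∧
      ∀ h : E → ℂ, ContDiff ℝ 1 h → HasCompactSupport h → tsupport h ⊆ W →
        ∫ y in cornerDomain r O, fderiv ℝ h y v =
          ∑ j, ∫ y in cornerFace r O j,
            ((‖fderiv ℝ (r j) y‖⁻¹ * fderiv ℝ (r j) y v : ℝ) : ℂ) * h y ∂μHE[k] := by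
  obtain ⟨a, δ, ha, hδ, hbox, hneg, hpos⟩ := exists_box hO hp hr hrv hrp
  choose g hg using fun j => exists_graph hv hO (hr j) (hrv j) ha hbox (hneg j) (hpos j)
  have hfin : Module.finrank ℝ (ℝ ∙ v)ᗮ = k := by
    have h1 : Module.finrank ℝ (ℝ ∙ v) = 1 := finrank_span_singleton (by rintro rfl; simp at hv)
    have h2 := (ℝ ∙ v).finrank_add_finrank_orthogonal
    omega
  let B : Set (ℝ ∙ v)ᗮ := Metric.ball 0 δ
  have hB : ∀ x, x ∈ B ↔ ‖x‖ < δ := fun x => by simp [B]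
  choose! g' hg' hg'0 using fun j x hx => (hg j x hx).2.2
  have hgI : ∀ j x, x ∈ B → g j x ∈ Ioo (-a) a := fun j x hx => (hg j x ((hB x).1 hx)).1
  let G : ι → (ℝ ∙ v)ᗮ → E := fun j x => p + (x : E) + g j x • v
  have hGO : ∀ j x, x ∈ B → G j x ∈ O := fun j x hx =>
    hbox x ((hB x).1 hx) _ (Ioo_subset_Icc_self (hgI j x hx))
  let G' : ι → (ℝ ∙ v)ᗮ → (ℝ ∙ v)ᗮ →L[ℝ] E := fun j x => (ℝ ∙ v)ᗮ.subtypeL + (g' j x).smulRight v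
  have hGd : ∀ j, ∀ x ∈ B, HasStrictFDerivAt (G j) (G' j x) x := fun j x hx =>
    ((((ℝ ∙ v)ᗮ.subtypeL).hasStrictFDerivAt).const_add p).add
      ((hg' j x ((hB x).1 hx)).smul_const v)
  let J : ι → (ℝ ∙ v)ᗮ → ℝ := fun j x => ‖fderiv ℝ (r j) (G j x)‖ / fderiv ℝ (r j) (G j x) v
  have hrc : ∀ j, ContinuousOn (r j) O := fun j => (hr j).continuousOn
  have hGc : ∀ j, ContinuousOn (G j) B := fun j x hx =>
    (hGd j x hx).continuousAt.continuousWithinAt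
  have hgc : ∀ j, ContinuousOn (g j) B := fun j x hx =>
    (hg' j x ((hB x).1 hx)).continuousAt.continuousWithinAt
  have hdc : ∀ j, ContinuousOn (fun x => fderiv ℝ (r j) (G j x)) B := fun j =>
    ((hr j).continuousOn_fderiv_of_isOpen hO le_rfl).comp (hGc j) (hGO j)
  have hJc : ∀ j, ContinuousOn (J j) B := fun j =>
    (hdc j).norm.div ((hdc j).clm_apply continuousOn_const)
      fun x hx => (hrv j _ (hGO j x hx)).ne'
  have hJ : ∀ j, ∀ x ∈ B, J j x = (G' j x : (ℝ ∙ v)ᗮ →ₗ[ℝ] E).normDet := fun j x hx =>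
    (normDet_graph hv (hrv j _ (hGO j x hx)) (hg'0 j x ((hB x).1 hx))).symm
  have hdn : ∀ j, ∀ y ∈ O, 0 < ‖fderiv ℝ (r j) y‖ := fun j y hy => by
    rw [norm_pos_iff]; intro h; have := hrv j y hy; simp [h] at this
  have hJ0 : ∀ j, ∀ x ∈ B, 0 < J j x := fun j x hx =>
    div_pos (hdn j _ (hGO j x hx)) (hrv j _ (hGO j x hx))
  -- the coordinates of the box
  let Φ : (ℝ ∙ v)ᗮ × ℝ ≃ₜ E := (orthProd v hv).toHomeomorph.trans (Homeomorph.addLeft p)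
  have hΦ : ∀ z, Φ z = p + (z.1 : E) + z.2 • v := fun z => by simp [Φ, add_assoc]
  have hΦm : MeasurePreserving Φ :=
    (measurePreserving_add_left (volume : Measure E) p).comp (measurePreserving_orthProd v hv)
  have hGΦ : ∀ j x, Φ (x, g j x) = G j x := fun j x => hΦ _
  have hGinj : ∀ j, Function.Injective (G j) := fun j x x' h => by
    rw [← hGΦ, ← hGΦ] at h; exact congrArg Prod.fst (Φ.injective h)
  let W : Set E := Φ.symm ⁻¹' (B ×ˢ Ioo (-a) a)
  have hWmem : ∀ x t, Φ (x, t) ∈ W ↔ x ∈ B ∧ t ∈ Ioo (-a) a := fun x t => by simp [W]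
  have hWO : W ⊆ O := by
    intro y hy
    obtain ⟨⟨x, t⟩, rfl⟩ := Φ.surjective y
    rw [hWmem] at hy
    rw [hΦ]
    exact hbox _ ((hB _).1 hy.1) _ (Ioo_subset_Icc_self hy.2)
  have hWopen : IsOpen W := (Metric.isOpen_ball.prod isOpen_Ioo).preimage Φ.symm.continuous
  have hpW : p ∈ W := by
    have : p = Φ (0, 0) := by simp [hΦ]
    rw [this, hWmem]
    exact ⟨by simp [B, hδ], by simp [ha]⟩
  have hrsign : ∀ j x t, x ∈ B → t ∈ Ioo (-a) a → (r j (Φ (x, t)) < 0 ↔ t < g j x) ∧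
      (r j (Φ (x, t)) = 0 ↔ t = g j x) ∧ (r j (Φ (x, t)) ≤ 0 ↔ t ≤ g j x) := by
    intro j x t hx ht
    have := (hg j x ((hB x).1 hx)).2.1 t (Ioo_subset_Icc_self ht)
    rw [hΦ]
    refine ⟨this.1, this.2, ?_⟩
    rw [le_iff_lt_or_eq, le_iff_lt_or_eq, this.1, this.2]
  -- the faces
  let A : ι → Set (ℝ ∙ v)ᗮ := fun j => {x ∈ B | ∀ i, g j x ≤ g i x}
  have hAB : ∀ j, A j ⊆ B := fun j x hx => hx.1
  have hAm : ∀ j, MeasurableSet (A j) := by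
    intro j
    have : A j = B ∩ ⋂ i, (B ∩ (fun x => g j x - g i x) ⁻¹' Iic 0) := by
      ext x
      simp only [A, mem_ofPred_eq, mem_inter_iff, mem_iInter, mem_preimage, mem_Iic, sub_nonpos]
      exact ⟨fun h => ⟨h.1, fun i => ⟨h.1, h.2 i⟩⟩, fun h => ⟨h.1, fun i => (h.2 i).2⟩⟩
    rw [this]
    exact Metric.isOpen_ball.measurableSet.inter (MeasurableSet.iInter fun i =>
      measurableSet_inter_preimage_of_continuousOn Metric.isOpen_ball ((hgc j).sub (hgc i))
        isClosed_Iic)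
  have hface : ∀ j, G j '' A j = cornerFace r O j ∩ W := by
    intro j
    ext y
    obtain ⟨⟨x, t⟩, rfl⟩ := Φ.surjective y
    constructor
    · rintro ⟨x', hx', hxy⟩
      rw [← hGΦ] at hxy
      rw [← hxy]
      have hW' : Φ (x', g j x') ∈ W := (hWmem _ _).2 ⟨hx'.1, hgI j x' hx'.1⟩
      refine ⟨⟨hWO hW', ?_, fun i => ?_⟩, hW'⟩
      · exact (hrsign j x' _ hx'.1 (hgI j x' hx'.1)).2.1.2 rfl
      · exact (hrsign i x' _ hx'.1 (hgI j x' hx'.1)).2.2.2 (hx'.2 i)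
    · rintro ⟨⟨-, h0, hle⟩, hW'⟩
      rw [hWmem] at hW'
      have ht := (hrsign j x t hW'.1 hW'.2).2.1.1 h0
      refine ⟨x, ⟨hW'.1, fun i => ?_⟩, ?_⟩
      · rw [← ht]; exact (hrsign i x t hW'.1 hW'.2).2.2.1 (hle i)
      · rw [← hGΦ, ← ht]
  refine ⟨W, hWO, hWopen, hpW, ?_, ?_⟩
  · intro j K hKW hK
    let πK : Set (ℝ ∙ v)ᗮ := (fun y => (Φ.symm y).1) '' K
    have hπK : IsCompact πK := hK.image (by fun_prop)
    have hπB : πK ⊆ B := by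
      rintro _ ⟨y, hy, rfl⟩; exact (hKW hy).1
    have hsub : cornerFace r O j ∩ K ⊆ G j '' πK := by
      rintro y ⟨hy, hyK⟩
      obtain ⟨x, hx, rfl⟩ : y ∈ G j '' A j := (hface j) ▸ ⟨hy, hKW hyK⟩
      refine ⟨x, ⟨_, hyK, ?_⟩, rfl⟩
      simp [← hGΦ]
    refine (measure_mono hsub).trans_lt ?_
    rw [← hfin, euclideanHausdorffMeasure_image_eq_lintegral (hGd j) (hGinj j).injOn (hJc j) (hJ j)
      (hJ0 j) hπK.measurableSet hπB]
    exact (((hJc j).mono hπB).integrableOn_compact hπK).lintegral_lt_top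
  intro h hh hhc hhW
  have hh0 : ∀ y ∉ W, h y = 0 := fun y hy => image_eq_zero_of_notMem_tsupport fun h => hy (hhW h)
  have hdh0 : ∀ y ∉ W, fderiv ℝ h y = 0 := fun y hy =>
    fderiv_of_notMem_tsupport ℝ fun h => hy (hhW h)
  have hne : (Finset.univ : Finset ι).Nonempty := Finset.univ_nonempty
  let gm : (ℝ ∙ v)ᗮ → ℝ := fun x => Finset.univ.inf' hne fun j => g j x
  have hgmI : ∀ x ∈ B, gm x ∈ Ioo (-a) a := by
    intro x hx
    obtain ⟨j, -, hj⟩ := Finset.exists_mem_eq_inf' hne fun j => g j x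
    simp only [gm, hj]; exact hgI j x hx
  have hgmc : ContinuousOn gm B := ContinuousOn.finset_inf'_apply hne fun j _ => hgc j
  let H : (ℝ ∙ v)ᗮ → ℂ := fun x => h (Φ (x, gm x))
  have hHc : ContinuousOn H B :=
    hh.continuous.comp_continuousOn (Φ.continuous.comp_continuousOn (continuousOn_id.prodMk hgmc))
  obtain ⟨C, hC⟩ := hhc.exists_bound_of_continuous hh.continuous
  have hHint : IntegrableOn H B := by
    refine ⟨hHc.aestronglyMeasurable Metric.isOpen_ball.measurableSet, ?_⟩
    exact HasFiniteIntegral.restrict_of_bounded (C := C) (measure_ball_lt_top) (Eventually.of_forall fun x => hC _)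
  -- Fubini and the fundamental theorem of calculus on each line from t = -a, where `h` vanishes, up
  -- to the lowest graph.
  have hleft : ∫ y in cornerDomain r O, fderiv ℝ h y v = ∫ x in B, H x := by
    have hdhc : Continuous fun y => fderiv ℝ h y v :=
      (hh.continuous_fderiv one_ne_zero).clm_apply continuous_const
    have hCD := isOpen_cornerDomain hO hrc
    let F : (ℝ ∙ v)ᗮ × ℝ → ℂ := fun z =>
      (cornerDomain r O).indicator (fun y => fderiv ℝ h y v) (Φ z)
    have hFint : Integrable F := by
      have h1 : Integrable fun y => fderiv ℝ h y v :=
        hdhc.integrable_of_hasCompactSupport (hhc.fderiv_apply (𝕜 := ℝ) v)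
      exact (hΦm.integrable_comp_emb Φ.measurableEmbedding).2 (h1.indicator hCD.measurableSet)
    have hinner : ∀ x, ∫ t, F (x, t) = B.indicator H x := by
      intro x
      by_cases hx : x ∈ B
      · rw [indicator_of_mem hx]
        have hFx : (fun t => F (x, t)) =
            (Ioo (-a) (gm x)).indicator fun t => fderiv ℝ h (Φ (x, t)) v := by
          ext t
          by_cases ht : t ∈ Ioo (-a) a
          · have hiff : Φ (x, t) ∈ cornerDomain r O ↔ t ∈ Ioo (-a) (gm x) := by
              simp only [cornerDomain, mem_ofPred_eq, mem_Ioo, ht.1, true_and, gm,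
                Finset.lt_inf'_iff, Finset.mem_univ, forall_const]
              rw [and_iff_right (hWO ((hWmem x t).2 ⟨hx, ht⟩))]
              exact forall_congr' fun j => (hrsign j x t hx ht).1
            simp only [F, indicator, hiff]
          · have h0 : fderiv ℝ h (Φ (x, t)) v = 0 := by
              rw [hdh0 _ fun hW' => ht ((hWmem x t).1 hW').2]; rfl
            simp only [F, indicator, h0, ite_self]
        rw [hFx, integral_indicator measurableSet_Ioo, ← integral_Ioc_eq_integral_Ioo,
          ← intervalIntegral.integral_of_le (hgmI x hx).1.le]
        have hd : ∀ t : ℝ, HasDerivAt (fun t => h (Φ (x, t))) (fderiv ℝ h (Φ (x, t)) v) t := by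
          intro t
          have h2 : HasDerivAt (fun t : ℝ => Φ (x, t)) v t := by
            simp only [hΦ]
            simpa using ((hasDerivAt_id t).smul_const v).const_add (p + (x : E))
          exact ((hh.differentiable one_ne_zero).differentiableAt.hasFDerivAt).comp_hasDerivAt t h2
        rw [intervalIntegral.integral_eq_sub_of_hasDerivAt (fun t _ => hd t)
          ((hdhc.comp (Φ.continuous.comp (by fun_prop))).intervalIntegrable _ _)]
        rw [hh0 (Φ (x, -a)) fun hW' => by simpa using ((hWmem _ _).1 hW').2, sub_zero]
      · rw [indicator_of_notMem hx]
        refine integral_eq_zero_of_ae (Eventually.of_forall fun t => ?_)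
        have h0 : fderiv ℝ h (Φ (x, t)) v = 0 := by
          rw [hdh0 _ fun hW' => hx ((hWmem x t).1 hW').1]; rfl
        simp only [F, indicator, h0, ite_self, Pi.zero_apply]
    rw [← integral_indicator hCD.measurableSet, ← hΦm.integral_comp Φ.measurableEmbedding,
      ← integral_indicator Metric.isOpen_ball.measurableSet]
    change ∫ z, F z = _
    rw [Measure.volume_eq_prod, integral_prod _ hFint]
    exact integral_congr_ae (Eventually.of_forall hinner)
  -- The graph has Jacobian |dr|/dr(v), exactly the inverse of the factor dr(v)/|dr| in the flux.
  have hright : ∀ j, ∫ y in cornerFace r O j,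
      ((‖fderiv ℝ (r j) y‖⁻¹ * fderiv ℝ (r j) y v : ℝ) : ℂ) * h y ∂μHE[k] = ∫ x in A j, H x := by
    intro j
    rw [setIntegral_eq_of_subset_of_forall_sdiff_eq_zero (measurableSet_cornerFace hO hrc j)
      (inter_subset_left (t := W)), ← hface j, ← hfin, setIntegral_image_eq_normDet (hAm j)
      (fun x hx => hGd j x hx.1) (hGinj j).injOn ((hJc j).mono (hAB j)) (fun x hx => hJ j x hx.1)
      (fun x hx => hJ0 j x hx.1)]
    · refine setIntegral_congr_fun (hAm j) fun x hx => ?_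
      have hgmx : gm x = g j x :=
        le_antisymm (Finset.inf'_le _ (Finset.mem_univ j)) (Finset.le_inf' _ _ fun i _ => hx.2 i)
      have h1 := hdn j _ (hGO j x hx.1)
      have h2 := hrv j _ (hGO j x hx.1)
      simp only [H, hgmx, hGΦ, J]
      rw [Complex.real_smul, ← mul_assoc, ← Complex.ofReal_mul]
      have : ‖fderiv ℝ (r j) (G j x)‖ / fderiv ℝ (r j) (G j x) v *
          (‖fderiv ℝ (r j) (G j x)‖⁻¹ * fderiv ℝ (r j) (G j x) v) = 1 := by field_simp
      rw [this]; simp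
    · rintro y ⟨hy, hy'⟩
      rw [hh0 y (fun h => hy' ⟨hy, h⟩), mul_zero]
  have hcover : ⋃ j, A j = B := by
    refine subset_antisymm (iUnion_subset hAB) fun x hx => ?_
    obtain ⟨j, -, hj⟩ := Finset.exists_mem_eq_inf' hne fun j => g j x
    exact mem_iUnion.2 ⟨j, hx, fun i => hj ▸ Finset.inf'_le _ (Finset.mem_univ i)⟩
  -- Where g_i = g_j, equality of their gradients would make dr_i and dr_j proportional, against
  -- `hpair`. So the overlap lies in a regular zero set of g_i - g_j.
  have hdisj : Pairwise (Function.onFun (AEDisjoint volume) A) := by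
    intro i j hij
    refine volume_zero_set_eq_zero (h := fun x => g i x - g j x) (h' := fun x => g' i x - g' j x)
      (fun x hx => sub_eq_zero.2 (le_antisymm (hx.1.2 j) (hx.2.2 i)))
      (fun x hx => (hg' i x ((hB x).1 hx.1.1)).hasFDerivAt.sub
        (hg' j x ((hB x).1 hx.1.1)).hasFDerivAt) fun x hx h0 => ?_
    have hxB := hx.1.1
    have hgij : g i x = g j x := le_antisymm (hx.1.2 j) (hx.2.2 i)
    have hGij : G i x = G j x := by simp only [G, hgij]
    refine hpair i j hij _ (hGO i x hxB) ?_
    ext w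
    obtain ⟨⟨ξ, t⟩, rfl⟩ := (orthProd v hv).surjective w
    have h1 := hg'0 i x ((hB x).1 hxB) ξ
    have h2 := hg'0 j x ((hB x).1 hxB) ξ
    have h3 : g' i x = g' j x := sub_eq_zero.1 h0
    change fderiv ℝ (r i) (G i x) ξ + _ * fderiv ℝ (r i) (G i x) v = 0 at h1
    change fderiv ℝ (r j) (G j x) ξ + _ * fderiv ℝ (r j) (G j x) v = 0 at h2
    rw [← hGij, ← h3] at h2
    simp only [orthProd_apply, map_add, map_smul, smul_eq_mul, smul_apply]
    rw [eq_neg_of_add_eq_zero_left h1, eq_neg_of_add_eq_zero_left h2]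
    ring
  rw [hleft, Finset.sum_congr rfl fun j _ => hright j, ← tsum_fintype (L := .unconditional _),
    ← integral_iUnion_ae (fun j => (hAm j).nullMeasurableSet) hdisj (by rwa [hcover]), hcover]

end Stokes

/-! ### Localization of the divergence theorem, and arbitrary directions -/

section Stokes

variable {E : Type*} [NormedAddCommGroup E] [InnerProductSpace ℝ E] [FiniteDimensional ℝ E]
  [MeasurableSpace E] [BorelSpace E]

theorem cornerDomain_inter {ι : Type*} {r : ι → E → ℝ} {O W : Set E} (h : W ⊆ O) :
    cornerDomain r O ∩ W = cornerDomain r W := by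
  ext y; simp only [cornerDomain, mem_inter_iff, mem_ofPred_eq]
  exact ⟨fun h' => ⟨h'.2, h'.1.2⟩, fun h' => ⟨⟨h h'.1, h'.2⟩, h'.1⟩⟩

theorem cornerFace_inter {ι : Type*} {r : ι → E → ℝ} {O W : Set E} (h : W ⊆ O) (j : ι) :
    cornerFace r O j ∩ W = cornerFace r W j := by
  ext y; simp only [cornerFace, mem_inter_iff, mem_ofPred_eq]
  exact ⟨fun h' => ⟨h'.2, h'.1.2⟩, fun h' => ⟨⟨h h'.1, h'.2⟩, h'.1⟩⟩

theorem setIntegral_cornerDomain_of_subset {ι : Type*} [Finite ι] {r : ι → E → ℝ} {O W : Set E}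
    (hO : IsOpen O) (hr : ∀ j, ContinuousOn (r j) O) (h : W ⊆ O) {φ : E → ℂ}
    (hφ : ∀ y ∉ W, φ y = 0) :
    ∫ y in cornerDomain r O, φ y = ∫ y in cornerDomain r W, φ y := by
  rw [← cornerDomain_inter h]
  exact setIntegral_eq_of_subset_of_forall_sdiff_eq_zero (isOpen_cornerDomain hO hr).measurableSet
    inter_subset_left fun y hy => hφ y fun hyW => hy.2 ⟨hy.1, hyW⟩

theorem setIntegral_cornerFace_of_subset {ι : Type*} [Finite ι] {r : ι → E → ℝ} {O W : Set E}
    (hO : IsOpen O) (hr : ∀ j, ContinuousOn (r j) O) (h : W ⊆ O) (j : ι) {φ : E → ℂ}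
    (hφ : ∀ y ∉ W, φ y = 0) (μ : Measure E) :
    ∫ y in cornerFace r O j, φ y ∂μ = ∫ y in cornerFace r W j, φ y ∂μ := by
  rw [← cornerFace_inter h]
  exact setIntegral_eq_of_subset_of_forall_sdiff_eq_zero (measurableSet_cornerFace hO hr j)
    inter_subset_left fun y hy => hφ y fun hyW => hy.2 ⟨hy.1, hyW⟩

theorem integrableOn_cornerFace {ι : Type*} [Finite ι] {r : ι → E → ℝ} {O K : Set E}
    (hO : IsOpen O) (hr : ∀ j, ContinuousOn (r j) O) (j : ι) (hK : IsCompact K) (hKO : K ⊆ O)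
    {μ : Measure E} (hμ : μ (cornerFace r O j ∩ K) < ⊤) {φ : E → ℂ} (hφc : ContinuousOn φ O)
    (hφ : ∀ y ∉ K, φ y = 0) : IntegrableOn φ (cornerFace r O j) μ := by
  have hm := measurableSet_cornerFace hO hr j
  obtain ⟨C, hC⟩ := hK.exists_bound_of_continuousOn (hφc.mono hKO)
  have h1 : IntegrableOn φ (cornerFace r O j ∩ K) μ := by
    refine ⟨((hφc.mono hKO).mono inter_subset_right).aestronglyMeasurable
      (hm.inter hK.measurableSet), ?_⟩
    refine HasFiniteIntegral.restrict_of_bounded (C := C) hμ ?_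
    filter_upwards [ae_restrict_mem (hm.inter hK.measurableSet)] with y hy using hC y hy.2
  exact h1.of_forall_sdiff_eq_zero hm fun y hy => hφ y fun hyK => hy.2 ⟨hy.1, hyK⟩

/-- All conditions at `p` are open, so they persist near `p`, and both sides are homogeneous in `v`,
which may be normalized. Non-proportionality is stated as an inequality between continuous functions
so that it persists too. -/
theorem stokes_of_outward {ι : Type*} [Fintype ι] [Nonempty ι] {k : ℕ}
    (hk : Module.finrank ℝ E = k + 1) {v p : E} {O : Set E} (hO : IsOpen O)
    (hp : p ∈ O) {r : ι → E → ℝ} (hr : ∀ j, ContDiffOn ℝ 1 (r j) O)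
    (hrv : ∀ j, 0 < fderiv ℝ (r j) p v) (hrp : ∀ j, r j p = 0)
    (hpair : ∀ i j, i ≠ j → ∀ c : ℝ, fderiv ℝ (r j) p ≠ c • fderiv ℝ (r i) p) :
    ∃ W ⊆ O, IsOpen W ∧ p ∈ W ∧
      (∀ j, ∀ K ⊆ W, IsCompact K → μHE[k] (cornerFace r O j ∩ K) < ⊤) ∧
      ∀ h : E → ℂ, ContDiff ℝ 1 h → HasCompactSupport h → tsupport h ⊆ W →
        ∫ y in cornerDomain r O, fderiv ℝ h y v =
          ∑ j, ∫ y in cornerFace r O j,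
            ((‖fderiv ℝ (r j) y‖⁻¹ * fderiv ℝ (r j) y v : ℝ) : ℂ) * h y ∂μHE[k] := by
  have hv0 : v ≠ 0 := by
    rintro rfl
    have := hrv (Classical.arbitrary ι)
    simp at this
  have hvn : 0 < ‖v‖ := norm_pos_iff.2 hv0
  set u := ‖v‖⁻¹ • v with hu
  have hun : ‖u‖ = 1 := by rw [hu, norm_smul, norm_inv, norm_norm, inv_mul_cancel₀ hvn.ne']
  have hvu : v = ‖v‖ • u := by rw [hu, smul_smul, mul_inv_cancel₀ hvn.ne', one_smul]
  have hru : ∀ j, 0 < fderiv ℝ (r j) p u := fun j => by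
    rw [hu, map_smul, smul_eq_mul]; exact mul_pos (inv_pos.2 hvn) (hrv j)
  have hdc : ∀ j, ContinuousAt (fderiv ℝ (r j)) p := fun j =>
    ((hr j).continuousOn_fderiv_of_isOpen hO le_rfl).continuousAt (hO.mem_nhds hp)
  have hev : ∀ᶠ y in 𝓝 p, y ∈ O ∧ (∀ j, 0 < fderiv ℝ (r j) y u) ∧ ∀ i j, i ≠ j →
      fderiv ℝ (r i) y u • fderiv ℝ (r j) y ≠ fderiv ℝ (r j) y u • fderiv ℝ (r i) y := by
    refine (hO.eventually_mem hp).and ((eventually_all.2 fun j => ?_).and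
      (eventually_all.2 fun i => eventually_all.2 fun j => ?_))
    · exact ((hdc j).clm_apply continuousAt_const).eventually (lt_mem_nhds (hru j))
    · by_cases hij : i = j
      · simp [hij]
      · have h1 : ContinuousAt (fun y => fderiv ℝ (r i) y u • fderiv ℝ (r j) y) p :=
          ((hdc i).clm_apply continuousAt_const).smul (hdc j)
        have h2 : ContinuousAt (fun y => fderiv ℝ (r j) y u • fderiv ℝ (r i) y) p :=
          ((hdc j).clm_apply continuousAt_const).smul (hdc i)
        refine (h1.ne_iff_eventually_ne h2 |>.1 fun heq => ?_).mono fun y hy _ => hy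
        apply hpair i j hij ((fderiv ℝ (r i) p u)⁻¹ * fderiv ℝ (r j) p u)
        rw [mul_smul, ← heq, smul_smul, inv_mul_cancel₀ (hru i).ne', one_smul]
  obtain ⟨O', hO'sub, hO', hpO'⟩ := eventually_nhds_iff.1 hev
  have hsub : O' ⊆ O := fun y hy => (hO'sub y hy).1
  obtain ⟨W, hWO', hW, hpW, hfin, hst⟩ := stokes_of_transverse hk hun hO' hpO'
    (fun j => (hr j).mono hsub) (fun j y hy => (hO'sub y hy).2.1 j) hrp
    (fun i j hij y hy => (hO'sub y hy).2.2 i j hij)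
  have hrc : ∀ j, ContinuousOn (r j) O := fun j => (hr j).continuousOn
  refine ⟨W, hWO'.trans hsub, hW, hpW, fun j K hKW hK => ?_, fun h hh hhc hhW => ?_⟩
  · have : cornerFace r O j ∩ K = cornerFace r O' j ∩ K := by
      rw [← cornerFace_inter hsub, inter_assoc, inter_eq_right.2 (hKW.trans hWO')]
    rw [this]; exact hfin j K hKW hK
  · have h0 : ∀ y ∉ O', h y = 0 := fun y hy =>
      image_eq_zero_of_notMem_tsupport fun h' => hy (hWO' (hhW h'))
    have hd0 : ∀ y ∉ O', fderiv ℝ h y = 0 := fun y hy =>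
      fderiv_of_notMem_tsupport ℝ fun h' => hy (hWO' (hhW h'))
    have key := hst h hh hhc hhW
    rw [setIntegral_cornerDomain_of_subset hO hrc hsub fun y hy => by rw [hd0 y hy]; rfl]
    have hL : ∫ y in cornerDomain r O', fderiv ℝ h y v =
        (‖v‖ : ℂ) * ∫ y in cornerDomain r O', fderiv ℝ h y u := by
      rw [← integral_const_mul]
      congr 1; ext y
      conv_lhs => rw [hvu, map_smul]
      simp
    rw [hL, key, Finset.mul_sum]
    refine Finset.sum_congr rfl fun j _ => ?_
    rw [setIntegral_cornerFace_of_subset hO hrc hsub j fun y hy => by rw [h0 y hy, mul_zero],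
      ← integral_const_mul]
    congr 1; ext y
    have : fderiv ℝ (r j) y v = ‖v‖ * fderiv ℝ (r j) y u := by
      conv_lhs => rw [hvu, map_smul]
      simp
    rw [this]; push_cast; ring

/-- The divergence theorem holds for the corner domain `⋂ⱼ {rⱼ < 0}` and vector fields supported
in the open set `W`. -/
structure StokesNbhd {ι : Type*} [Fintype ι] (k : ℕ) (r : ι → E → ℝ) (W : Set E) : Prop where
  isOpen : IsOpen W
  contDiffOn : ∀ j, ContDiffOn ℝ 1 (r j) W
  fderiv_ne_zero : ∀ j, ∀ y ∈ W, fderiv ℝ (r j) y ≠ 0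
  measure_lt_top : ∀ j, ∀ K ⊆ W, IsCompact K → μHE[k] (cornerFace r W j ∩ K) < ⊤
  integral_eq : ∀ h : E → ℂ, ContDiff ℝ 1 h → HasCompactSupport h → tsupport h ⊆ W → ∀ w : E,
    ∫ y in cornerDomain r W, fderiv ℝ h y w =
      ∑ j, ∫ y in cornerFace r W j,
        ((‖fderiv ℝ (r j) y‖⁻¹ * fderiv ℝ (r j) y w : ℝ) : ℂ) * h y ∂μHE[k]

theorem StokesNbhd.continuousOn {ι : Type*} [Fintype ι] {k : ℕ} {r : ι → E → ℝ} {W : Set E}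
    (hW : StokesNbhd k r W) (j : ι) : ContinuousOn (r j) W := (hW.contDiffOn j).continuousOn

/-- Test functions supported in the smaller set do not see the rest of the domain or of its faces.
This is what allows shrinking to a convex ball. -/
theorem StokesNbhd.mono {ι : Type*} [Fintype ι] {k : ℕ} {r : ι → E → ℝ} {W W' : Set E}
    (hW : StokesNbhd k r W) (hW' : IsOpen W') (hsub : W' ⊆ W) : StokesNbhd k r W' where
  isOpen := hW'
  contDiffOn j := (hW.contDiffOn j).mono hsub
  fderiv_ne_zero j y hy := hW.fderiv_ne_zero j y (hsub hy)
  measure_lt_top j K hK hKc := by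
    refine (measure_mono (inter_subset_inter_left _ ?_)).trans_lt
      (hW.measure_lt_top j K (hK.trans hsub) hKc)
    rw [← cornerFace_inter hsub]; exact inter_subset_left
  integral_eq h hh hhc hhW w := by
    have h0 : ∀ y ∉ W', h y = 0 := fun y hy =>
      image_eq_zero_of_notMem_tsupport fun h' => hy (hhW h')
    have hd0 : ∀ y ∉ W', fderiv ℝ h y = 0 := fun y hy =>
      fderiv_of_notMem_tsupport ℝ fun h' => hy (hhW h')
    rw [← setIntegral_cornerDomain_of_subset hW.isOpen hW.continuousOn hsub
      fun y hy => by rw [hd0 y hy]; rfl, hW.integral_eq h hh hhc (hhW.trans hsub)]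
    refine Finset.sum_congr rfl fun j _ => ?_
    rw [← setIntegral_cornerFace_of_subset hW.isOpen hW.continuousOn hsub j
      fun y hy => by rw [h0 y hy, mul_zero]]

theorem StokesNbhd.integrableOn_face {ι : Type*} [Fintype ι] {k : ℕ} {r : ι → E → ℝ} {W : Set E}
    (hW : StokesNbhd k r W) {h : E → ℂ} (hh : Continuous h) (hhc : HasCompactSupport h)
    (hhW : tsupport h ⊆ W) (w : E) (j : ι) :
    IntegrableOn (fun y => ((‖fderiv ℝ (r j) y‖⁻¹ * fderiv ℝ (r j) y w : ℝ) : ℂ) * h y)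
      (cornerFace r W j) μHE[k] := by
  refine integrableOn_cornerFace hW.isOpen hW.continuousOn j hhc hhW
    (hW.measure_lt_top j _ hhW hhc) ?_ ?_
  · have hd := (hW.contDiffOn j).continuousOn_fderiv_of_isOpen hW.isOpen le_rfl
    refine ContinuousOn.mul ?_ hh.continuousOn
    refine Complex.continuous_ofReal.comp_continuousOn ?_
    refine (hd.norm.inv₀ fun y hy => ?_).mul (hd.clm_apply continuousOn_const)
    exact norm_ne_zero_iff.2 (hW.fderiv_ne_zero j y hy)
  · intro y hy; rw [image_eq_zero_of_notMem_tsupport hy, mul_zero]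

/-- Divergence theorem near a transverse corner, for vector fields of constant direction. -/
theorem exists_stokesNbhd {ι : Type*} [Fintype ι] [Nonempty ι] {k : ℕ}
    (hk : Module.finrank ℝ E = k + 1) {v p : E} {O : Set E} (hO : IsOpen O)
    (hp : p ∈ O) {r : ι → E → ℝ} (hr : ∀ j, ContDiffOn ℝ 1 (r j) O)
    (hrv : ∀ j, 0 < fderiv ℝ (r j) p v) (hrp : ∀ j, r j p = 0)
    (hpair : ∀ i j, i ≠ j → ∀ c : ℝ, fderiv ℝ (r j) p ≠ c • fderiv ℝ (r i) p) :
    ∃ W ⊆ O, p ∈ W ∧ StokesNbhd k r W := by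
  have hrc : ∀ j, ContinuousOn (r j) O := fun j => (hr j).continuousOn
  let b := Module.finBasis ℝ E
  -- Adding a large multiple of `v` makes each basis vector outward. These vectors and `v` span, and
  -- the formula is linear in the direction.
  have hC : ∀ i, ∃ C : ℝ, ∀ j, 0 < fderiv ℝ (r j) p (b i + C • v) := by
    intro i
    have : ∀ᶠ C : ℝ in atTop, ∀ j, 0 < fderiv ℝ (r j) p (b i + C • v) := by
      refine eventually_all.2 fun j => ?_
      simp only [map_add, map_smul, smul_eq_mul]
      have := tendsto_atTop_add_const_left atTop (fderiv ℝ (r j) p (b i))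
        (tendsto_id.atTop_mul_const (hrv j))
      exact this.eventually_gt_atTop 0
    exact this.exists
  choose C hC using hC
  obtain ⟨W₀, hW₀O, hW₀, hpW₀, hfin₀, hst₀⟩ := stokes_of_outward hk hO hp hr hrv hrp hpair
  choose W' hW'O hW' hpW' hfin' hst' using fun i => stokes_of_outward hk hO hp hr (hC i) hrp hpair
  have hdc : ∀ j, ContinuousAt (fderiv ℝ (r j)) p := fun j =>
    ((hr j).continuousOn_fderiv_of_isOpen hO le_rfl).continuousAt (hO.mem_nhds hp)
  have hne : ∀ᶠ y in 𝓝 p, ∀ j, fderiv ℝ (r j) y ≠ 0 := eventually_all.2 fun j =>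
    (hdc j).eventually_ne fun h => by have := hrv j; simp [h] at this
  obtain ⟨W₁, hW₁ne, hW₁, hpW₁⟩ := eventually_nhds_iff.1 hne
  let W := W₀ ∩ (⋂ i, W' i) ∩ W₁
  have hWopen : IsOpen W := (hW₀.inter (isOpen_iInter_of_finite hW')).inter hW₁
  have hsub : W ⊆ O := fun y hy => hW₀O hy.1.1
  have hrW : ∀ j, ContDiffOn ℝ 1 (r j) W := fun j => (hr j).mono hsub
  have hneW : ∀ j, ∀ y ∈ W, fderiv ℝ (r j) y ≠ 0 := fun j y hy => hW₁ne y hy.2 j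
  have hfin : ∀ j, ∀ K ⊆ W, IsCompact K → μHE[k] (cornerFace r W j ∩ K) < ⊤ := by
    intro j K hK hKc
    refine (measure_mono (inter_subset_inter_left _ ?_)).trans_lt
      (hfin₀ j K (fun y hy => (hK hy).1.1) hKc)
    rw [← cornerFace_inter hsub]; exact inter_subset_left
  refine ⟨W, hsub, ⟨⟨hpW₀, mem_iInter.2 hpW'⟩, hpW₁⟩, hWopen, hrW, hneW, hfin,
    fun h hh hhc hhW => ?_⟩
  have h0 : ∀ y ∉ W, h y = 0 := fun y hy =>
    image_eq_zero_of_notMem_tsupport fun h' => hy (hhW h')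
  have hd0 : ∀ y ∉ W, fderiv ℝ h y = 0 := fun y hy =>
    fderiv_of_notMem_tsupport ℝ fun h' => hy (hhW h')
  have hI : ∀ j (w : E), IntegrableOn (fun y =>
      ((‖fderiv ℝ (r j) y‖⁻¹ * fderiv ℝ (r j) y w : ℝ) : ℂ) * h y) (cornerFace r W j) μHE[k] := by
    intro j w
    refine integrableOn_cornerFace hWopen (fun j => (hrc j).mono hsub) j hhc hhW
      (hfin j _ hhW hhc) ?_ ?_
    · have hd := (hrW j).continuousOn_fderiv_of_isOpen hWopen le_rfl
      refine ContinuousOn.mul ?_ hh.continuous.continuousOn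
      refine Complex.continuous_ofReal.comp_continuousOn ?_
      refine (hd.norm.inv₀ fun y hy => ?_).mul (hd.clm_apply continuousOn_const)
      exact norm_ne_zero_iff.2 (hneW j y hy)
    · intro y hy; rw [image_eq_zero_of_notMem_tsupport hy, mul_zero]
  have hID : ∀ w, Integrable fun y => fderiv ℝ h y w := fun w =>
    ((hh.continuous_fderiv one_ne_zero).clm_apply continuous_const).integrable_of_hasCompactSupport
      (hhc.fderiv_apply (𝕜 := ℝ) w)
  have hconv : ∀ w, (∫ y in cornerDomain r O, fderiv ℝ h y w =
          ∑ j, ∫ y in cornerFace r O j,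
            ((‖fderiv ℝ (r j) y‖⁻¹ * fderiv ℝ (r j) y w : ℝ) : ℂ) * h y ∂μHE[k]) →
      ∫ y in cornerDomain r W, fderiv ℝ h y w =
          ∑ j, ∫ y in cornerFace r W j,
            ((‖fderiv ℝ (r j) y‖⁻¹ * fderiv ℝ (r j) y w : ℝ) : ℂ) * h y ∂μHE[k] := by
    intro w hw
    rw [← setIntegral_cornerDomain_of_subset hO hrc hsub fun y hy => by rw [hd0 y hy]; rfl, hw]
    refine Finset.sum_congr rfl fun j _ => ?_
    rw [← setIntegral_cornerFace_of_subset hO hrc hsub j fun y hy => by rw [h0 y hy, mul_zero]]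
  -- the vectors for which the formula holds form a subspace
  let S : Submodule ℝ E :=
    { carrier := {w | ∫ y in cornerDomain r W, fderiv ℝ h y w =
          ∑ j, ∫ y in cornerFace r W j,
            ((‖fderiv ℝ (r j) y‖⁻¹ * fderiv ℝ (r j) y w : ℝ) : ℂ) * h y ∂μHE[k]}
      add_mem' := by
        intro w w' hw hw'
        rw [mem_ofPred_eq] at hw hw' ⊢
        simp only [map_add]
        rw [integral_add (hID w).integrableOn (hID w').integrableOn, hw, hw',
          ← Finset.sum_add_distrib]
        refine Finset.sum_congr rfl fun j _ => ?_
        rw [← integral_add (hI j w) (hI j w')]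
        congr 1; ext y; push_cast; ring
      zero_mem' := by simp
      smul_mem' := by
        intro c w hw
        rw [mem_ofPred_eq] at hw ⊢
        simp only [map_smul]
        rw [integral_smul, hw, Finset.smul_sum]
        refine Finset.sum_congr rfl fun j _ => ?_
        rw [← integral_smul]
        congr 1; ext y; simp only [smul_eq_mul, Complex.real_smul]; push_cast; ring }
  have hvS : v ∈ S := hconv _ (hst₀ h hh hhc fun y hy => (hhW hy).1.1)
  have hbS : ∀ i, b i ∈ S := fun i => by
    have h1 : b i + C i • v ∈ S :=
      hconv _ (hst' i h hh hhc fun y hy => mem_iInter.1 (hhW hy).1.2 i)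
    simpa using S.sub_mem h1 (S.smul_mem (C i) hvS)
  have hS : S = ⊤ := by
    rw [eq_top_iff, ← b.span_eq, Submodule.span_le]
    rintro _ ⟨i, rfl⟩; exact hbS i
  intro w
  exact (hS ▸ Submodule.mem_top : w ∈ S)

end Stokes

/-! ### Test functions and bounds on their jets -/

section Jets

variable {E : Type*} [NormedAddCommGroup E] [NormedSpace ℝ E]

theorem contDiff_of_forall_mem_tsupport {F : Type*} [NormedAddCommGroup F] [NormedSpace ℝ F]
    {m : ℕ∞ω} {f : E → F} (h : ∀ x ∈ tsupport f, ContDiffAt ℝ m f x) : ContDiff ℝ m f := by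
  rw [contDiff_iff_contDiffAt]
  intro x
  by_cases hx : x ∈ tsupport f
  · exact h x hx
  · exact contDiffAt_const.congr_of_eventuallyEq (notMem_tsupport_iff_eventuallyEq.1 hx)

/-- Smooth functions with compact support in `W`. -/
def TestFn (W : Set E) : Submodule ℂ (E → ℂ) where
  carrier := {u | ContDiff ℝ ∞ u ∧ HasCompactSupport u ∧ tsupport u ⊆ W}
  add_mem' := fun {u u'} hu hu' => ⟨hu.1.add hu'.1, hu.2.1.add hu'.2.1,
    (tsupport_add u u').trans (union_subset hu.2.2 hu'.2.2)⟩
  zero_mem' := ⟨contDiff_const, HasCompactSupport.zero, by simp [tsupport]⟩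
  smul_mem' := fun c u hu => ⟨contDiff_const.smul hu.1, hu.2.1.smul_left (f := fun _ => c),
    (tsupport_smul_subset_right (fun _ => c) u).trans hu.2.2⟩

/-- Leibniz' rule, with the derivatives of `c` bounded on the compact set `K`; the binomial
coefficients sum to at most 2^m. Vector values are allowed because the lemma also serves for forms
multiplied by cut-off functions. -/
theorem exists_jet_smul_bound {F : Type*} [NormedAddCommGroup F] [NormedSpace ℝ F]
    [NormedSpace ℂ F] [IsScalarTower ℝ ℂ F]
    {W K : Set E} (hW : IsOpen W) (hK : IsCompact K) (hKW : K ⊆ W) {c : E → ℂ}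
    (hc : ContDiffOn ℝ ∞ c W) (m : ℕ) :
    ∃ C : ℝ, 0 ≤ C ∧ ∀ u : E → F, ContDiffOn ℝ ∞ u W → ∀ y ∈ K, ∀ A : ℝ,
      (∀ i ≤ m, ‖iteratedFDeriv ℝ i u y‖ ≤ A) →
        ∀ i ≤ m, ‖iteratedFDeriv ℝ i (fun y => c y • u y) y‖ ≤ C * A := by
  have hB : ∀ i, ∃ B : ℝ, ∀ y ∈ K, ‖iteratedFDerivWithin ℝ i c W y‖ ≤ B := fun i =>
    hK.exists_bound_of_continuousOn ((hc.continuousOn_iteratedFDerivWithin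
      (by exact_mod_cast le_top) hW.uniqueDiffOn).mono hKW)
  choose B hB using hB
  let B' : ℝ := ∑ i ∈ Finset.range (m + 1), |B i|
  have hB' : ∀ i ≤ m, ∀ y ∈ K, ‖iteratedFDerivWithin ℝ i c W y‖ ≤ B' := fun i hi y hy =>
    ((hB i y hy).trans (le_abs_self _)).trans (Finset.single_le_sum (f := fun i => |B i|)
      (fun _ _ => abs_nonneg _) (Finset.mem_range.2 (by omega)))
  have hB'0 : 0 ≤ B' := Finset.sum_nonneg fun _ _ => abs_nonneg _
  refine ⟨2 ^ m * B', by positivity, fun u hu y hy A hA i hi => ?_⟩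
  have hA0 : 0 ≤ A := (norm_nonneg _).trans (hA 0 (by omega))
  have hyW := hKW hy
  have h1 := norm_iteratedFDerivWithin_smul_le (𝕜 := ℝ) hc hu hW.uniqueDiffOn hyW (n := i)
    (by exact_mod_cast le_top)
  rw [iteratedFDerivWithin_of_isOpen i hW hyW] at h1
  refine h1.trans ?_
  calc _ ≤ ∑ l ∈ Finset.range (i + 1), (i.choose l : ℝ) * B' * A := by
        refine Finset.sum_le_sum fun l hl => ?_
        have hl' : l ≤ i := by have := Finset.mem_range.1 hl; omega
        gcongr
        · exact hB' l (by omega) y hy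
        · rw [iteratedFDerivWithin_of_isOpen _ hW hyW]; exact hA _ (by omega)
    _ = 2 ^ i * B' * A := by
        rw [← Finset.sum_mul, ← Finset.sum_mul]
        congr 2
        exact_mod_cast Nat.sum_range_choose i
    _ ≤ 2 ^ m * B' * A := by gcongr; norm_num

theorem norm_iteratedFDeriv_fderiv_apply_le {F : Type*} [NormedAddCommGroup F] [NormedSpace ℝ F]
    {u : E → F} {y : E} (hu : ContDiffAt ℝ ∞ u y) (w : E) (i : ℕ) :
    ‖iteratedFDeriv ℝ i (fun y => fderiv ℝ u y w) y‖ ≤ ‖w‖ * ‖iteratedFDeriv ℝ (i + 1) u y‖ := by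
  have hd : ContDiffAt ℝ ∞ (fderiv ℝ u) y := hu.fderiv_right (by simp)
  have h := (ContinuousLinearMap.apply ℝ F w).norm_iteratedFDeriv_comp_left hd (n := i)
    (by exact_mod_cast le_top)
  rw [norm_iteratedFDeriv_fderiv] at h
  refine h.trans ?_
  gcongr
  refine ContinuousLinearMap.opNorm_le_bound _ (norm_nonneg _) fun L => ?_
  simpa [mul_comm] using L.le_opNorm w

/-- A linear operator on test functions whose values have jets bounded, locally uniformly, by jets of
the argument. -/
def JetBounded {W : Set E} (P : TestFn W →ₗ[ℂ] TestFn W) : Prop :=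
  ∀ K ⊆ W, IsCompact K → ∀ m : ℕ, ∃ (m' : ℕ) (C : ℝ), 0 ≤ C ∧ ∀ (u : TestFn W), ∀ y ∈ K, ∀ A : ℝ,
    (∀ i ≤ m', ‖iteratedFDeriv ℝ i (u : E → ℂ) y‖ ≤ A) →
      ∀ i ≤ m, ‖iteratedFDeriv ℝ i (P u : E → ℂ) y‖ ≤ C * A

theorem JetBounded.id {W : Set E} : JetBounded (LinearMap.id : TestFn W →ₗ[ℂ] TestFn W) :=
  fun K _ _ m => ⟨m, 1, zero_le_one, fun u y _ A hA i hi => by simpa using hA i hi⟩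

theorem JetBounded.comp {W : Set E} {P Q : TestFn W →ₗ[ℂ] TestFn W} (hP : JetBounded P)
    (hQ : JetBounded Q) : JetBounded (P ∘ₗ Q) := by
  intro K hKW hK m
  obtain ⟨m₁, C₁, hC₁, h₁⟩ := hP K hKW hK m
  obtain ⟨m₂, C₂, hC₂, h₂⟩ := hQ K hKW hK m₁
  refine ⟨m₂, C₁ * C₂, by positivity, fun u y hy A hA i hi => ?_⟩
  rw [mul_assoc]
  exact h₁ (Q u) y hy _ (h₂ u y hy A hA) i hi

/-- Together with composition and sums this makes every operator obtained by repeated integration by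
parts jet bounded, which is the source of the continuity of the current. -/
theorem JetBounded.smul {W : Set E} {P : TestFn W →ₗ[ℂ] TestFn W} (hP : JetBounded P) (t : ℂ) :
    JetBounded (t • P) := by
  intro K hKW hK m
  obtain ⟨m₁, C₁, hC₁, h₁⟩ := hP K hKW hK m
  refine ⟨m₁, ‖t‖ * C₁, by positivity, fun u y hy A hA i hi => ?_⟩
  have : ((t • P) u : E → ℂ) = t • (P u : E → ℂ) := rfl
  rw [this, iteratedFDeriv_const_smul_apply
    ((P u).2.1.contDiffAt.of_le (by exact_mod_cast le_top)), norm_smul, mul_assoc]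
  gcongr
  exact h₁ u y hy A hA i hi

end Jets

/-! ### Integration by parts along antiholomorphic vector fields tangent to the faces -/

section Dbar

variable {n : ℕ}

/-- Twice the antiholomorphic derivative of `u` in the direction `w`. -/
def dbarAt (u : Cn n → ℂ) (y w : Cn n) : ℂ :=
  fderiv ℝ u y w + Complex.I * fderiv ℝ u y (Complex.I • w)

/-- Twice the antiholomorphic derivative of a real function, as a function of its differential. -/
def dbarReal (l : Cn n →L[ℝ] ℝ) (w : Cn n) : ℂ := (l w : ℂ) + Complex.I * (l (Complex.I • w) : ℂ)

theorem dbarAt_mul {u u' : Cn n → ℂ} {y : Cn n} (hu : DifferentiableAt ℝ u y)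
    (hu' : DifferentiableAt ℝ u' y) (w : Cn n) :
    dbarAt (fun y => u y * u' y) y w = u y * dbarAt u' y w + dbarAt u y w * u' y := by
  simp only [dbarAt, fderiv_fun_mul hu hu', add_apply, smul_apply, smul_eq_mul]
  ring

theorem dbarAt_ofReal {r : Cn n → ℝ} {y : Cn n} (hr : DifferentiableAt ℝ r y) (w : Cn n) :
    dbarAt (fun y => (r y : ℂ)) y w = dbarReal (fderiv ℝ r y) w := by
  have : HasFDerivAt (fun y => (r y : ℂ)) (Complex.ofRealCLM ∘L fderiv ℝ r y) y :=
    Complex.ofRealCLM.hasFDerivAt.comp y hr.hasFDerivAt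
  simp [dbarAt, dbarReal, this.fderiv]

theorem dbarAt_eq_zero_of_notMem_tsupport {u : Cn n → ℂ} {y : Cn n} (h : y ∉ tsupport u)
    (w : Cn n) : dbarAt u y w = 0 := by
  simp [dbarAt, fderiv_of_notMem_tsupport ℝ h]

variable {ι : Type*} [Fintype ι]

/-- A monomial in the defining functions. -/
def monomialFn (r : ι → Cn n → ℝ) (α : ι → ℕ) (y : Cn n) : ℝ := ∏ i, r i y ^ α i

variable (W : Set (Cn n)) (c : ι → ι → Cn n → ℂ) (w : ι → Cn n)

/-- Antiholomorphic vector fields `Lⱼ = ∑ₗ cⱼₗ ∂̄_{wₗ}` on `W` dual to the functions `rᵢ`. -/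
structure DualFields (r : ι → Cn n → ℝ) : Prop where
  contDiffOn : ∀ j l, ContDiffOn ℝ ∞ (c j l) W
  dual : ∀ y ∈ W, ∀ j, ∑ l, c j l y * dbarReal (fderiv ℝ (r j) y) (w l) = 1
  dual_ne : ∀ y ∈ W, ∀ i j, i ≠ j → ∑ l, c j l y * dbarReal (fderiv ℝ (r i) y) (w l) = 0

variable {W c w} {r : ι → Cn n → ℝ}

theorem contDiff_mul_testFn {W : Set (Cn n)} (hW : IsOpen W) {a : Cn n → ℂ} {m : ℕ∞ω}
    (ha : ContDiffOn ℝ m a W) (hm : m ≤ (∞ : ℕ∞ω)) (u : TestFn W) :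
    ContDiff ℝ m fun y => a y * (u : Cn n → ℂ) y :=
  contDiff_of_forall_mem_tsupport fun _ hy =>
    (ha.contDiffAt (hW.mem_nhds (u.2.2.2 (tsupport_mul_subset_right hy)))).mul
      (u.2.1.contDiffAt.of_le hm)

theorem mul_mem_testFn {W : Set (Cn n)} (hW : IsOpen W) {a : Cn n → ℂ}
    (ha : ContDiffOn ℝ ∞ a W) (u : TestFn W) : (fun y => a y * (u : Cn n → ℂ) y) ∈ TestFn W :=
  ⟨contDiff_mul_testFn hW ha le_rfl u, u.2.2.1.mul_left,
    tsupport_mul_subset_right.trans u.2.2.2⟩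

theorem tsupport_dbarAt_subset (u : Cn n → ℂ) (w : Cn n) :
    tsupport (fun y => dbarAt u y w) ⊆ tsupport u := by
  refine closure_minimal (fun y hy => ?_) (isClosed_tsupport _)
  by_contra h
  exact hy (dbarAt_eq_zero_of_notMem_tsupport h w)

theorem dbarAt_mem_testFn {W : Set (Cn n)} (u : TestFn W) (w : Cn n) :
    (fun y => dbarAt (u : Cn n → ℂ) y w) ∈ TestFn W := by
  have h1 : ContDiff ℝ ∞ (fderiv ℝ (u : Cn n → ℂ)) := u.2.1.fderiv_right (by simp)
  refine ⟨(h1.clm_apply contDiff_const).add (contDiff_const.mul (h1.clm_apply contDiff_const)),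
    ?_, (tsupport_dbarAt_subset _ _).trans u.2.2.2⟩
  exact u.2.2.1.of_isClosed_subset (isClosed_tsupport _) (tsupport_dbarAt_subset _ _)

/-- Multiplication of test functions by a smooth function. -/
def mulOp {W : Set (Cn n)} (hW : IsOpen W) {a : Cn n → ℂ} (ha : ContDiffOn ℝ ∞ a W) :
    TestFn W →ₗ[ℂ] TestFn W where
  toFun u := ⟨fun y => a y * (u : Cn n → ℂ) y, mul_mem_testFn hW ha u⟩
  map_add' u u' := by ext y; simp [mul_add]
  map_smul' t u := by ext y; simp; ring

/-- The antiholomorphic derivative on test functions. -/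
def dbarOp {W : Set (Cn n)} (w : Cn n) : TestFn W →ₗ[ℂ] TestFn W where
  toFun u := ⟨fun y => dbarAt (u : Cn n → ℂ) y w, dbarAt_mem_testFn u w⟩
  map_add' u u' := by
    ext y
    have h1 := (u.2.1.differentiable (by simp)).differentiableAt (x := y)
    have h2 := (u'.2.1.differentiable (by simp)).differentiableAt (x := y)
    simp only [dbarAt, Submodule.coe_add, fderiv_add h1 h2, add_apply, Pi.add_apply]
    ring
  map_smul' t u := by
    ext y
    have h1 := (u.2.1.differentiable (by simp)).differentiableAt (x := y)
    simp only [dbarAt, Submodule.coe_smul, fderiv_const_smul h1, smul_apply, Pi.smul_apply,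
      smul_eq_mul, RingHom.id_apply]
    ring

theorem jetBounded_mulOp {W : Set (Cn n)} (hW : IsOpen W) {a : Cn n → ℂ}
    (ha : ContDiffOn ℝ ∞ a W) : JetBounded (mulOp hW ha) := by
  intro K hKW hK m
  obtain ⟨C, hC, h⟩ := exists_jet_smul_bound (F := ℂ) hW hK hKW ha m
  exact ⟨m, C, hC, fun u y hy A hA i hi => h u u.2.1.contDiffOn y hy A hA i hi⟩

theorem jetBounded_dbarOp {W : Set (Cn n)} (w : Cn n) :
    JetBounded (dbarOp w : TestFn W →ₗ[ℂ] TestFn W) := by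
  intro K hKW hK m
  refine ⟨m + 1, ‖w‖ + ‖Complex.I • w‖, by positivity, fun u y hy A hA i hi => ?_⟩
  have hd : ∀ x : Cn n, ContDiff ℝ ∞ fun y => fderiv ℝ (u : Cn n → ℂ) y x := fun x =>
    (u.2.1.fderiv_right (by simp)).clm_apply contDiff_const
  have hle : ((i : ℕ) : ℕ∞ω) ≤ (∞ : ℕ∞ω) := by exact_mod_cast le_top
  have h1 : ∀ x : Cn n, ‖iteratedFDeriv ℝ i (fun y => fderiv ℝ (u : Cn n → ℂ) y x) y‖ ≤ ‖x‖ * A :=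
    fun x => (norm_iteratedFDeriv_fderiv_apply_le u.2.1.contDiffAt x i).trans
      (by gcongr; exact hA _ (by omega))
  change ‖iteratedFDeriv ℝ i ((fun y => fderiv ℝ (u : Cn n → ℂ) y w) +
    Complex.I • fun y => fderiv ℝ (u : Cn n → ℂ) y (Complex.I • w)) y‖ ≤ _
  have h2 : ContDiffAt ℝ i (Complex.I • fun y => fderiv ℝ (u : Cn n → ℂ) y (Complex.I • w)) y :=
    ((hd (Complex.I • w)).const_smul Complex.I).contDiffAt.of_le hle
  rw [iteratedFDeriv_add_apply ((hd w).contDiffAt.of_le hle) h2,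
    iteratedFDeriv_const_smul_apply ((hd _).contDiffAt.of_le hle), add_mul]
  refine (norm_add_le _ _).trans (add_le_add (h1 w) ?_)
  rw [norm_smul, Complex.norm_I, one_mul]
  exact h1 _

theorem JetBounded.sum {W : Set (Cn n)} {κ : Type*} (s : Finset κ)
    {P : κ → TestFn W →ₗ[ℂ] TestFn W} (hP : ∀ l, JetBounded (P l)) :
    JetBounded (∑ l ∈ s, P l) := by
  classical
  induction s using Finset.induction_on with
  | empty =>
    intro K _ _ m
    refine ⟨0, 0, le_rfl, fun u y _ A _ i _ => ?_⟩
    have : (((∑ l ∈ (∅ : Finset κ), P l) u : TestFn W) : Cn n → ℂ) = fun _ => 0 := by simp; rfl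
    rw [this, iteratedFDeriv_fun_zero]; simp
  | insert a s ha ih =>
    intro K hKW hK m
    obtain ⟨m₁, C₁, hC₁, h₁⟩ := hP a K hKW hK m
    obtain ⟨m₂, C₂, hC₂, h₂⟩ := ih K hKW hK m
    refine ⟨max m₁ m₂, C₁ + C₂, by positivity, fun u y hy A hA i hi => ?_⟩
    have hle : ((i : ℕ) : ℕ∞ω) ≤ (∞ : ℕ∞ω) := by exact_mod_cast le_top
    have : (((∑ l ∈ insert a s, P l) u : TestFn W) : Cn n → ℂ) =
        (P a u : Cn n → ℂ) + ((∑ l ∈ s, P l) u : TestFn W) := by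
      rw [Finset.sum_insert ha]; rfl
    rw [this, iteratedFDeriv_add_apply ((P a u).2.1.contDiffAt.of_le hle)
      ((((∑ l ∈ s, P l) u : TestFn W)).2.1.contDiffAt.of_le hle), add_mul]
    exact (norm_add_le _ _).trans (add_le_add
      (h₁ u y hy A (fun i hi => hA i (hi.trans (le_max_left _ _))) i hi)
      (h₂ u y hy A (fun i hi => hA i (hi.trans (le_max_right _ _))) i hi))

end Dbar

section Dbar

variable {n : ℕ} {ι : Type*} [Fintype ι] {W : Set (Cn n)} {c : ι → ι → Cn n → ℂ} {w : ι → Cn n}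
  {r : ι → Cn n → ℝ}

/-- The formal transpose of the vector field `Lⱼ`, up to sign. -/
def transposeOp (hW : IsOpen W) (hL : DualFields W c w r) (j : ι) : TestFn W →ₗ[ℂ] TestFn W :=
  ∑ l, dbarOp (w l) ∘ₗ mulOp hW (hL.contDiffOn j l)

theorem transposeOp_apply (hW : IsOpen W) (hL : DualFields W c w r) (j : ι) (u : TestFn W)
    (y : Cn n) : (transposeOp hW hL j u : Cn n → ℂ) y =
      ∑ l, dbarAt (fun y => c j l y * (u : Cn n → ℂ) y) y (w l) := by
  simp only [transposeOp, LinearMap.sum_apply, Submodule.coe_sum, Finset.sum_apply]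
  rfl

theorem jetBounded_transposeOp (hW : IsOpen W) (hL : DualFields W c w r) (j : ι) :
    JetBounded (transposeOp hW hL j) :=
  JetBounded.sum _ fun l => (jetBounded_dbarOp (w l)).comp (jetBounded_mulOp hW _)

theorem tsupport_transposeOp_subset (hW : IsOpen W) (hL : DualFields W c w r) (j : ι)
    (u : TestFn W) : tsupport (transposeOp hW hL j u : Cn n → ℂ) ⊆ tsupport (u : Cn n → ℂ) := by
  refine closure_minimal (fun y hy => ?_) (isClosed_tsupport _)
  by_contra h
  refine hy ?_
  rw [transposeOp_apply]
  refine Finset.sum_eq_zero fun l _ => dbarAt_eq_zero_of_notMem_tsupport (fun h' => h ?_) _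
  exact tsupport_mul_subset_right h'

theorem contDiffOn_monomialFn {m : ℕ∞ω} (hr : ∀ j, ContDiffOn ℝ m (r j) W) (α : ι → ℕ) :
    ContDiffOn ℝ m (monomialFn r α) W := by
  unfold monomialFn
  exact contDiffOn_prod fun i _ => (hr i).pow _

/-- The vector field `Lⱼ` differentiates a monomial in the `rᵢ` as if it were `∂ / ∂rⱼ`. -/
theorem sum_dbarReal_monomialFn [DecidableEq ι] (hL : DualFields W c w r) {y : Cn n} (hy : y ∈ W)
    (hr : ∀ j, DifferentiableAt ℝ (r j) y) (α : ι → ℕ) (j : ι) :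
    ∑ l, c j l y * dbarReal (fderiv ℝ (monomialFn r (α + Pi.single j 1)) y) (w l) =
      (α j + 1) * (monomialFn r α y : ℂ) := by
  set β := α + Pi.single j 1 with hβ
  have hd : HasFDerivAt (monomialFn r β) (∑ i, (∏ k ∈ Finset.univ.erase i, r k y ^ β k) •
      ((β i * r i y ^ (β i - 1)) • fderiv ℝ (r i) y)) y := by
    refine HasFDerivAt.finsetProd fun i _ => ?_
    simpa [mul_smul, nsmul_eq_mul] using (hr i).hasFDerivAt.pow (β i)
  have hlin : ∀ (a : ι → ℝ) (l : ι → Cn n →L[ℝ] ℝ) (x : Cn n),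
      dbarReal (∑ i, a i • l i) x = ∑ i, (a i : ℂ) * dbarReal (l i) x := by
    intro a l x
    simp only [dbarReal, sum_apply, smul_apply, smul_eq_mul,
      Complex.ofReal_sum, Complex.ofReal_mul, Finset.mul_sum, ← Finset.sum_add_distrib]
    exact Finset.sum_congr rfl fun i _ => by ring
  rw [hd.fderiv]
  simp only [smul_smul]
  simp_rw [hlin, Finset.mul_sum]
  rw [Finset.sum_comm, Finset.sum_eq_single j]
  · have h1 : ∀ l, c j l y * ((((∏ k ∈ Finset.univ.erase j, r k y ^ β k) *
        (β j * r j y ^ (β j - 1)) : ℝ) : ℂ) * dbarReal (fderiv ℝ (r j) y) (w l)) =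
        (((∏ k ∈ Finset.univ.erase j, r k y ^ β k) * (β j * r j y ^ (β j - 1)) : ℝ) : ℂ) *
          (c j l y * dbarReal (fderiv ℝ (r j) y) (w l)) := fun l => by ring
    simp_rw [h1, ← Finset.mul_sum, hL.dual y hy j, mul_one]
    have hβj : β j = α j + 1 := by simp [hβ]
    have h2 : ∏ k ∈ Finset.univ.erase j, r k y ^ β k = ∏ k ∈ Finset.univ.erase j, r k y ^ α k := by
      refine Finset.prod_congr rfl fun k hk => ?_
      have : β k = α k := by simp [hβ, Finset.ne_of_mem_erase hk]
      rw [this]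
    rw [h2, hβj, Nat.add_sub_cancel]
    have h3 : monomialFn r α y = r j y ^ α j * ∏ k ∈ Finset.univ.erase j, r k y ^ α k :=
      (Finset.mul_prod_erase Finset.univ (fun k => r k y ^ α k) (Finset.mem_univ j)).symm
    rw [h3]; push_cast; ring
  · intro i _ hij
    have h1 : ∀ l, c j l y * ((((∏ k ∈ Finset.univ.erase i, r k y ^ β k) *
        (β i * r i y ^ (β i - 1)) : ℝ) : ℂ) * dbarReal (fderiv ℝ (r i) y) (w l)) =
        (((∏ k ∈ Finset.univ.erase i, r k y ^ β k) * (β i * r i y ^ (β i - 1)) : ℝ) : ℂ) *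
          (c j l y * dbarReal (fderiv ℝ (r i) y) (w l)) := fun l => by ring
    simp_rw [h1, ← Finset.mul_sum, hL.dual_ne y hy i j hij, mul_zero]
  · simp

/-- The complex form of the divergence theorem on a Stokes neighbourhood. -/
theorem StokesNbhd.integral_sum_dbarAt {k : ℕ} (hW : StokesNbhd k r W) {κ : Type*} (s : Finset κ)
    (h : κ → Cn n → ℂ) (hh : ∀ l, ContDiff ℝ 1 (h l)) (hhc : ∀ l, HasCompactSupport (h l))
    (hhW : ∀ l, tsupport (h l) ⊆ W) (w : κ → Cn n) :
    ∫ y in cornerDomain r W, ∑ l ∈ s, dbarAt (h l) y (w l) =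
      ∑ i, ∫ y in cornerFace r W i, (‖fderiv ℝ (r i) y‖⁻¹ : ℂ) *
        ∑ l ∈ s, dbarReal (fderiv ℝ (r i) y) (w l) * h l y ∂μHE[k] := by
  have hID : ∀ l x, Integrable fun y => fderiv ℝ (h l) y x := fun l x =>
    (((hh l).continuous_fderiv one_ne_zero).clm_apply
      continuous_const).integrable_of_hasCompactSupport ((hhc l).fderiv_apply (𝕜 := ℝ) x)
  have hI : ∀ l x i, IntegrableOn (fun y =>
      ((‖fderiv ℝ (r i) y‖⁻¹ * fderiv ℝ (r i) y x : ℝ) : ℂ) * h l y) (cornerFace r W i) μHE[k] :=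
    fun l x i => hW.integrableOn_face (hh l).continuous (hhc l) (hhW l) x i
  have hS : ∀ l, IntegrableOn (fun y => fderiv ℝ (h l) y (w l) +
      Complex.I * fderiv ℝ (h l) y (Complex.I • w l)) (cornerDomain r W) := fun l =>
    ((hID l _).integrableOn).add ((hID l _).integrableOn.const_mul _)
  simp only [dbarAt]
  rw [integral_finsetSum _ fun l _ => hS l]
  simp_rw [Finset.mul_sum]
  have hR : ∀ i, ∫ y in cornerFace r W i, ∑ l ∈ s, (‖fderiv ℝ (r i) y‖⁻¹ : ℂ) *
      (dbarReal (fderiv ℝ (r i) y) (w l) * h l y) ∂μHE[k] =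
      ∑ l ∈ s, (∫ y in cornerFace r W i,
        ((‖fderiv ℝ (r i) y‖⁻¹ * fderiv ℝ (r i) y (w l) : ℝ) : ℂ) * h l y ∂μHE[k] +
        Complex.I * ∫ y in cornerFace r W i,
        ((‖fderiv ℝ (r i) y‖⁻¹ * fderiv ℝ (r i) y (Complex.I • w l) : ℝ) : ℂ) * h l y ∂μHE[k]) := by
    intro i
    have : (fun y => ∑ l ∈ s, (‖fderiv ℝ (r i) y‖⁻¹ : ℂ) *
        (dbarReal (fderiv ℝ (r i) y) (w l) * h l y)) = fun y => ∑ l ∈ s,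
        (((‖fderiv ℝ (r i) y‖⁻¹ * fderiv ℝ (r i) y (w l) : ℝ) : ℂ) * h l y +
        Complex.I * (((‖fderiv ℝ (r i) y‖⁻¹ * fderiv ℝ (r i) y (Complex.I • w l) : ℝ) : ℂ) *
          h l y)) := by
      ext y
      refine Finset.sum_congr rfl fun l _ => ?_
      simp only [dbarReal]; push_cast; ring
    have hS' : ∀ l, IntegrableOn (fun y =>
        ((‖fderiv ℝ (r i) y‖⁻¹ * fderiv ℝ (r i) y (w l) : ℝ) : ℂ) * h l y +
        Complex.I * (((‖fderiv ℝ (r i) y‖⁻¹ * fderiv ℝ (r i) y (Complex.I • w l) : ℝ) : ℂ) *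
          h l y)) (cornerFace r W i) μHE[k] := fun l => (hI l _ i).add ((hI l _ i).const_mul _)
    rw [this, integral_finsetSum _ fun l _ => hS' l]
    refine Finset.sum_congr rfl fun l _ => ?_
    rw [integral_add (hI l _ i) ((hI l _ i).const_mul _), integral_const_mul]
  simp_rw [hR]
  rw [Finset.sum_comm]
  refine Finset.sum_congr rfl fun l _ => ?_
  rw [integral_add (hID l _).integrableOn ((hID l _).integrableOn.const_mul _), integral_const_mul,
    hW.integral_eq _ (hh l) (hhc l) (hhW l), hW.integral_eq _ (hh l) (hhc l) (hhW l),
    Finset.mul_sum, ← Finset.sum_add_distrib]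

/-- Integration by parts along `Lⱼ`: there are no boundary terms. -/
theorem integral_monomialFn_mul [DecidableEq ι] {k : ℕ} (hW : StokesNbhd k r W)
    (hL : DualFields W c w r) (α : ι → ℕ) (j : ι) {F : Cn n → ℂ} (hF : ContDiff ℝ 1 F)
    (u : TestFn W)
    (hFu : ∀ y ∈ cornerDomain r W, y ∈ tsupport (u : Cn n → ℂ) → ∀ x, dbarAt F y x = 0) :
    ∫ y in cornerDomain r W, F y * (monomialFn r α y : ℂ) * (u : Cn n → ℂ) y =
      ∫ y in cornerDomain r W, F y * (monomialFn r (α + Pi.single j 1) y : ℂ) *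
        (((-((α j : ℂ) + 1)⁻¹) • transposeOp hW.isOpen hL j u : TestFn W) : Cn n → ℂ) y := by
  set β := α + Pi.single j 1 with hβ
  have hopen := hW.isOpen
  have hαj : ((α j : ℂ) + 1) ≠ 0 := by exact_mod_cast Nat.succ_ne_zero (α j)
  have hR : ∀ α, ContDiffOn ℝ 1 (monomialFn r α) W := contDiffOn_monomialFn hW.contDiffOn
  have hRC : ∀ α, ContDiffOn ℝ 1 (fun y => (monomialFn r α y : ℂ)) W := fun α =>
    Complex.ofRealCLM.contDiff.comp_contDiffOn (hR α)
  let h : ι → Cn n → ℂ := fun l y => F y * (monomialFn r β y : ℂ) * (c j l y * (u : Cn n → ℂ) y)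
  have hcu : ∀ l, (fun y => c j l y * (u : Cn n → ℂ) y) ∈ TestFn W := fun l =>
    mul_mem_testFn hopen (hL.contDiffOn j l) u
  have hh : ∀ l, ContDiff ℝ 1 (h l) := fun l =>
    contDiff_mul_testFn hopen (hF.contDiffOn.mul (hRC β)) (by exact_mod_cast le_top) ⟨_, hcu l⟩
  have hts : ∀ l, tsupport (h l) ⊆ tsupport (u : Cn n → ℂ) := fun l =>
    tsupport_mul_subset_right.trans tsupport_mul_subset_right
  have hhc : ∀ l, HasCompactSupport (h l) := fun l =>
    u.2.2.1.of_isClosed_subset (isClosed_tsupport _) (hts l)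
  have hst := hW.integral_sum_dbarAt Finset.univ h hh hhc (fun l => (hts l).trans u.2.2.2) w
  -- the boundary terms vanish
  have hbd : ∀ i, ∫ y in cornerFace r W i, (‖fderiv ℝ (r i) y‖⁻¹ : ℂ) *
        ∑ l, dbarReal (fderiv ℝ (r i) y) (w l) * h l y ∂μHE[k] = 0 := by
    intro i
    refine (setIntegral_congr_fun (measurableSet_cornerFace hopen hW.continuousOn i)
      fun y hy => ?_).trans (integral_zero _ _)
    have hsum : ∑ l, dbarReal (fderiv ℝ (r i) y) (w l) * h l y =
        F y * (monomialFn r β y : ℂ) * (u : Cn n → ℂ) y *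
          ∑ l, c j l y * dbarReal (fderiv ℝ (r i) y) (w l) := by
      rw [Finset.mul_sum]; exact Finset.sum_congr rfl fun l _ => by simp only [h]; ring
    rw [hsum]
    -- On the face of r_j the monomial carries the factor r_j^(α_j+1); along every other face L_j is
    -- tangent.
    by_cases hij : i = j
    · subst hij
      have : monomialFn r β y = 0 :=
        Finset.prod_eq_zero (Finset.mem_univ i) (by rw [hy.2.1]; simp [hβ])
      rw [this]; simp
    · rw [hL.dual_ne y hy.1 i j hij]; simp
  -- the interior terms
  have hint : ∀ y ∈ cornerDomain r W, ∑ l, dbarAt (h l) y (w l) =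
      (α j + 1) * (F y * (monomialFn r α y : ℂ) * (u : Cn n → ℂ) y) +
        F y * (monomialFn r β y : ℂ) * (transposeOp hopen hL j u : Cn n → ℂ) y := by
    intro y hy
    by_cases hyu : y ∈ tsupport (u : Cn n → ℂ)
    · have hyW := hy.1
      have hrd : ∀ i, DifferentiableAt ℝ (r i) y := fun i =>
        ((hW.contDiffOn i).contDiffAt (hopen.mem_nhds hyW)).differentiableAt one_ne_zero
      have hRd : DifferentiableAt ℝ (monomialFn r β) y :=
        ((hR β).contDiffAt (hopen.mem_nhds hyW)).differentiableAt one_ne_zero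
      have hRCd : DifferentiableAt ℝ (fun y => (monomialFn r β y : ℂ)) y :=
        ((hRC β).contDiffAt (hopen.mem_nhds hyW)).differentiableAt one_ne_zero
      have hFd : DifferentiableAt ℝ F y := hF.differentiable one_ne_zero y
      have hl : ∀ l, dbarAt (h l) y (w l) =
          F y * (u : Cn n → ℂ) y * (c j l y * dbarReal (fderiv ℝ (monomialFn r β) y) (w l)) +
          F y * (monomialFn r β y : ℂ) *
            dbarAt (fun y => c j l y * (u : Cn n → ℂ) y) y (w l) := by
        intro l
        have hcd : DifferentiableAt ℝ (fun y => c j l y * (u : Cn n → ℂ) y) y :=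
          ((hcu l).1.differentiable (by simp)).differentiableAt
        have hFR : DifferentiableAt ℝ (fun y => F y * (monomialFn r β y : ℂ)) y := hFd.mul hRCd
        change dbarAt (fun y => (F y * (monomialFn r β y : ℂ)) * (c j l y * (u : Cn n → ℂ) y)) y
          (w l) = _
        -- No derivative falls on `F`, which is holomorphic here: this is why the fields must be
        -- antiholomorphic.
        rw [dbarAt_mul hFR hcd, dbarAt_mul hFd hRCd, hFu y hy hyu, dbarAt_ofReal hRd]
        ring
      simp_rw [hl]
      rw [Finset.sum_add_distrib, ← Finset.mul_sum, ← Finset.mul_sum,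
        sum_dbarReal_monomialFn hL hyW hrd α j, transposeOp_apply]
      ring
    · have h0 : (u : Cn n → ℂ) y = 0 := image_eq_zero_of_notMem_tsupport hyu
      have h1 : (transposeOp hopen hL j u : Cn n → ℂ) y = 0 :=
        image_eq_zero_of_notMem_tsupport fun h' => hyu (tsupport_transposeOp_subset hopen hL j u h')
      rw [h0, h1, mul_zero, mul_zero, mul_zero, add_zero]
      exact Finset.sum_eq_zero fun l _ =>
        dbarAt_eq_zero_of_notMem_tsupport (fun h' => hyu (hts l h')) _
  have hInt : ∀ (α : ι → ℕ) (u : TestFn W),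
      Integrable fun y => F y * (monomialFn r α y : ℂ) * (u : Cn n → ℂ) y := fun α u =>
    (contDiff_mul_testFn hopen (hF.contDiffOn.mul (hRC α)) (by exact_mod_cast le_top)
      u).continuous.integrable_of_hasCompactSupport u.2.2.1.mul_left
  have hm := (isOpen_cornerDomain hopen hW.continuousOn).measurableSet
  rw [setIntegral_congr_fun hm hint, integral_add ((hInt α u).integrableOn.const_mul _)
    (hInt β (transposeOp hopen hL j u)).integrableOn, integral_const_mul,
    Finset.sum_eq_zero fun i _ => hbd i] at hst
  have hrhs : ∀ y, F y * (monomialFn r β y : ℂ) *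
        (((-((α j : ℂ) + 1)⁻¹) • transposeOp hopen hL j u : TestFn W) : Cn n → ℂ) y =
      (-((α j : ℂ) + 1)⁻¹) * (F y * (monomialFn r β y : ℂ) *
        (transposeOp hopen hL j u : Cn n → ℂ) y) := fun y => by
    rw [Submodule.coe_smul, Pi.smul_apply, smul_eq_mul]; ring
  simp_rw [hrhs]
  rw [integral_const_mul, ← eq_neg_of_add_eq_zero_left hst |> neg_eq_iff_eq_neg.2]
  field_simp

/-- Regularization: against holomorphic functions, a test function may be replaced by one which is
divisible by any given monomial in the defining functions. -/
theorem exists_regularization {k : ℕ} (hW : StokesNbhd k r W) (hL : DualFields W c w r)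
    (α : ι → ℕ) :
    ∃ P : TestFn W →ₗ[ℂ] TestFn W, JetBounded P ∧
      (∀ u, tsupport (P u : Cn n → ℂ) ⊆ tsupport (u : Cn n → ℂ)) ∧
      ∀ (F : Cn n → ℂ), ContDiff ℝ 1 F → ∀ u : TestFn W,
        (∀ y ∈ cornerDomain r W, y ∈ tsupport (u : Cn n → ℂ) → ∀ x, dbarAt F y x = 0) →
        ∫ y in cornerDomain r W, F y * (u : Cn n → ℂ) y =
          ∫ y in cornerDomain r W, F y * (monomialFn r α y : ℂ) * (P u : Cn n → ℂ) y := by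
  classical
  -- One power of one r_j is gained at a time, at the cost of one derivative of the test function.
  induction hN : ∑ i, α i generalizing α with
  | zero =>
    have h0 : ∀ i, α i = 0 := fun i => by
      have := Finset.sum_eq_zero_iff.1 hN i (Finset.mem_univ i); exact this
    refine ⟨LinearMap.id, JetBounded.id, fun u => subset_rfl, fun F _ u _ => ?_⟩
    simp [monomialFn, h0]
  | succ N ih =>
    obtain ⟨j, hj⟩ : ∃ j, α j ≠ 0 := by
      by_contra! hcon; simp [hcon] at hN
    set α' : ι → ℕ := α - Pi.single j 1 with hα'
    have hαα' : α = α' + Pi.single j 1 := by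
      ext i
      by_cases hij : i = j
      · subst hij; simp [hα']; omega
      · simp [hα', hij]
    have hN' : ∑ i, α' i = N := by
      rw [hαα'] at hN
      simp only [Pi.add_apply, Finset.sum_add_distrib, Finset.sum_pi_single',
        Finset.mem_univ, if_true] at hN
      omega
    obtain ⟨P, hPb, hPs, hP⟩ := ih α' hN'
    refine ⟨(-((α' j : ℂ) + 1)⁻¹) • (transposeOp hW.isOpen hL j ∘ₗ P),
      ((jetBounded_transposeOp _ hL j).comp hPb).smul _, fun u => ?_, fun F hF u hFu => ?_⟩
    · refine (tsupport_smul_subset_right (fun _ => (-((α' j : ℂ) + 1)⁻¹)) _).trans ?_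
      exact (tsupport_transposeOp_subset hW.isOpen hL j (P u)).trans (hPs u)
    · rw [hP F hF u hFu, integral_monomialFn_mul hW hL α' j hF (P u)
        fun y hy hyu => hFu y hy (hPs u hyu), ← hαα']
      rfl

end Dbar

/-! ### Generic families of covectors -/

section Generic

variable {n : ℕ} {ι : Type*} [Fintype ι] [DecidableEq ι]

/-- The antilinear parts of the covectors `lᵢ` are linearly independent, with dual vectors `wₖ`. -/
def IsDualTo (l : ι → Cn n →L[ℝ] ℝ) (w : ι → Cn n) : Prop :=
  ∀ i k, dbarReal (l i) (w k) = if i = k then 1 else 0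

/-- The complex-linear map with components l_i(x) - i l_i(ix), twice the (1,0)-parts, has as kernel
the maximal complex subspace of ⋂ ker l_i. The dimension hypothesis and rank-nullity make it
surjective; preimages of the standard basis are the dual vectors, since `dbarReal` is the complex
conjugate of this map. -/
theorem exists_isDualTo (l : ι → Cn n →L[ℝ] ℝ)
    (h : Module.finrank ℂ (maxComplexSubspace (⨅ j, (l j).ker)) + Fintype.card ι = n) :
    ∃ w, IsDualTo l w := by
  let Φ : Cn n →ₗ[ℂ] (ι → ℂ) :=
    LinearMap.pi fun i => Module.Dual.extendRCLike (𝕜 := ℂ) (l i : Cn n →ₗ[ℝ] ℝ)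
  have hΦ : ∀ x i, Φ x i = (l i x : ℂ) - Complex.I * (l i (Complex.I • x) : ℂ) := fun x i => rfl
  have hker : Φ.ker = maxComplexSubspace (⨅ j, (l j).ker) := by
    ext x
    have hmem : x ∈ maxComplexSubspace (⨅ j, (l j).ker) ↔ ∀ c : ℂ, ∀ i, l i (c • x) = 0 := by
      change (∀ c : ℂ, c • x ∈ ⨅ j, (l j).ker) ↔ _
      simp [Submodule.mem_iInf]
    rw [hmem, LinearMap.mem_ker]
    constructor
    · intro hx c i
      have h1 : Φ (c • x) i = 0 := by rw [map_smul, hx]; simp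
      rw [hΦ] at h1
      simpa using congrArg Complex.re h1
    · intro hx
      ext i
      rw [hΦ]
      have h1 := hx 1 i
      rw [one_smul] at h1
      simp [h1, hx Complex.I i]
  have hsurj : Function.Surjective Φ := by
    rw [← LinearMap.range_eq_top]
    apply Submodule.eq_top_of_finrank_eq
    have := LinearMap.finrank_range_add_finrank_ker Φ
    rw [hker, finrank_euclideanSpace_fin] at this
    rw [Module.finrank_pi]
    omega
  choose w hw using fun k : ι => hsurj (Pi.single k 1)
  refine ⟨w, fun i k => ?_⟩
  have h1 := congrFun (hw k) i
  rw [hΦ] at h1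
  have h2 := congrArg (starRingEnd ℂ) h1
  simp only [map_sub, map_mul, Complex.conj_ofReal, Complex.conj_I] at h2
  have h3 : dbarReal (l i) (w k) = starRingEnd ℂ ((Pi.single k 1 : ι → ℂ) i) := by
    rw [← h2, dbarReal]; ring
  rw [h3, Pi.single_apply]
  split_ifs <;> simp

/-- Duality is invariant under complex-linear changes of coordinates, so genericity on the manifold
can be read in any holomorphic chart. -/
theorem IsDualTo.comp {l : ι → Cn n →L[ℝ] ℝ} {w : ι → Cn n} (h : IsDualTo l w)
    (A : Cn n ≃L[ℂ] Cn n) :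
    IsDualTo (fun i => l i ∘L (A.restrictScalars ℝ : Cn n ≃L[ℝ] Cn n)) (fun k => A.symm (w k)) := by
  intro i k
  rw [← h i k]
  simp [dbarReal]

/-- Supplies the pairwise transversality of faces required by the divergence theorem: real
proportionality would pass to the antilinear parts. -/
theorem IsDualTo.ne_smul {l : ι → Cn n →L[ℝ] ℝ} {w : ι → Cn n} (h : IsDualTo l w) {i j : ι}
    (hij : i ≠ j) (c : ℝ) : l j ≠ c • l i := by
  intro hc
  have h1 := h j j
  have h2 := h i j
  rw [if_neg hij] at h2
  rw [if_pos rfl, hc] at h1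
  have : dbarReal (c • l i) (w j) = c * dbarReal (l i) (w j) := by
    simp [dbarReal]; ring
  rw [this, h2] at h1
  simp at h1

/-- The real part of `dbarReal (l i) (w k)` is l_i(w_k), so the sum of the dual vectors takes the
value 1 on every l_i. A generic corner thus always has an outward vector. -/
theorem IsDualTo.exists_pos {l : ι → Cn n →L[ℝ] ℝ} {w : ι → Cn n} (h : IsDualTo l w) :
    ∃ v, ∀ i, 0 < l i v := by
  refine ⟨∑ k, w k, fun i => ?_⟩
  have h1 : ∀ k, l i (w k) = if i = k then 1 else 0 := fun k => by
    have := congrArg Complex.re (h i k)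
    rw [apply_ite Complex.re] at this
    simpa [dbarReal] using this
  simp [h1]

theorem contDiffOn_det {E : Type*} [NormedAddCommGroup E] [NormedSpace ℝ E] {W : Set E}
    {B : E → Matrix ι ι ℂ} {m : ℕ∞ω} (hB : ∀ i j, ContDiffOn ℝ m (fun y => B y i j) W) :
    ContDiffOn ℝ m (fun y => (B y).det) W := by
  simp only [Matrix.det_apply]
  refine ContDiffOn.sum fun σ _ => ?_
  simp only [Units.smul_def, zsmul_eq_mul]
  exact contDiffOn_const.mul (contDiffOn_prod fun i _ => hB _ _)

/-- The coefficients are the entries of the inverse of the matrix of the antiholomorphic derivatives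
of the r_i along the constant vectors w_l. It is the identity at `p`, hence invertible nearby, and
Cramer's rule gives smoothness. -/
theorem exists_dualFields {r : ι → Cn n → ℝ} {O : Set (Cn n)} (hO : IsOpen O) {p : Cn n}
    (hp : p ∈ O) (hr : ∀ j, ContDiffOn ℝ ∞ (r j) O) {w : ι → Cn n}
    (hw : IsDualTo (fun j => fderiv ℝ (r j) p) w) :
    ∃ W ⊆ O, IsOpen W ∧ p ∈ W ∧ ∃ c, DualFields W c w r := by
  let B : Cn n → Matrix ι ι ℂ := fun y => Matrix.of fun l i => dbarReal (fderiv ℝ (r i) y) (w l)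
  have hB : ∀ l i, ContDiffOn ℝ ∞ (fun y => B y l i) O := by
    intro l i
    have h1 : ContDiffOn ℝ ∞ (fderiv ℝ (r i)) O := (hr i).fderiv_of_isOpen hO (by simp)
    have h2 : ∀ x : Cn n, ContDiffOn ℝ ∞ (fun y => (fderiv ℝ (r i) y x : ℂ)) O := fun x =>
      Complex.ofRealCLM.contDiff.comp_contDiffOn (h1.clm_apply contDiffOn_const)
    exact (h2 (w l)).add (contDiffOn_const.mul (h2 (Complex.I • w l)))
  have hdet := contDiffOn_det hB
  have hBp : B p = 1 := by
    ext l i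
    have := hw i l
    simp only [B, Matrix.of_apply, this, Matrix.one_apply, eq_comm]
  let W : Set (Cn n) := O ∩ (fun y => (B y).det) ⁻¹' {0}ᶜ
  have hW : IsOpen W := hdet.continuousOn.isOpen_inter_preimage hO isOpen_compl_singleton
  refine ⟨W, inter_subset_left, hW, ⟨hp, by simp [hBp]⟩, fun j l y => (B y)⁻¹ j l, ?_, ?_, ?_⟩
  · intro j l
    have hW0 : ∀ y ∈ W, (B y).det ≠ 0 := fun y hy => hy.2
    have hadj : ContDiffOn ℝ ∞ (fun y => (B y).adjugate j l) W := by
      simp only [Matrix.adjugate_apply]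
      refine contDiffOn_det fun a b => ?_
      by_cases ha : a = l
      · subst ha
        simp only [Matrix.updateRow_self]; exact contDiffOn_const
      · simp only [Matrix.updateRow_ne ha]; exact (hB a b).mono inter_subset_left
    refine (((hdet.mono inter_subset_left).inv hW0).mul hadj).congr fun y hy => ?_
    simp [Matrix.inv_def, Ring.inverse_eq_inv']
  · intro y hy j
    have h1 : ((B y)⁻¹ * B y) j j = 1 := by
      rw [Matrix.nonsing_inv_mul _ (isUnit_iff_ne_zero.2 hy.2)]; simp
    exact h1
  · intro y hy i j hij
    have h1 : ((B y)⁻¹ * B y) j i = 0 := by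
      rw [Matrix.nonsing_inv_mul _ (isUnit_iff_ne_zero.2 hy.2)]; simp [hij.symm]
    exact h1

end Generic

/-! ### Forms of top degree and of codegree one on `ℂⁿ` -/

section Forms

variable {n k : ℕ}

/-- The real frame `e₁, i e₁, …, eₙ, i eₙ` of `ℂⁿ` is a basis. -/
def realFrameBasis (hk : k + 1 = n * 2) : Module.Basis (Fin (k + 1)) ℝ (Cn n) :=
  ((Complex.basisOneI.smulTower (EuclideanSpace.basisFun (Fin n) ℂ).toBasis).reindex
    (Equiv.prodComm _ _)).reindex (finProdFinEquiv.trans (finCongr hk.symm))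

theorem realFrameBasis_apply (hk : k + 1 = n * 2) (i : Fin (k + 1)) :
    realFrameBasis hk i = realFrame n i := by
  obtain ⟨⟨a, b⟩, rfl⟩ := (finProdFinEquiv.trans (finCongr hk.symm)).surjective i
  have h1 : realFrameBasis hk ((finProdFinEquiv.trans (finCongr hk.symm)) (a, b)) =
      Complex.basisOneI b • EuclideanSpace.basisFun (Fin n) ℂ a := by
    simp [realFrameBasis]
  rw [h1]
  have h2 : (((finProdFinEquiv.trans (finCongr hk.symm)) (a, b) : Fin (k + 1)) : ℕ) =
      (b : ℕ) + 2 * a := by simp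
  rw [h2]
  ext j
  by_cases hj : j = a
  · subst hj
    fin_cases b
    · simp [realFrame, Complex.coe_basisOneI]
    · simp [realFrame, Complex.coe_basisOneI, add_comm]
  · have hj' : (a : ℕ) ≠ j := fun h => hj (Fin.ext h.symm)
    have h3 : ¬ ((b : ℕ) + 2 * a = 2 * j) := by have := b.2; omega
    have h4 : ¬ ((b : ℕ) + 2 * a = 2 * j + 1) := by have := b.2; omega
    simp [realFrame, h3, h4, hj]

/-- A form of top degree transforms under a linear map by its determinant. -/
theorem map_comp_realFrame (hk : k + 1 = n * 2) (f : (Cn n) [⋀^Fin (k + 1)]→L[ℝ] ℂ)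
    (A : Cn n →L[ℝ] Cn n) :
    f (fun i => A (realFrame n i)) =
      (LinearMap.det (A : Cn n →ₗ[ℝ] Cn n) : ℝ) * f fun i => realFrame n i := by
  set b := realFrameBasis hk
  have hb : (fun i : Fin (k + 1) => realFrame n i) = b := funext fun i =>
    (realFrameBasis_apply hk i).symm
  have hAb : (fun i : Fin (k + 1) => A (realFrame n i)) = (A : Cn n →ₗ[ℝ] Cn n) ∘ b := by
    rw [← hb]; rfl
  have key : ∀ g : (Cn n) [⋀^Fin (k + 1)]→ₗ[ℝ] ℝ, g ((A : Cn n →ₗ[ℝ] Cn n) ∘ b) =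
      LinearMap.det (A : Cn n →ₗ[ℝ] Cn n) * g b := by
    intro g
    have h1 := congrArg (fun G => G ((A : Cn n →ₗ[ℝ] Cn n) ∘ b)) (g.eq_smul_basis_det b)
    simp only [AlternatingMap.smul_apply, Module.Basis.det_comp, Module.Basis.det_self, smul_eq_mul,
      mul_one] at h1
    rw [h1]; ring
  rw [hAb, hb]
  apply Complex.ext
  · have := key (Complex.reLm.compAlternatingMap f.toAlternatingMap)
    simpa using this
  · have := key (Complex.imLm.compAlternatingMap f.toAlternatingMap)
    simpa using this

/-- The exterior product of a complex covector and a form. -/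
def wedge (l : Cn n →L[ℝ] ℂ) (η : (Cn n) [⋀^Fin k]→L[ℝ] ℂ) : (Cn n) [⋀^Fin (k + 1)]→L[ℝ] ℂ :=
  .alternatizeUncurryFin (((ContinuousLinearMap.toSpanSingleton ℂ η).restrictScalars ℝ) ∘L l)

theorem wedge_apply (l : Cn n →L[ℝ] ℂ) (η : (Cn n) [⋀^Fin k]→L[ℝ] ℂ) (v : Fin (k + 1) → Cn n) :
    wedge l η v = ∑ i : Fin (k + 1), (-1) ^ (i : ℕ) * l (v i) * η (i.removeNth v) := by
  rw [wedge, ContinuousAlternatingMap.alternatizeUncurryFin_apply]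
  refine Finset.sum_congr rfl fun i _ => ?_
  simp [mul_assoc]

/-- The exterior product of a `(1,0)`-covector and a form of bidegree `(n,n-1)` vanishes. -/
theorem wedge_realFrame_eq_zero (hk : k + 1 = n * 2) {l : Cn n →L[ℝ] ℂ}
    (hl : ∀ x, l (Complex.I • x) = Complex.I * l x) {η : (Cn n) [⋀^Fin k]→L[ℝ] ℂ}
    (hη : ∀ v : Fin k → Cn n, η (fun a => Complex.I • v a) = Complex.I * η v) :
    (wedge l η fun i => realFrame n i) = 0 := by
  -- Multiplying all arguments by i multiplies the form by i · i = -1, by its bidegree, but also by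
  -- the real determinant of multiplication by i, which is 1. So the form equals its own negative.
  have h1 : (wedge l η fun i => Complex.I • realFrame n i) =
      -(wedge l η fun i => realFrame n i) := by
    rw [wedge_apply, wedge_apply, ← Finset.sum_neg_distrib]
    refine Finset.sum_congr rfl fun i _ => ?_
    have : (i.removeNth fun j : Fin (k + 1) => Complex.I • realFrame n j) =
      fun a => Complex.I • i.removeNth (fun j : Fin (k + 1) => realFrame n j) a := rfl
    rw [this, hη, hl]
    linear_combination ((-1) ^ (i : ℕ) * l (realFrame n i) *
      η (i.removeNth fun j : Fin (k + 1) => realFrame n j)) * Complex.I_mul_I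
  let A : Cn n →ₗ[ℂ] Cn n := Complex.I • LinearMap.id
  have h2 := map_comp_realFrame hk (wedge l η)
    (LinearMap.toContinuousLinearMap (A.restrictScalars ℝ))
  have h3 : LinearMap.det (A.restrictScalars ℝ) = 1 := by
    rw [LinearMap.det_restrictScalars, Algebra.norm_complex_apply]
    simp [A, LinearMap.det_smul]
  rw [LinearMap.coe_toContinuousLinearMap, h3] at h2
  have h4 : (wedge l η fun i => Complex.I • realFrame n i) = wedge l η fun i => realFrame n i := by
    simpa [A] using h2
  rw [h4] at h1
  exact self_eq_neg.1 h1

end Forms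

/-! ### Stokes' theorem for a holomorphic function times an (n,n-1)-form -/

section FormStokes

variable {n k : ℕ} {ι : Type*} [Fintype ι] {W : Set (Cn n)} {r : ι → Cn n → ℝ}

/-- The coefficient of the exterior derivative of a form of degree `2n - 1`. -/
def topCoeff (η : Cn n → (Cn n) [⋀^Fin k]→L[ℝ] ℂ) (y : Cn n) : ℂ :=
  extDeriv η y fun i => realFrame n i

theorem topCoeff_eq_sum (η : Cn n → (Cn n) [⋀^Fin k]→L[ℝ] ℂ) (y : Cn n) :
    topCoeff η y = ∑ i : Fin (k + 1), (-1) ^ (i : ℕ) *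
      fderiv ℝ η y (realFrame n i) fun a : Fin k => realFrame n (i.succAbove a) := by
  rw [topCoeff, extDeriv, ContinuousAlternatingMap.alternatizeUncurryFin_apply]
  refine Finset.sum_congr rfl fun i _ => ?_
  rw [← Int.cast_smul_eq_zsmul ℂ, smul_eq_mul]
  push_cast
  rfl

theorem tsupport_topCoeff_subset (η : Cn n → (Cn n) [⋀^Fin k]→L[ℝ] ℂ) :
    tsupport (topCoeff η) ⊆ tsupport η := by
  refine closure_minimal (fun y hy => ?_) (isClosed_tsupport _)
  by_contra h
  refine hy ?_
  rw [topCoeff_eq_sum]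
  simp [fderiv_of_notMem_tsupport ℝ h]

theorem fderiv_apply_I_smul {F : Cn n → ℂ} {y : Cn n} (h : ∀ x, dbarAt F y x = 0) (x : Cn n) :
    fderiv ℝ F y (Complex.I • x) = Complex.I * fderiv ℝ F y x := by
  have h1 := h x
  rw [dbarAt] at h1
  linear_combination (-Complex.I) * h1 + fderiv ℝ F y (Complex.I • x) * Complex.I_mul_I

/-- The terms of the divergence form of `F η`. -/
def formComponent (F : Cn n → ℂ) (η : Cn n → (Cn n) [⋀^Fin k]→L[ℝ] ℂ) (i : Fin (k + 1))
    (y : Cn n) : ℂ :=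
  (-1) ^ (i : ℕ) * (F y * η y fun a : Fin k => realFrame n (i.succAbove a))

theorem contDiff_formComponent {F : Cn n → ℂ} {η : Cn n → (Cn n) [⋀^Fin k]→L[ℝ] ℂ}
    (hF : ContDiff ℝ 1 F) (hη : ContDiff ℝ 1 η) (i : Fin (k + 1)) :
    ContDiff ℝ 1 (formComponent F η i) := by
  unfold formComponent
  exact contDiff_const.mul (hF.mul
    ((ContinuousAlternatingMap.apply ℝ (Cn n) ℂ fun a : Fin k =>
      realFrame n (i.succAbove a)).contDiff.comp hη))

theorem tsupport_formComponent_subset (F : Cn n → ℂ) (η : Cn n → (Cn n) [⋀^Fin k]→L[ℝ] ℂ)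
    (i : Fin (k + 1)) : tsupport (formComponent F η i) ⊆ tsupport η := by
  refine closure_minimal (fun y hy => ?_) (isClosed_tsupport _)
  by_contra h
  refine hy ?_
  simp [formComponent, image_eq_zero_of_notMem_tsupport h]

theorem fderiv_formComponent {F : Cn n → ℂ} {η : Cn n → (Cn n) [⋀^Fin k]→L[ℝ] ℂ} {y : Cn n}
    (hF : DifferentiableAt ℝ F y) (hη : DifferentiableAt ℝ η y) (i : Fin (k + 1)) (x : Cn n) :
    fderiv ℝ (formComponent F η i) y x = (-1) ^ (i : ℕ) *
      (F y * fderiv ℝ η y x (fun a : Fin k => realFrame n (i.succAbove a)) +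
        fderiv ℝ F y x * η y fun a : Fin k => realFrame n (i.succAbove a)) := by
  have h1 : HasFDerivAt (fun y => η y fun a : Fin k => realFrame n (i.succAbove a))
      ((ContinuousAlternatingMap.apply ℝ (Cn n) ℂ fun a : Fin k => realFrame n (i.succAbove a))
        ∘L fderiv ℝ η y) y :=
    (ContinuousAlternatingMap.apply ℝ (Cn n) ℂ fun a : Fin k =>
      realFrame n (i.succAbove a)).hasFDerivAt.comp y hη.hasFDerivAt
  have h2 := (hF.hasFDerivAt.mul h1).const_mul ((-1 : ℂ) ^ (i : ℕ))
  have h3 : fderiv ℝ (formComponent F η i) y = _ := h2.fderiv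
  rw [h3]
  simp only [smul_apply, add_apply, smul_eq_mul, ContinuousLinearMap.comp_apply,
    ContinuousAlternatingMap.apply_apply]
  ring

/-- This is d(Fη) = dF ∧ η + F dη: where `F` satisfies the Cauchy–Riemann equations dF is of type
(1,0), and its product with an (n,n-1)-form vanishes. -/
theorem sum_fderiv_formComponent (hk : k + 1 = n * 2) {F : Cn n → ℂ}
    {η : Cn n → (Cn n) [⋀^Fin k]→L[ℝ] ℂ} {y : Cn n}
    (hF : DifferentiableAt ℝ F y) (hη : DifferentiableAt ℝ η y)
    (hFy : ∀ x, dbarAt F y x = 0)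
    (hηI : ∀ v : Fin k → Cn n, η y (fun a => Complex.I • v a) = Complex.I * η y v) :
    ∑ i : Fin (k + 1), fderiv ℝ (formComponent F η i) y (realFrame n i) = F y * topCoeff η y := by
  have h1 := wedge_realFrame_eq_zero hk (fderiv_apply_I_smul hFy) hηI
  rw [wedge_apply] at h1
  simp_rw [fderiv_formComponent hF hη, mul_add, Finset.sum_add_distrib]
  rw [topCoeff_eq_sum, Finset.mul_sum]
  have h2 : ∑ i : Fin (k + 1), (-1 : ℂ) ^ (i : ℕ) * (fderiv ℝ F y (realFrame n i) *
      η y fun a : Fin k => realFrame n (i.succAbove a)) = 0 := by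
    rw [← h1]
    exact Finset.sum_congr rfl fun i _ => (mul_assoc _ _ _).symm
  rw [h2, add_zero]
  exact Finset.sum_congr rfl fun i _ => by ring

theorem surfaceDensity_smul_eq (F : Cn n → ℂ) (η : Cn n → (Cn n) [⋀^Fin k]→L[ℝ] ℂ) (y : Cn n)
    (a : ℝ) (l : Cn n →L[ℝ] ℝ) :
    surfaceDensity (a • l) (F y • η y) =
      ∑ i : Fin (k + 1), ((a * l (realFrame n i) : ℝ) : ℂ) * formComponent F η i y := by
  refine Finset.sum_congr rfl fun i _ => ?_
  simp only [formComponent, smul_apply, ContinuousAlternatingMap.smul_apply, smul_eq_mul]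
  push_cast
  ring

/-- The integrability of a form over the faces of a corner domain. -/
theorem StokesNbhd.integrableOn_surfaceDensity (hW : StokesNbhd k r W) {F : Cn n → ℂ}
    {η : Cn n → (Cn n) [⋀^Fin k]→L[ℝ] ℂ} (hF : ContDiff ℝ 1 F) (hη : ContDiff ℝ 1 η)
    (hηc : HasCompactSupport η) (hηW : tsupport η ⊆ W) (j : ι) :
    IntegrableOn (fun y => surfaceDensity (‖fderiv ℝ (r j) y‖⁻¹ • fderiv ℝ (r j) y) (F y • η y))
      (cornerFace r W j) μHE[k] := by
  simp_rw [surfaceDensity_smul_eq]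
  exact integrable_finsetSum _ fun i _ => hW.integrableOn_face
    (contDiff_formComponent hF hη i).continuous
    (hηc.of_isClosed_subset (isClosed_tsupport _) (tsupport_formComponent_subset F η i))
    ((tsupport_formComponent_subset F η i).trans hηW) _ j

/-- Stokes' theorem for `F η`, with `F` holomorphic and `η` of bidegree `(n,n-1)`. -/
theorem StokesNbhd.integral_mul_topCoeff (hk : k + 1 = n * 2) (hW : StokesNbhd k r W)
    {F : Cn n → ℂ} {η : Cn n → (Cn n) [⋀^Fin k]→L[ℝ] ℂ} (hF : ContDiff ℝ 1 F)
    (hη : ContDiff ℝ 1 η) (hηc : HasCompactSupport η) (hηW : tsupport η ⊆ W)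
    (hηI : ∀ y (v : Fin k → Cn n), η y (fun a => Complex.I • v a) = Complex.I * η y v)
    (hFη : ∀ y ∈ cornerDomain r W, y ∈ tsupport η → ∀ x, dbarAt F y x = 0) :
    ∫ y in cornerDomain r W, F y * topCoeff η y =
      ∑ j, ∫ y in cornerFace r W j,
        surfaceDensity (‖fderiv ℝ (r j) y‖⁻¹ • fderiv ℝ (r j) y) (F y • η y) ∂μHE[k] := by
  have hc := contDiff_formComponent hF hη
  have hs : ∀ i, HasCompactSupport (formComponent F η i) := fun i =>
    hηc.of_isClosed_subset (isClosed_tsupport _) (tsupport_formComponent_subset F η i)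
  have hsW : ∀ i, tsupport (formComponent F η i) ⊆ W := fun i =>
    (tsupport_formComponent_subset F η i).trans hηW
  have hm := (isOpen_cornerDomain hW.isOpen hW.continuousOn).measurableSet
  have h1 : ∀ y ∈ cornerDomain r W, F y * topCoeff η y =
      ∑ i : Fin (k + 1), fderiv ℝ (formComponent F η i) y (realFrame n i) := by
    intro y hy
    by_cases hyη : y ∈ tsupport η
    · exact (sum_fderiv_formComponent hk (hF.differentiable one_ne_zero y)
        (hη.differentiable one_ne_zero y) (hFη y hy hyη) (hηI y)).symm
    · rw [image_eq_zero_of_notMem_tsupport fun h => hyη (tsupport_topCoeff_subset η h), mul_zero]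
      refine (Finset.sum_eq_zero fun i _ => ?_).symm
      rw [fderiv_of_notMem_tsupport ℝ fun h => hyη (tsupport_formComponent_subset F η i h)]
      rfl
  rw [setIntegral_congr_fun hm h1, integral_finsetSum]
  · simp_rw [surfaceDensity_smul_eq]
    have h2 : ∀ j, ∫ y in cornerFace r W j, ∑ i : Fin (k + 1), ((‖fderiv ℝ (r j) y‖⁻¹ *
        fderiv ℝ (r j) y (realFrame n i) : ℝ) : ℂ) * formComponent F η i y ∂μHE[k] =
        ∑ i : Fin (k + 1), ∫ y in cornerFace r W j, ((‖fderiv ℝ (r j) y‖⁻¹ *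
        fderiv ℝ (r j) y (realFrame n i) : ℝ) : ℂ) * formComponent F η i y ∂μHE[k] := fun j =>
      integral_finsetSum _ fun i _ => hW.integrableOn_face (hc i).continuous (hs i) (hsW i) _ j
    simp_rw [h2]
    rw [Finset.sum_comm]
    exact Finset.sum_congr rfl fun i _ => hW.integral_eq _ (hc i) (hs i) (hsW i) _
  · intro i _
    exact ((((hc i).continuous_fderiv one_ne_zero).clm_apply
      continuous_const).integrable_of_hasCompactSupport
        ((hs i).fderiv_apply (𝕜 := ℝ) _)).integrableOn

end FormStokes

/-! ### Holomorphic functions of several variables -/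

section Holomorphic

variable {n : ℕ}

/-- Cauchy's estimate on a fixed disc in the direction `w`, applied to F(y+ζw) - F(p+ζw), which is
small uniformly on the disc, by compactness, when `y` is near `p`. -/
theorem continuousOn_fderiv_apply_of_differentiableOn {V : Set (Cn n)} (hV : IsOpen V)
    {F : Cn n → ℂ} (hF : DifferentiableOn ℂ F V) (w : Cn n) :
    ContinuousOn (fun y => fderiv ℂ F y w) V := by
  intro p hp
  refine ContinuousAt.continuousWithinAt ?_
  have hcurve : Continuous fun x : Cn n × ℂ => x.1 + x.2 • w := by fun_prop
  obtain ⟨R, hR, hRV⟩ : ∃ R > 0, ∀ᶠ y in 𝓝 p, ∀ ζ ∈ Metric.closedBall (0 : ℂ) R,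
      y + ζ • w ∈ V := by
    have h1 : ∀ᶠ x : Cn n × ℂ in 𝓝 (p, 0), x.1 + x.2 • w ∈ V :=
      hcurve.continuousAt.eventually_mem (hV.mem_nhds (by simpa using hp))
    rw [nhds_prod_eq, eventually_prod_iff] at h1
    obtain ⟨pa, ha, pb, hb, hab⟩ := h1
    obtain ⟨R, hR, hRb⟩ := Metric.nhds_basis_closedBall.eventually_iff.1 hb
    exact ⟨R, hR, ha.mono fun y hy ζ hζ => hab hy (hRb hζ)⟩
  have hlin : ∀ y : Cn n, (∀ ζ ∈ Metric.closedBall (0 : ℂ) R, y + ζ • w ∈ V) →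
      DifferentiableOn ℂ (fun ζ : ℂ => F (y + ζ • w)) (Metric.closedBall 0 R) ∧
      deriv (fun ζ : ℂ => F (y + ζ • w)) 0 = fderiv ℂ F y w := by
    intro y hy
    have hd : Differentiable ℂ fun ζ : ℂ => y + ζ • w := by fun_prop
    refine ⟨hF.comp hd.differentiableOn hy, ?_⟩
    have h0 : y ∈ V := by simpa using hy 0 (by simp [hR.le])
    have h1 : HasDerivAt (fun ζ : ℂ => y + ζ • w) w 0 := by
      simpa using ((hasDerivAt_id (0 : ℂ)).smul_const w).const_add y
    have h2 : HasFDerivAt F (fderiv ℂ F y) (y + (0 : ℂ) • w) := by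
      simpa using (hF.differentiableAt (hV.mem_nhds h0)).hasFDerivAt
    exact (h2.comp_hasDerivAt (0 : ℂ) h1).deriv
  rw [Metric.continuousAt_iff']
  intro ε hε
  have hcont : ∀ᶠ y in 𝓝 p, ∀ ζ ∈ Metric.closedBall (0 : ℂ) R,
      ‖F (y + ζ • w) - F (p + ζ • w)‖ < ε * R / 2 := by
    refine (isCompact_closedBall (0 : ℂ) R).eventually_forall_of_forall_eventually fun ζ hζ => ?_
    have hmem : p + ζ • w ∈ V := hRV.self_of_nhds ζ hζ
    have h1 : ContinuousAt (fun x : Cn n × ℂ => F (x.1 + x.2 • w)) (p, ζ) :=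
      ContinuousAt.comp (f := fun x : Cn n × ℂ => x.1 + x.2 • w)
        (hF.continuousOn.continuousAt (hV.mem_nhds hmem)) hcurve.continuousAt
    have hc2 : Continuous fun x : Cn n × ℂ => p + x.2 • w := by fun_prop
    have h2 : ContinuousAt (fun x : Cn n × ℂ => F (p + x.2 • w)) (p, ζ) :=
      ContinuousAt.comp (f := fun x : Cn n × ℂ => p + x.2 • w)
        (hF.continuousOn.continuousAt (hV.mem_nhds hmem)) hc2.continuousAt
    have h3 := (h1.sub h2).norm
    refine h3.eventually_lt_const ?_
    simpa using by positivity
  filter_upwards [hcont, hRV] with y hy hyV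
  obtain ⟨hd1, he1⟩ := hlin y hyV
  obtain ⟨hd2, he2⟩ := hlin p hRV.self_of_nhds
  have hsub : closure (Metric.ball (0 : ℂ) R) = Metric.closedBall 0 R := closure_ball 0 hR.ne'
  have hdc : DiffContOnCl ℂ (fun ζ : ℂ => F (y + ζ • w) - F (p + ζ • w)) (Metric.ball 0 R) := by
    apply DifferentiableOn.diffContOnCl
    rw [hsub]; exact hd1.sub hd2
  have h1 := Complex.norm_deriv_le_of_forall_mem_sphere_norm_le hR hdc
    (fun ζ hζ => (hy ζ (Metric.sphere_subset_closedBall hζ)).le)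
  have hn : Metric.closedBall (0 : ℂ) R ∈ 𝓝 0 := Metric.closedBall_mem_nhds 0 hR
  rw [deriv_fun_sub (hd1.differentiableAt hn) (hd2.differentiableAt hn), he1, he2] at h1
  rw [dist_eq_norm]
  refine h1.trans_lt ?_
  have : ε * R / 2 / R = ε / 2 := by field_simp
  linarith

/-- In finite dimension, continuity of all directional derivatives is continuity of the
differential. Order one is all that the divergence theorem asks of the holomorphic factor. -/
theorem contDiffOn_one_of_differentiableOn {V : Set (Cn n)} (hV : IsOpen V)
    {F : Cn n → ℂ} (hF : DifferentiableOn ℂ F V) : ContDiffOn ℝ 1 F V := by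
  refine ContDiffOn.restrict_scalars (𝕜' := ℂ) ℝ ?_
  rw [show (1 : ℕ∞ω) = 0 + 1 from rfl, contDiffOn_succ_iff_fderiv_of_isOpen hV]
  exact ⟨hF, by simp, contDiffOn_zero.2 (continuousOn_clm_apply.2 fun w =>
    continuousOn_fderiv_apply_of_differentiableOn hV hF w)⟩

theorem dbarAt_eq_zero_of_differentiableAt {F : Cn n → ℂ} {y : Cn n}
    (hF : DifferentiableAt ℂ F y) (x : Cn n) : dbarAt F y x = 0 := by
  have h1 : fderiv ℝ F y = (fderiv ℂ F y).restrictScalars ℝ :=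
    (hF.hasFDerivAt.restrictScalars ℝ).fderiv
  rw [dbarAt, h1, ContinuousLinearMap.coe_restrictScalars', map_smul, smul_eq_mul, ← mul_assoc,
    Complex.I_mul_I]
  ring

/-- A holomorphic function may be modified away from a closed set so as to be everywhere `C¹`. -/
theorem exists_contDiff_eqOn {K V : Set (Cn n)} (hK : IsClosed K) (hV : IsOpen V) (hKV : K ⊆ V)
    {F : Cn n → ℂ} (hF : DifferentiableOn ℂ F V) :
    ∃ G : Cn n → ℂ, ContDiff ℝ 1 G ∧ ∀ y ∈ K, G y = F y ∧ ∀ x, dbarAt G y x = 0 := by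
  -- The cut-off is 1 on a neighbourhood of `K`, not only on `K`, so that the derivatives on `K` are
  -- also unchanged; it is 0 near the complement of `V`, where `F` is uncontrolled.
  obtain ⟨χ, h0, h1, -⟩ := exists_contMDiffMap_zero_one_nhds_of_isClosed (n := ⊤) 𝓘(ℝ, Cn n)
    hV.isClosed_compl hK (disjoint_left.2 fun y hy hy' => hy (hKV hy'))
  have hχ : ContDiff ℝ 1 χ := (χ.contMDiff.contDiff).of_le (by exact_mod_cast le_top)
  have hF1 := contDiffOn_one_of_differentiableOn hV hF
  refine ⟨fun y => χ y • F y, ?_, fun y hy => ?_⟩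
  · rw [contDiff_iff_contDiffAt]
    intro y
    by_cases hy : y ∈ V
    · exact hχ.contDiffAt.smul (hF1.contDiffAt (hV.mem_nhds hy))
    · refine (contDiffAt_const (c := (0 : ℂ))).congr_of_eventuallyEq ?_
      filter_upwards [(eventually_nhdsSet_iff_forall.1 h0) y hy] with z hz
      simp [hz]
  · have hev : (fun y => χ y • F y) =ᶠ[𝓝 y] F := by
      filter_upwards [(eventually_nhdsSet_iff_forall.1 h1) y hy] with z hz
      simp [hz]
    refine ⟨hev.self_of_nhds, fun x => ?_⟩
    rw [dbarAt, hev.fderiv_eq]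
    exact dbarAt_eq_zero_of_differentiableAt (hF.differentiableAt (hV.mem_nhds (hKV hy))) x

end Holomorphic

/-! ### Holomorphic charts -/

section Charts

variable {n : ℕ} {M : Type*} [TopologicalSpace M] [ChartedSpace (Cn n) M]
  [IsManifold 𝓘(ℂ, Cn n) ω M] {e e' : OpenPartialHomeomorph M (Cn n)}

theorem contDiffOn_transition (he : e ∈ holCharts n M) (he' : e' ∈ holCharts n M) :
    ContDiffOn ℂ ω (e' ∘ e.symm) (e.symm.trans e').source := by
  have h := IsManifold.compatible_of_mem_maximalAtlas he he'
  rw [contDiffGroupoid, mem_groupoid_of_pregroupoid] at h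
  have h1 := h.1
  simpa [contDiffPregroupoid, ContDiffOn] using h1

theorem mem_maximalAtlas_real (he : e ∈ holCharts n M) :
    e ∈ IsManifold.maximalAtlas 𝓘(ℝ, Cn n) ω M := by
  rw [IsManifold.mem_maximalAtlas_iff, mem_maximalAtlas_iff]
  intro e' he'
  have he'' : e' ∈ holCharts n M := IsManifold.subset_maximalAtlas he'
  constructor
  all_goals
    rw [contDiffGroupoid, mem_groupoid_of_pregroupoid]
  · exact ⟨by simpa [contDiffPregroupoid] using (contDiffOn_transition he he'').restrict_scalars ℝ,
      by simpa [contDiffPregroupoid] using (contDiffOn_transition he'' he).restrict_scalars ℝ⟩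
  · exact ⟨by simpa [contDiffPregroupoid] using (contDiffOn_transition he'' he).restrict_scalars ℝ,
      by simpa [contDiffPregroupoid] using (contDiffOn_transition he he'').restrict_scalars ℝ⟩

/-- The two transition maps are mutually inverse near the point, so the chain rule makes their
complex derivatives mutually inverse. -/
theorem exists_hasFDerivAt_transition (he : e ∈ holCharts n M) (he' : e' ∈ holCharts n M)
    {y : Cn n} (hy : y ∈ e.target) (hy' : e.symm y ∈ e'.source) :
    ∃ A : Cn n ≃L[ℂ] Cn n, HasFDerivAt (e' ∘ e.symm) (A : Cn n →L[ℂ] Cn n) y := by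
  have hd : ∀ {e e' : OpenPartialHomeomorph M (Cn n)}, e ∈ holCharts n M → e' ∈ holCharts n M →
      ∀ {y : Cn n}, y ∈ e.target → e.symm y ∈ e'.source →
      DifferentiableAt ℂ (e' ∘ e.symm) y := by
    intro e e' he he' y hy hy'
    exact ((contDiffOn_transition he he').contDiffAt ((e.symm.trans e').open_source.mem_nhds
      (by simp [hy, hy']))).differentiableAt (by simp)
  have h1 := (hd he he' hy hy').hasFDerivAt
  have hT : (e' ∘ e.symm) y ∈ e'.target := e'.map_source hy'
  have hTs : e'.symm ((e' ∘ e.symm) y) = e.symm y := e'.left_inv hy'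
  have h2 := (hd he' he hT (by rw [hTs]; exact e.map_target hy)).hasFDerivAt
  have h12 := h2.comp y h1
  have hid1 : (e ∘ e'.symm) ∘ (e' ∘ e.symm) =ᶠ[𝓝 y] id := by
    filter_upwards [(e.symm.trans e').open_source.mem_nhds (by simp [hy, hy'])] with z hz
    simp only [OpenPartialHomeomorph.trans_source, OpenPartialHomeomorph.symm_source, mem_inter_iff,
      mem_preimage] at hz
    simp [e'.left_inv hz.2, e.right_inv hz.1]
  have hcomp1 := (h12.congr_of_eventuallyEq hid1.symm).unique (hasFDerivAt_id y)
  have hy2 : (e ∘ e'.symm) ((e' ∘ e.symm) y) = y := hid1.self_of_nhds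
  have h1' : HasFDerivAt (e' ∘ e.symm) (fderiv ℂ (e' ∘ e.symm) y)
      ((e ∘ e'.symm) ((e' ∘ e.symm) y)) := by rw [hy2]; exact h1
  have h21 := h1'.comp _ h2
  have hid2 : (e' ∘ e.symm) ∘ (e ∘ e'.symm) =ᶠ[𝓝 ((e' ∘ e.symm) y)] id := by
    filter_upwards [(e'.symm.trans e).open_source.mem_nhds
      (by simp only [OpenPartialHomeomorph.trans_source, OpenPartialHomeomorph.symm_source,
            mem_inter_iff, mem_preimage]; exact ⟨hT, by rw [hTs]; exact e.map_target hy⟩)] with z hz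
    simp only [OpenPartialHomeomorph.trans_source, OpenPartialHomeomorph.symm_source, mem_inter_iff,
      mem_preimage] at hz
    simp [e.left_inv hz.2, e'.right_inv hz.1]
  have hcomp2 := (h21.congr_of_eventuallyEq hid2.symm).unique (hasFDerivAt_id _)
  exact ⟨ContinuousLinearEquiv.equivOfInverse (fderiv ℂ (e' ∘ e.symm) y) _
    (fun x => DFunLike.congr_fun hcomp1 x) (fun x => DFunLike.congr_fun hcomp2 x), h1⟩

theorem mdifferentiableAt_symm_real (he : e ∈ holCharts n M) {y : Cn n} (hy : y ∈ e.target) :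
    MDifferentiableAt 𝓘(ℝ, Cn n) 𝓘(ℝ, Cn n) e.symm y :=
  (contMDiffAt_symm_of_mem_maximalAtlas (mem_maximalAtlas_real he) hy).mdifferentiableAt (by simp)

/-- The derivative of the inverse of a holomorphic chart is a complex linear isomorphism. -/
theorem exists_mfderiv_symm_eq (he : e ∈ holCharts n M) {y : Cn n} (hy : y ∈ e.target) :
    ∃ A : Cn n ≃L[ℂ] Cn n, mfderiv 𝓘(ℝ, Cn n) 𝓘(ℝ, Cn n) e.symm y =
      (A : Cn n →L[ℂ] Cn n).restrictScalars ℝ := by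
  obtain ⟨A, hA⟩ := exists_hasFDerivAt_transition he
    (IsManifold.chart_mem_maximalAtlas (I := 𝓘(ℂ, Cn n)) (n := ω) (e.symm y)) hy
    (mem_chart_source _ _)
  refine ⟨A, ?_⟩
  have h1 : HasMFDerivAt 𝓘(ℝ, Cn n) 𝓘(ℝ, Cn n) e.symm y
      ((A : Cn n →L[ℂ] Cn n).restrictScalars ℝ) := by
    refine ⟨(mdifferentiableAt_symm_real he hy).continuousAt, ?_⟩
    simp only [writtenInExtChartAt, mfld_simps]
    rw [chartAt_self_eq]
    exact (hA.restrictScalars ℝ).hasFDerivWithinAt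
  exact h1.mfderiv

/-- The change of charts for forms. -/
theorem inChart_eq_pullback {k : ℕ} (he : e ∈ holCharts n M) (he' : e' ∈ holCharts n M)
    (ψ : Form n M k) {y : Cn n} (hy : y ∈ e.target) (hy' : e.symm y ∈ e'.source) :
    Form.inChart e ψ y = (Form.inChart e' ψ ((e' ∘ e.symm) y)).compContinuousLinearMap
      (fderiv ℝ (e' ∘ e.symm) y) := by
  obtain ⟨A, hA⟩ := exists_hasFDerivAt_transition he he' hy hy'
  have hT : (e' ∘ e.symm) y ∈ e'.target := e'.map_source hy'
  have hev : e'.symm ∘ (e' ∘ e.symm) =ᶠ[𝓝 y] e.symm := by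
    filter_upwards [(e.symm.trans e').open_source.mem_nhds (by simp [hy, hy'])] with z hz
    simp only [OpenPartialHomeomorph.trans_source, OpenPartialHomeomorph.symm_source, mem_inter_iff,
      mem_preimage] at hz
    simp [e'.left_inv hz.2]
  have h1 : mfderiv 𝓘(ℝ, Cn n) 𝓘(ℝ, Cn n) e.symm y =
      (mfderiv 𝓘(ℝ, Cn n) 𝓘(ℝ, Cn n) e'.symm ((e' ∘ e.symm) y)) ∘L
        (fderiv ℝ (e' ∘ e.symm) y) := by
    rw [← hev.mfderiv_eq, mfderiv_comp y (mdifferentiableAt_symm_real he' hT)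
      (hA.restrictScalars ℝ).differentiableAt.mdifferentiableAt, mfderiv_eq_fderiv]
    rfl
  have h2 : e'.symm ((e' ∘ e.symm) y) = e.symm y := e'.left_inv hy'
  ext v
  simp only [Form.inChart, ContinuousAlternatingMap.compContinuousLinearMap_apply, h1]
  rw [h2]
  rfl

end Charts

/-! ### Forms in charts and invariance of the volume integral of their differential -/

section ChartForm

variable {n : ℕ} {M : Type*} [TopologicalSpace M] [ChartedSpace (Cn n) M]
  [IsManifold 𝓘(ℂ, Cn n) ω M] {e e' : OpenPartialHomeomorph M (Cn n)} {k : ℕ}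

/-- The expression of a form in a chart, extended by zero. -/
def chartForm (e : OpenPartialHomeomorph M (Cn n)) (ψ : Form n M k) :
    Cn n → (Cn n) [⋀^Fin k]→L[ℝ] ℂ :=
  e.target.indicator (Form.inChart e ψ)

theorem chartForm_apply (ψ : Form n M k) {y : Cn n} (hy : y ∈ e.target) :
    chartForm e ψ y = Form.inChart e ψ y := indicator_of_mem hy _

theorem chartForm_eventuallyEq (ψ : Form n M k) {y : Cn n} (hy : y ∈ e.target) :
    chartForm e ψ =ᶠ[𝓝 y] Form.inChart e ψ := by
  filter_upwards [e.open_target.mem_nhds hy] with z hz using chartForm_apply ψ hz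

theorem inChart_eq_zero {ψ : Form n M k} {y : Cn n} (h : ψ (e.symm y) = 0) :
    Form.inChart e ψ y = 0 := by
  rw [Form.inChart, h]
  rfl

theorem tsupport_chartForm_subset [T2Space M] {ψ : Form n M k} (hc : HasCompactSupport ψ)
    (hs : tsupport ψ ⊆ e.source) : tsupport (chartForm e ψ) ⊆ e '' tsupport ψ := by
  have hK : IsCompact (e '' tsupport ψ) := hc.isCompact.image_of_continuousOn (e.continuousOn.mono hs)
  refine closure_minimal (fun y hy => ?_) hK.isClosed
  by_contra h
  refine hy ?_
  by_cases hyt : y ∈ e.target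
  · rw [chartForm_apply ψ hyt]
    refine inChart_eq_zero (image_eq_zero_of_notMem_tsupport fun h' => h ?_)
    exact ⟨e.symm y, h', e.right_inv hyt⟩
  · exact indicator_of_notMem hyt _

theorem tsupport_chartForm_subset_target [T2Space M] {ψ : Form n M k} (hc : HasCompactSupport ψ)
    (hs : tsupport ψ ⊆ e.source) : tsupport (chartForm e ψ) ⊆ e.target := by
  intro y hy
  obtain ⟨x, hx, rfl⟩ := tsupport_chartForm_subset hc hs hy
  exact e.map_source (hs hx)

theorem hasCompactSupport_chartForm [T2Space M] {ψ : Form n M k} (hc : HasCompactSupport ψ)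
    (hs : tsupport ψ ⊆ e.source) : HasCompactSupport (chartForm e ψ) :=
  HasCompactSupport.of_support_subset_isCompact
    (hc.isCompact.image_of_continuousOn (e.continuousOn.mono hs))
    ((subset_tsupport _).trans (tsupport_chartForm_subset hc hs))

theorem contDiff_chartForm [T2Space M] {ψ : Form n M k} (hc : HasCompactSupport ψ)
    (hs : tsupport ψ ⊆ e.source) (hψ : ContDiffOn ℝ ∞ (Form.inChart e ψ) e.target) :
    ContDiff ℝ ∞ (chartForm e ψ) :=
  contDiff_of_forall_mem_tsupport fun y hy => by
    have hyt := tsupport_chartForm_subset_target hc hs hy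
    exact (hψ.contDiffAt (e.open_target.mem_nhds hyt)).congr_of_eventuallyEq
      (chartForm_eventuallyEq ψ hyt)

/-- For c = i the bidegree condition gives the factor iⁿ(-i)ⁿ⁻¹ = i, and complex linearity of the
chart derivative preserves it. The hypothesis `1 ≤ n` makes the truncated `n - 1` the true one. -/
theorem chartForm_I_smul (hn : 1 ≤ n) (he : e ∈ holCharts n M) {ψ : Form n M (n + (n - 1))}
    (hψ : ψ ∈ testForms n M n (n - 1)) (y : Cn n) (v : Fin (n + (n - 1)) → Cn n) :
    chartForm e ψ y (fun a => Complex.I • v a) = Complex.I * chartForm e ψ y v := by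
  by_cases hy : y ∈ e.target
  · obtain ⟨A, hA⟩ := exists_mfderiv_symm_eq he hy
    rw [chartForm_apply ψ hy]
    have h1 : ∀ v, Form.inChart e ψ y v = ψ (e.symm y) fun a => A (v a) := fun v => by
      rw [Form.inChart, hA]; rfl
    simp only [h1, map_smul]
    rw [hψ.2.1 (e.symm y) Complex.I fun a => A (v a)]
    congr 1
    obtain ⟨m, rfl⟩ : ∃ m, n = m + 1 := ⟨n - 1, by omega⟩
    rw [Nat.add_sub_cancel, pow_succ, mul_right_comm, ← mul_pow]
    simp
  · simp [chartForm, indicator_of_notMem hy]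

theorem topCoeff_chartForm_of_notMem (ψ : Form n M k) {y : Cn n} (hy : y ∈ e.target)
    (hs : e.symm y ∉ tsupport ψ) : topCoeff (chartForm e ψ) y = 0 := by
  have h1 : chartForm e ψ =ᶠ[𝓝 y] fun _ => 0 := by
    have h2 : ∀ᶠ z in 𝓝 y, e.symm z ∉ tsupport ψ :=
      (e.continuousAt_symm hy).eventually_mem ((isClosed_tsupport ψ).isOpen_compl.mem_nhds hs)
    filter_upwards [e.open_target.mem_nhds hy, h2] with z hz hz2
    rw [chartForm_apply ψ hz]
    exact inChart_eq_zero (image_eq_zero_of_notMem_tsupport hz2)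
  rw [topCoeff_eq_sum, h1.fderiv_eq]
  simp

/-- The exterior derivative commutes with pullback, and a top form scales by the real determinant.
For a complex-linear map this is the squared modulus of the complex determinant, so taking the
absolute value, as the change of variables formula requires, alters nothing. -/
theorem topCoeff_chartForm_transition (hk : k + 1 = n * 2) (he : e ∈ holCharts n M)
    (he' : e' ∈ holCharts n M) {ψ : Form n M k}
    (hψ : ContDiffOn ℝ ∞ (Form.inChart e' ψ) e'.target) {y : Cn n} (hy : y ∈ e.target)
    (hy' : e.symm y ∈ e'.source) :
    topCoeff (chartForm e ψ) y =
      |(fderiv ℝ (e' ∘ e.symm) y).det| • topCoeff (chartForm e' ψ) ((e' ∘ e.symm) y) := by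
  obtain ⟨A, hA⟩ := exists_hasFDerivAt_transition he he' hy hy'
  have hT : (e' ∘ e.symm) y ∈ e'.target := e'.map_source hy'
  have hsrc : (e.symm.trans e').source ∈ 𝓝 y :=
    (e.symm.trans e').open_source.mem_nhds (by simp [hy, hy'])
  have h1 : chartForm e ψ =ᶠ[𝓝 y] fun y => (Form.inChart e' ψ
      ((e' ∘ e.symm) y)).compContinuousLinearMap (fderiv ℝ (e' ∘ e.symm) y) := by
    filter_upwards [hsrc] with z hz
    simp only [OpenPartialHomeomorph.trans_source, OpenPartialHomeomorph.symm_source, mem_inter_iff,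
      mem_preimage] at hz
    rw [chartForm_apply ψ hz.1, inChart_eq_pullback he he' ψ hz.1 hz.2]
  have hd : DifferentiableAt ℝ (Form.inChart e' ψ) ((e' ∘ e.symm) y) :=
    (hψ.contDiffAt (e'.open_target.mem_nhds hT)).differentiableAt (by simp)
  have hTc : ContDiffAt ℝ ω (e' ∘ e.symm) y :=
    ((contDiffOn_transition he he').restrict_scalars ℝ).contDiffAt hsrc
  rw [topCoeff, h1.extDeriv_eq, extDeriv_pullback hd hTc (by simp),
    ContinuousAlternatingMap.compContinuousLinearMap_apply, topCoeff,
    (chartForm_eventuallyEq ψ hT).extDeriv_eq]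
  have h2 := map_comp_realFrame hk (extDeriv (Form.inChart e' ψ) ((e' ∘ e.symm) y))
    (fderiv ℝ (e' ∘ e.symm) y)
  have h3 : 0 ≤ (fderiv ℝ (e' ∘ e.symm) y).det := by
    rw [(hA.restrictScalars ℝ).fderiv, ContinuousLinearMap.det]
    change 0 ≤ LinearMap.det (((A : Cn n →L[ℂ] Cn n) : Cn n →ₗ[ℂ] Cn n).restrictScalars ℝ)
    rw [LinearMap.det_restrictScalars, Algebra.norm_complex_apply]
    exact Complex.normSq_nonneg _
  rw [abs_of_nonneg h3, Complex.real_smul]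
  exact h2

/-- The integral over `Ω` of a function times the exterior derivative of a form supported in two
charts does not depend on the chart used to compute it. -/
theorem setIntegral_topCoeff_chartForm (hk : k + 1 = n * 2) (he : e ∈ holCharts n M)
    (he' : e' ∈ holCharts n M) {ψ : Form n M k}
    (hψ : ContDiffOn ℝ ∞ (Form.inChart e' ψ) e'.target)
    (hs : tsupport ψ ⊆ e.source ∩ e'.source) {Ω : Set M} (hΩ : IsOpen Ω) (G : M → ℂ) :
    ∫ y in e.target ∩ e.symm ⁻¹' Ω, G (e.symm y) * topCoeff (chartForm e ψ) y =
      ∫ y in e'.target ∩ e'.symm ⁻¹' Ω, G (e'.symm y) * topCoeff (chartForm e' ψ) y := by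
  have hred : ∀ {e e' : OpenPartialHomeomorph M (Cn n)}, tsupport ψ ⊆ e'.source →
      ∫ y in e.target ∩ e.symm ⁻¹' Ω, G (e.symm y) * topCoeff (chartForm e ψ) y =
      ∫ y in e.target ∩ e.symm ⁻¹' (Ω ∩ e'.source),
        G (e.symm y) * topCoeff (chartForm e ψ) y := by
    intro e e' hs
    refine setIntegral_eq_of_subset_of_forall_sdiff_eq_zero
      (e.symm.isOpen_inter_preimage hΩ).measurableSet (fun y hy => ⟨hy.1, hy.2.1⟩) fun y hy => ?_
    rw [topCoeff_chartForm_of_notMem ψ hy.1.1, mul_zero]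
    exact fun h => hy.2 ⟨hy.1.1, hy.1.2, hs h⟩
  rw [hred (e := e) (e' := e') fun x hx => (hs hx).2, hred (e := e') (e' := e) fun x hx => (hs hx).1]
  set s := e.target ∩ e.symm ⁻¹' (Ω ∩ e'.source) with hsdef
  have hsm : MeasurableSet s :=
    (e.symm.isOpen_inter_preimage (hΩ.inter e'.open_source)).measurableSet
  have himg : (e' ∘ e.symm) '' s = e'.target ∩ e'.symm ⁻¹' (Ω ∩ e.source) := by
    ext z
    constructor
    · rintro ⟨y, hy, rfl⟩
      refine ⟨e'.map_source hy.2.2, ?_⟩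
      change e'.symm (e' (e.symm y)) ∈ Ω ∩ e.source
      rw [e'.left_inv hy.2.2]
      exact ⟨hy.2.1, e.map_target hy.1⟩
    · rintro ⟨hz, hzΩ, hzs⟩
      refine ⟨e (e'.symm z), ⟨e.map_source hzs, ?_⟩, ?_⟩
      · change e.symm (e (e'.symm z)) ∈ Ω ∩ e'.source
        rw [e.left_inv hzs]; exact ⟨hzΩ, e'.map_target hz⟩
      · change e' (e.symm (e (e'.symm z))) = z
        rw [e.left_inv hzs, e'.right_inv hz]
  have hinj : InjOn (e' ∘ e.symm) s := by
    intro y hy z hz h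
    have h1 : e.symm y = e.symm z := e'.injOn hy.2.2 hz.2.2 h
    exact e.symm.injOn hy.1 hz.1 h1
  have hder : ∀ y ∈ s, HasFDerivWithinAt (e' ∘ e.symm) (fderiv ℝ (e' ∘ e.symm) y) s y := by
    intro y hy
    obtain ⟨A, hA⟩ := exists_hasFDerivAt_transition he he' hy.1 hy.2.2
    exact (hA.restrictScalars ℝ).differentiableAt.hasFDerivAt.hasFDerivWithinAt
  rw [← himg, integral_image_eq_integral_abs_det_fderiv_smul volume hsm hder hinj]
  refine setIntegral_congr_fun hsm fun y hy => ?_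
  change G (e.symm y) * _ = _ • (G (e'.symm (e' (e.symm y))) * _)
  rw [e'.left_inv hy.2.2, topCoeff_chartForm_transition hk he he' hψ hy.1 hy.2.2, mul_smul_comm]

end ChartForm

/-! ### Defining functions -/

section Defining

/-- Moving from `y` in a direction where φ decreases enters {φ < 0}, hence {φ' < 0}; so dφ < 0
implies dφ' ≤ 0. This containment of half-spaces forces ker dφ ⊆ ker dφ' and a positive factor. It
shows that the outward conormal does not depend on the defining function. -/
theorem exists_pos_smul_fderiv {E : Type*} [NormedAddCommGroup E] [NormedSpace ℝ E]
    {φ φ' : E → ℝ} {y : E} (hφ : DifferentiableAt ℝ φ y) (hφ' : DifferentiableAt ℝ φ' y)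
    (h0 : φ y = 0) (h0' : φ' y = 0) (hne : fderiv ℝ φ y ≠ 0) (hne' : fderiv ℝ φ' y ≠ 0)
    (h : ∀ᶠ z in 𝓝 y, φ z < 0 → φ' z < 0) : ∃ c : ℝ, 0 < c ∧ fderiv ℝ φ' y = c • fderiv ℝ φ y := by
  have hline : ∀ {g : E → ℝ} (x : E), DifferentiableAt ℝ g y →
      HasDerivAt (fun t : ℝ => g (y + t • x)) (fderiv ℝ g y x) 0 := by
    intro g x hg
    have h1 : HasDerivAt (fun t : ℝ => y + t • x) x 0 := by
      simpa using ((hasDerivAt_id (0 : ℝ)).smul_const x).const_add y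
    have h2 : HasFDerivAt g (fderiv ℝ g y) (y + (0 : ℝ) • x) := by simpa using hg.hasFDerivAt
    exact h2.comp_hasDerivAt (0 : ℝ) h1
  have hneg : ∀ x, fderiv ℝ φ y x < 0 → fderiv ℝ φ' y x ≤ 0 := by
    intro x hx
    by_contra! hpos
    have h1 := (hline x hφ).tendsto_slope_zero_right.eventually_lt_const hx
    have h2 := (hline x hφ').tendsto_slope_zero_right.eventually_const_lt hpos
    have hc : Tendsto (fun t : ℝ => y + t • x) (𝓝[>] 0) (𝓝 y) := by
      have : Continuous fun t : ℝ => y + t • x := by fun_prop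
      have h3 := this.tendsto 0
      simp only [zero_smul, add_zero] at h3
      exact h3.mono_left nhdsWithin_le_nhds
    obtain ⟨t, ht1, ht2, ht3, ht⟩ :=
      (h1.and (h2.and ((hc.eventually h).and eventually_mem_nhdsWithin))).exists
    have ht0 : 0 < t⁻¹ := inv_pos.2 ht
    simp only [zero_smul, add_zero, zero_add, h0, h0', sub_zero, smul_eq_mul] at ht1 ht2
    exact (ht3 (neg_of_mul_neg_right ht1 ht0.le)).not_gt (pos_of_mul_pos_right ht2 ht0.le)
  obtain ⟨x₀, hx₀⟩ : ∃ x₀, fderiv ℝ φ y x₀ < 0 := by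
    obtain ⟨x, hx⟩ : ∃ x, fderiv ℝ φ y x ≠ 0 := by
      by_contra! hcon; exact hne (ContinuousLinearMap.ext hcon)
    rcases hx.lt_or_gt with hx | hx
    · exact ⟨x, hx⟩
    · exact ⟨-x, by simpa using hx⟩
  have hker : ∀ x, fderiv ℝ φ y x = 0 → fderiv ℝ φ' y x = 0 := by
    intro x hx
    by_contra hcon
    -- The multiple of `x` is chosen so that dφ' takes the value 1 while dφ remains equal to dφ(x₀)
    -- < 0.
    have h1 := hneg (x₀ + ((1 - fderiv ℝ φ' y x₀) / fderiv ℝ φ' y x) • x) (by simpa [hx] using hx₀)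
    rw [map_add, map_smul, smul_eq_mul, div_mul_cancel₀ _ hcon] at h1
    linarith
  set c := fderiv ℝ φ' y x₀ / fderiv ℝ φ y x₀ with hc
  have heq : fderiv ℝ φ' y = c • fderiv ℝ φ y := by
    ext x
    have h1 := hker (x - (fderiv ℝ φ y x / fderiv ℝ φ y x₀) • x₀)
      (by rw [map_sub, map_smul, smul_eq_mul, div_mul_cancel₀ _ hx₀.ne, sub_self])
    rw [map_sub, map_smul, smul_eq_mul, sub_eq_zero] at h1
    rw [h1, smul_apply, smul_eq_mul, hc]
    ring
  refine ⟨c, lt_of_le_of_ne (div_nonneg_of_nonpos (hneg x₀ hx₀) hx₀.le) fun h => hne' ?_, heq⟩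
  rw [heq, ← h, zero_smul]

/-- By convexity the whole segment stays in `B`, and φ is strictly decreasing along it. This is the
mechanism by which an inward shift enters the domain. -/
theorem lt_of_fderiv_pos {E : Type*} [NormedAddCommGroup E] [NormedSpace ℝ E] {B : Set E}
    (hB : Convex ℝ B) {φ : E → ℝ} (hφ : ∀ y ∈ B, DifferentiableAt ℝ φ y) {v : E}
    (hv : ∀ y ∈ B, 0 < fderiv ℝ φ y v) {y : E} {t : ℝ} (ht : 0 < t) (hy : y ∈ B)
    (hyt : y - t • v ∈ B) : φ (y - t • v) < φ y := by
  have hmem : ∀ s ∈ Icc (0 : ℝ) t, y - s • v ∈ B := by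
    intro s hs
    have : y - s • v = (1 - s / t) • y + (s / t) • (y - t • v) := by
      rw [smul_sub, smul_smul, div_mul_cancel₀ _ ht.ne']; module
    rw [this]
    exact hB hy hyt (by rw [sub_nonneg, div_le_one ht]; exact hs.2) (div_nonneg hs.1 ht.le) (by ring)
  have hder : ∀ s ∈ Icc (0 : ℝ) t,
      HasDerivAt (fun s : ℝ => φ (y - s • v)) (-fderiv ℝ φ (y - s • v) v) s := by
    intro s hs
    have h1 : HasDerivAt (fun s : ℝ => y - s • v) (-v) s := by
      simpa using ((hasDerivAt_id s).smul_const v).const_sub y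
    have h2 := (hφ _ (hmem s hs)).hasFDerivAt.comp_hasDerivAt s h1
    rw [map_neg] at h2
    exact h2
  have h1 : StrictAntiOn (fun s : ℝ => φ (y - s • v)) (Icc 0 t) := by
    refine strictAntiOn_of_deriv_neg (convex_Icc 0 t)
      (fun s hs => (hder s hs).continuousAt.continuousWithinAt) fun s hs => ?_
    have hs' := interior_subset hs
    rw [(hder s hs').deriv, neg_lt_zero]
    exact hv _ (hmem s hs')
  simpa using h1 (left_mem_Icc.2 ht.le) (right_mem_Icc.2 ht.le) ht

variable {n : ℕ} {M : Type*} [TopologicalSpace M] [ChartedSpace (Cn n) M]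
  [IsManifold 𝓘(ℂ, Cn n) ω M] {e : OpenPartialHomeomorph M (Cn n)} {N : ℕ}

theorem contDiffOn_comp_symm (he : e ∈ holCharts n M) {W : Set M} {r : M → ℝ}
    (hr : ContMDiffOn 𝓘(ℝ, Cn n) 𝓘(ℝ, ℝ) ∞ r W) :
    ContDiffOn ℝ ∞ (r ∘ e.symm) (e.target ∩ e.symm ⁻¹' W) := by
  have h1 : ContMDiffOn 𝓘(ℝ, Cn n) 𝓘(ℝ, Cn n) ∞ e.symm e.target :=
    (contMDiffOn_symm_of_mem_maximalAtlas (mem_maximalAtlas_real he)).of_le (by exact_mod_cast le_top)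
  exact (hr.comp (h1.mono inter_subset_left) inter_subset_right).contDiffOn

theorem fderiv_comp_symm (he : e ∈ holCharts n M) {r : M → ℝ} {y : Cn n} (hy : y ∈ e.target)
    (hr : MDifferentiableAt 𝓘(ℝ, Cn n) 𝓘(ℝ, ℝ) r (e.symm y)) :
    fderiv ℝ (r ∘ e.symm) y =
      ContinuousLinearMap.comp (mfderiv 𝓘(ℝ, Cn n) 𝓘(ℝ, ℝ) r (e.symm y) : Cn n →L[ℝ] ℝ)
        (mfderiv 𝓘(ℝ, Cn n) 𝓘(ℝ, Cn n) e.symm y : Cn n →L[ℝ] Cn n) := by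
  rw [← mfderiv_eq_fderiv, mfderiv_comp y hr (mdifferentiableAt_symm_real he hy)]

/-- A neighbourhood on which `⋂ⱼ Ωⱼ` is given by the defining functions `rⱼ`, `j ∈ J`. -/
structure CornerNbhd (Ωs : Fin N → Set M) (J : Finset (Fin N)) (r : Fin N → M → ℝ) (O : Set M) :
    Prop where
  isOpen : IsOpen O
  contMDiffOn : ∀ j ∈ J, ContMDiffOn 𝓘(ℝ, Cn n) 𝓘(ℝ, ℝ) ∞ (r j) O
  mfderiv_ne_zero : ∀ j ∈ J, ∀ z ∈ O, mfderiv 𝓘(ℝ, Cn n) 𝓘(ℝ, ℝ) (r j) z ≠ 0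
  mem_iff : ∀ j ∈ J, ∀ z ∈ O, z ∈ Ωs j ↔ r j z < 0
  subset : ∀ j ∉ J, O ⊆ Ωs j

variable {Ωs : Fin N → Set M} {J : Finset (Fin N)} {r : Fin N → M → ℝ} {O : Set M}

theorem CornerNbhd.isLocalDefiningFunction (h : CornerNbhd (n := n) Ωs J r O) {j : Fin N}
    (hj : j ∈ J) {z : M} (hz : z ∈ O) : IsLocalDefiningFunction (n := n) (Ωs j) z (r j) := by
  refine ⟨O, h.isOpen, hz, h.contMDiffOn j hj, h.mfderiv_ne_zero j hj, ?_⟩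
  ext x
  constructor
  · rintro ⟨hx, hxO⟩; exact ⟨hxO, (h.mem_iff j hj x hxO).1 hx⟩
  · rintro ⟨hxO, hx⟩; exact ⟨(h.mem_iff j hj x hxO).2 hx, hxO⟩

theorem CornerNbhd.mem_iInter_iff (h : CornerNbhd (n := n) Ωs J r O) {z : M} (hz : z ∈ O) :
    z ∈ ⋂ j, Ωs j ↔ ∀ j ∈ J, r j z < 0 := by
  rw [mem_iInter]
  refine ⟨fun hz' j hj => (h.mem_iff j hj z hz).1 (hz' j), fun hz' j => ?_⟩
  by_cases hj : j ∈ J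
  · exact (h.mem_iff j hj z hz).2 (hz' j hj)
  · exact h.subset j hj hz

/-- A positive value would keep Ω away from `z`, and a negative one would put `z` inside the open
set Ω. -/
theorem IsLocalDefiningFunction.eq_zero {Ω : Set M} (hΩ : IsOpen Ω) {z : M}
    (hz : z ∈ frontier Ω) {r : M → ℝ} (h : IsLocalDefiningFunction (n := n) Ω z r) : r z = 0 := by
  obtain ⟨W, hW, hzW, hr, -, hΩW⟩ := h
  have hc : ContinuousAt r z := hr.continuousOn.continuousAt (hW.mem_nhds hzW)
  apply le_antisymm
  · by_contra! hpos
    have h1 : ∀ᶠ x in 𝓝 z, 0 < r x := hc.eventually_const_lt hpos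
    obtain ⟨x, hxΩ, hx, hxW⟩ := ((mem_closure_iff_frequently.1
      (frontier_subset_closure hz)).and_eventually (h1.and (hW.mem_nhds hzW))).exists
    have : x ∈ {z ∈ W | r z < 0} := hΩW ▸ ⟨hxΩ, hxW⟩
    exact this.2.not_gt hx
  · by_contra! hneg
    have h1 : z ∈ Ω ∩ W := by rw [hΩW]; exact ⟨hzW, hneg⟩
    rw [hΩ.frontier_eq] at hz
    exact hz.2 h1.1

theorem IsLocalDefiningFunction.differentiableAt (he : e ∈ holCharts n M) {Ω : Set M} {y : Cn n}
    (hy : y ∈ e.target) {r : M → ℝ} (h : IsLocalDefiningFunction (n := n) Ω (e.symm y) r) :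
    DifferentiableAt ℝ (r ∘ e.symm) y ∧ fderiv ℝ (r ∘ e.symm) y ≠ 0 := by
  obtain ⟨W, hW, hzW, hr, hne, hΩW⟩ := h
  have hW' : IsOpen (e.target ∩ e.symm ⁻¹' W) := e.symm.isOpen_inter_preimage hW
  refine ⟨((contDiffOn_comp_symm he hr).contDiffAt (hW'.mem_nhds ⟨hy, hzW⟩)).differentiableAt
    (by simp), ?_⟩
  have hd : MDifferentiableAt 𝓘(ℝ, Cn n) 𝓘(ℝ, ℝ) r (e.symm y) :=
    (hr.contMDiffAt (hW.mem_nhds hzW)).mdifferentiableAt (by simp)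
  rw [fderiv_comp_symm he hy hd]
  obtain ⟨A, hA⟩ := exists_mfderiv_symm_eq he hy
  intro h0
  apply hne _ hzW
  apply ContinuousLinearMap.ext
  intro x
  have h1 : (mfderiv 𝓘(ℝ, Cn n) 𝓘(ℝ, ℝ) r (e.symm y) : Cn n →L[ℝ] ℝ)
      ((mfderiv 𝓘(ℝ, Cn n) 𝓘(ℝ, Cn n) e.symm y : Cn n →L[ℝ] Cn n) (A.symm x)) = 0 :=
    DFunLike.congr_fun h0 (A.symm x)
  have h2 : (mfderiv 𝓘(ℝ, Cn n) 𝓘(ℝ, Cn n) e.symm y : Cn n →L[ℝ] Cn n) (A.symm x) = x := by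
    have h3 : (mfderiv 𝓘(ℝ, Cn n) 𝓘(ℝ, Cn n) e.symm y : Cn n →L[ℝ] Cn n) =
      (A : Cn n →L[ℂ] Cn n).restrictScalars ℝ := hA
    rw [h3]; exact A.apply_symm_apply x
  rw [h2] at h1
  exact h1

/-- The outward conormal may be computed from any local defining function. -/
theorem outwardConormal_eq (he : e ∈ holCharts n M) {Ω : Set M} (hΩ : IsOpen Ω) {y : Cn n}
    (hy : y ∈ e.target) (hyΩ : e.symm y ∈ frontier Ω) {r : M → ℝ}
    (h : IsLocalDefiningFunction (n := n) Ω (e.symm y) r) :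
    outwardConormal Ω e y = ‖fderiv ℝ (r ∘ e.symm) y‖⁻¹ • fderiv ℝ (r ∘ e.symm) y := by
  have hex : ∃ r, IsLocalDefiningFunction (n := n) Ω (e.symm y) r := ⟨r, h⟩
  rw [outwardConormal, dif_pos hex]
  set r' := hex.choose
  have h' : IsLocalDefiningFunction (n := n) Ω (e.symm y) r' := hex.choose_spec
  obtain ⟨hd, hne⟩ := h.differentiableAt he hy
  obtain ⟨hd', hne'⟩ := h'.differentiableAt he hy
  have h0 := h.eq_zero hΩ hyΩ
  have h0' := h'.eq_zero hΩ hyΩ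
  obtain ⟨W, hW, hzW, -, -, hΩW⟩ := h
  obtain ⟨W', hW', hzW', -, -, hΩW'⟩ := h'
  obtain ⟨c, hc, hcc⟩ := exists_pos_smul_fderiv hd hd' h0 h0' hne hne' (by
    have h1 : ∀ᶠ z in 𝓝 y, e.symm z ∈ W ∩ W' :=
      (e.continuousAt_symm hy).eventually_mem ((hW.inter hW').mem_nhds ⟨hzW, hzW'⟩)
    filter_upwards [h1] with z hz hz0
    have h2 : e.symm z ∈ Ω ∩ W := by rw [hΩW]; exact ⟨hz.1, hz0⟩
    have h3 : e.symm z ∈ {z ∈ W' | r' z < 0} := hΩW' ▸ ⟨h2.1, hz.2⟩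
    exact h3.2)
  rw [hcc, norm_smul, Real.norm_of_nonneg hc.le, smul_smul, mul_inv, mul_right_comm,
    inv_mul_cancel₀ hc.ne', one_mul]

/-- `J` collects the indices whose boundary passes through `q`. For any other index `q`, being in
the closure of the intersection, lies inside the open set `Ωs j`, which then contains a
neighbourhood. -/
theorem exists_cornerNbhd (hΩ : IsDomainWithGenericCorners n Ωs) {q : M}
    (hq : q ∈ closure (⋂ j, Ωs j)) :
    ∃ J r O, CornerNbhd (n := n) Ωs J r O ∧ q ∈ O ∧ ∀ j ∈ J, q ∈ frontier (Ωs j) := by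
  classical
  have hop : ∀ j, IsOpen (Ωs j) := fun j => (hΩ.smoothlyBounded j).isOpen
  have hr : ∀ j, ∃ r, q ∈ frontier (Ωs j) → IsLocalDefiningFunction (n := n) (Ωs j) q r := by
    intro j
    by_cases hj : q ∈ frontier (Ωs j)
    · obtain ⟨r, hr⟩ := (hΩ.smoothlyBounded j).smooth_boundary q hj
      exact ⟨r, fun _ => hr⟩
    · exact ⟨0, fun h => absurd h hj⟩
  choose r hr using hr
  have hW : ∀ j, ∃ W : Set M, IsOpen W ∧ q ∈ W ∧ (q ∈ frontier (Ωs j) →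
      ContMDiffOn 𝓘(ℝ, Cn n) 𝓘(ℝ, ℝ) ∞ (r j) W ∧
      (∀ z ∈ W, mfderiv 𝓘(ℝ, Cn n) 𝓘(ℝ, ℝ) (r j) z ≠ 0) ∧ ∀ z ∈ W, z ∈ Ωs j ↔ r j z < 0) ∧
      (q ∉ frontier (Ωs j) → W ⊆ Ωs j) := by
    intro j
    by_cases hj : q ∈ frontier (Ωs j)
    · obtain ⟨W, h1, h2, h3, h4, h5⟩ := hr j hj
      refine ⟨W, h1, h2, fun _ => ⟨h3, h4, fun z hz => ⟨fun hz' => ?_, fun hz' => ?_⟩⟩,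
        fun h => absurd hj h⟩
      · have : z ∈ {z ∈ W | r j z < 0} := h5 ▸ ⟨hz', hz⟩
        exact this.2
      · have : z ∈ Ωs j ∩ W := by rw [h5]; exact ⟨hz, hz'⟩
        exact this.1
    · refine ⟨Ωs j, hop j, ?_, fun h => absurd h hj, fun _ => subset_rfl⟩
      by_contra hcon
      exact hj ((hop j).frontier_eq ▸ ⟨closure_mono (iInter_subset _ j) hq, hcon⟩)
  choose W hWo hqW hW1 hW2 using hW
  refine ⟨Finset.univ.filter fun j => q ∈ frontier (Ωs j), r, ⋂ j, W j,
    ⟨isOpen_iInter_of_finite hWo, ?_, ?_, ?_, ?_⟩, mem_iInter.2 hqW, fun j hj => by simpa using hj⟩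
  · intro j hj
    exact (hW1 j (by simpa using hj)).1.mono (iInter_subset _ j)
  · intro j hj z hz
    exact (hW1 j (by simpa using hj)).2.1 z (mem_iInter.1 hz j)
  · intro j hj z hz
    exact (hW1 j (by simpa using hj)).2.2 z (mem_iInter.1 hz j)
  · intro j hj
    exact (iInter_subset _ j).trans (hW2 j (by simpa using hj))

open Classical in
/-- The corner neighbourhoods of nearby points. -/
theorem CornerNbhd.exists_of_mem (h : CornerNbhd (n := n) Ωs J r O)
    (hop : ∀ j, IsOpen (Ωs j)) {q : M} (hq : q ∈ O) (hqΩ : q ∈ closure (⋂ j, Ωs j)) :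
    ∃ J' ⊆ J, ∃ O' ⊆ O, CornerNbhd (n := n) Ωs J' r O' ∧ q ∈ O' ∧
      ∀ j ∈ J', q ∈ frontier (Ωs j) := by
  let J' := J.filter fun j => q ∈ frontier (Ωs j)
  have hmem : ∀ j, q ∉ frontier (Ωs j) → q ∈ Ωs j := by
    intro j hj
    by_contra hcon
    exact hj ((hop j).frontier_eq ▸ ⟨closure_mono (iInter_subset _ j) hqΩ, hcon⟩)
  have hsub : J' ⊆ J := Finset.filter_subset _ _
  refine ⟨J', hsub, O ∩ ⋂ j ∈ {j | q ∉ frontier (Ωs j)}, Ωs j, inter_subset_left,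
    ⟨h.isOpen.inter ((toFinite _).isOpen_biInter fun j _ => hop j),
      fun j hj => (h.contMDiffOn j (hsub hj)).mono inter_subset_left,
      fun j hj z hz => h.mfderiv_ne_zero j (hsub hj) z hz.1,
      fun j hj z hz => h.mem_iff j (hsub hj) z hz.1, fun j hj z hz => ?_⟩,
    ⟨hq, mem_iInter₂.2 fun j hj => hmem j hj⟩, fun j hj => (Finset.mem_filter.1 hj).2⟩
  by_cases hjJ : j ∈ J
  · have : q ∉ frontier (Ωs j) := fun h' => hj (Finset.mem_filter.2 ⟨hjJ, h'⟩)
    exact mem_iInter₂.1 hz.2 j this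
  · exact h.subset j hjJ hz.1

/-- Translates the generic-corner hypothesis from tangent spaces of the manifold to the coordinates
of `e`. All indices of `J` must be active at `q`, as genericity speaks of points of the corner only.
-/
theorem CornerNbhd.exists_isDualTo (h : CornerNbhd (n := n) Ωs J r O)
    (hΩ : IsDomainWithGenericCorners n Ωs) (he : e ∈ holCharts n M) {q : M} (hqe : q ∈ e.source)
    (hq : q ∈ O) (hqJ : ∀ j ∈ J, q ∈ frontier (Ωs j)) :
    ∃ w, IsDualTo (fun j : J => fderiv ℝ (r j ∘ e.symm) (e q)) w := by
  have hg := hΩ.generic J q hqJ r fun j hj => h.isLocalDefiningFunction hj hq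
  let l : J → Cn n →L[ℝ] ℝ := fun j => mfderiv 𝓘(ℝ, Cn n) 𝓘(ℝ, ℝ) (r j) q
  have hl : Module.finrank ℂ (maxComplexSubspace (⨅ j, (l j).ker)) + Fintype.card J = n := by
    rw [Fintype.card_coe]
    have h1 : ⨅ j, (l j).ker = ⨅ j ∈ J,
        (mfderiv 𝓘(ℝ, Cn n) 𝓘(ℝ, ℝ) (r j) q : Cn n →L[ℝ] ℝ).ker :=
      iInf_subtype (f := fun j : {j // j ∈ J} => (l j).ker)
    rw [h1]
    exact hg
  obtain ⟨w, hw⟩ := BoundaryCurrent.exists_isDualTo l hl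
  have hyt := e.map_source hqe
  obtain ⟨A, hA⟩ := exists_mfderiv_symm_eq he hyt
  refine ⟨fun k => A.symm (w k), ?_⟩
  convert hw.comp A using 1
  funext j
  have hd : MDifferentiableAt 𝓘(ℝ, Cn n) 𝓘(ℝ, ℝ) (r j) (e.symm (e q)) := by
    rw [e.left_inv hqe]
    exact ((h.contMDiffOn j j.2).contMDiffAt (h.isOpen.mem_nhds hq)).mdifferentiableAt (by simp)
  have h3 : (mfderiv 𝓘(ℝ, Cn n) 𝓘(ℝ, Cn n) e.symm (e q) : Cn n →L[ℝ] Cn n) =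
      (A : Cn n →L[ℂ] Cn n).restrictScalars ℝ := hA
  rw [fderiv_comp_symm he hyt hd, h3]
  ext x
  simp only [l]
  rw [e.left_inv hqe]
  rfl

end Defining

/-! ### Corner charts and Stokes' theorem for the boundary integral -/

section CornerChart

variable {n : ℕ} {M : Type*} [TopologicalSpace M] [ChartedSpace (Cn n) M]
  [IsManifold 𝓘(ℂ, Cn n) ω M] {e : OpenPartialHomeomorph M (Cn n)} {N : ℕ}

/-- The defining functions `rⱼ`, `j ∈ J`, in a chart. -/
abbrev inChartFamily (r : Fin N → M → ℝ) (e : OpenPartialHomeomorph M (Cn n)) (J : Finset (Fin N))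
    (j : J) (y : Cn n) : ℝ := r j (e.symm y)

/-- A convex piece of a chart in which `⋂ⱼ Ωⱼ` is a corner domain to which Stokes' theorem applies,
and for which `v` is an outward vector. -/
structure CornerChart (Ωs : Fin N → Set M) (e : OpenPartialHomeomorph M (Cn n))
    (J : Finset (Fin N)) (r : Fin N → M → ℝ) (v : Cn n) (B : Set (Cn n)) : Prop where
  stokes : StokesNbhd (n + (n - 1)) (inChartFamily r e J) B
  subset_target : B ⊆ e.target
  convex : Convex ℝ B
  contDiffOn : ∀ j, ContDiffOn ℝ ∞ (inChartFamily r e J j) B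
  pos : ∀ j, ∀ y ∈ B, 0 < fderiv ℝ (inChartFamily r e J j) y v
  mem_iff : ∀ y ∈ B, e.symm y ∈ ⋂ j, Ωs j ↔ ∀ j, inChartFamily r e J j y < 0
  nonpos : ∀ y ∈ B, e.symm y ∈ closure (⋂ j, Ωs j) → ∀ j, inChartFamily r e J j y ≤ 0
  face_iff : ∀ y ∈ B, ∀ j : J, e.symm y ∈ frontier (⋂ j, Ωs j) ∩ frontier (Ωs j) ↔
    inChartFamily r e J j y = 0 ∧ ∀ i, inChartFamily r e J i y ≤ 0
  notMem_frontier : ∀ y ∈ B, ∀ j ∉ J, e.symm y ∉ frontier (Ωs j)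
  conormal_eq : ∀ y ∈ B, ∀ j : J, e.symm y ∈ frontier (Ωs j) → outwardConormal (Ωs j) e y =
    ‖fderiv ℝ (inChartFamily r e J j) y‖⁻¹ • fderiv ℝ (inChartFamily r e J j) y

variable {Ωs : Fin N → Set M} {J : Finset (Fin N)} {r : Fin N → M → ℝ} {O : Set M} {v : Cn n}

/-- The degree 2n-1 occurs as `n + (n - 1)`, with truncated subtraction, whence the hypothesis on
`n`. -/
theorem finrank_real_Cn (hn : 1 ≤ n) : Module.finrank ℝ (Cn n) = n + (n - 1) + 1 := by
  rw [finrank_real_of_complex, finrank_euclideanSpace_fin]; omega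

/-- `B` is a small ball about `e q`, so that it is convex and all the open conditions hold on it.
The set-theoretic boundary agrees with its description by inequalities because the shift by -tv
brings every point with all r_i ≤ 0 into Ω. -/
theorem CornerNbhd.exists_cornerChart (hn : 1 ≤ n) (h : CornerNbhd (n := n) Ωs J r O)
    (hΩ : IsDomainWithGenericCorners n Ωs) (he : e ∈ holCharts n M) {q : M} (hqe : q ∈ e.source)
    (hq : q ∈ O) (hqJ : ∀ j ∈ J, q ∈ frontier (Ωs j)) (hJ : J.Nonempty)
    (hv : ∀ j : J, 0 < fderiv ℝ (inChartFamily r e J j) (e q) v) {V : Set (Cn n)} (hV : V ∈ 𝓝 (e q)) :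
    ∃ B ⊆ V, e q ∈ B ∧ B ⊆ e.symm ⁻¹' O ∧ CornerChart Ωs e J r v B := by
  have hop : ∀ j, IsOpen (Ωs j) := fun j => (hΩ.smoothlyBounded j).isOpen
  have hΩo : IsOpen (⋂ j, Ωs j) := isOpen_iInter_of_finite hop
  set O₁ := e.target ∩ e.symm ⁻¹' O with hO₁def
  have hO₁ : IsOpen O₁ := e.symm.isOpen_inter_preimage h.isOpen
  have hqO₁ : e q ∈ O₁ := ⟨e.map_source hqe, by change e.symm (e q) ∈ O; rwa [e.left_inv hqe]⟩
  have hcd : ∀ j, ContDiffOn ℝ ∞ (inChartFamily r e J j) O₁ := fun j =>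
    contDiffOn_comp_symm he (h.contMDiffOn j j.2)
  have hcd1 : ∀ j, ContDiffOn ℝ 1 (inChartFamily r e J j) O₁ := fun j =>
    (hcd j).of_le (by exact_mod_cast le_top)
  have hldf : ∀ z ∈ O, ∀ j ∈ J, IsLocalDefiningFunction (n := n) (Ωs j) z (r j) := fun z hz j hj =>
    h.isLocalDefiningFunction hj hz
  obtain ⟨w, hw⟩ := h.exists_isDualTo hΩ he hqe hq hqJ
  have : Nonempty J := hJ.to_subtype
  obtain ⟨W, hWO, hqW, hW⟩ := exists_stokesNbhd (finrank_real_Cn hn) hO₁ hqO₁ hcd1 hv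
    (fun j => by
      change r j (e.symm (e q)) = 0
      rw [e.left_inv hqe]
      exact (hldf q hq j j.2).eq_zero (hop j) (hqJ j j.2))
    (fun i j hij c => hw.ne_smul hij c)
  have hpos : ∀ᶠ y in 𝓝 (e q), ∀ j, 0 < fderiv ℝ (inChartFamily r e J j) y v :=
    eventually_all.2 fun j => ((((hcd1 j).continuousOn_fderiv_of_isOpen hO₁ le_rfl).clm_apply
      continuousOn_const).continuousAt (hO₁.mem_nhds hqO₁)).eventually_const_lt (hv j)
  obtain ⟨δ, hδ, hball⟩ := Metric.nhds_basis_ball.mem_iff.1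
    (inter_mem (inter_mem hV (hW.isOpen.mem_nhds hqW)) hpos)
  set B := Metric.ball (e q) δ
  have hBW : B ⊆ W := fun y hy => (hball hy).1.2
  have hBO : B ⊆ O₁ := hBW.trans hWO
  have hBpos : ∀ j, ∀ y ∈ B, 0 < fderiv ℝ (inChartFamily r e J j) y v := fun j y hy =>
    (hball hy).2 j
  have hdiff : ∀ j, ∀ y ∈ B, DifferentiableAt ℝ (inChartFamily r e J j) y := fun j y hy =>
    ((hcd j).contDiffAt (hO₁.mem_nhds (hBO hy))).differentiableAt (by simp)
  have hconv : Convex ℝ B := convex_ball _ _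
  have hmem : ∀ y ∈ B, e.symm y ∈ ⋂ j, Ωs j ↔ ∀ j, inChartFamily r e J j y < 0 := by
    intro y hy
    rw [h.mem_iInter_iff (hBO hy).2]
    exact ⟨fun h' j => h' j j.2, fun h' j hj => h' ⟨j, hj⟩⟩
  have hnonpos : ∀ y ∈ B, e.symm y ∈ closure (⋂ j, Ωs j) → ∀ j, inChartFamily r e J j y ≤ 0 := by
    intro y hy hyc j
    by_contra! hcon
    by_cases hyj : e.symm y ∈ Ωs j
    · exact ((h.mem_iff j j.2 _ (hBO hy).2).1 hyj).not_gt hcon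
    · have hfr : e.symm y ∈ frontier (Ωs j) :=
        (hop j).frontier_eq ▸ ⟨closure_mono (iInter_subset _ _) hyc, hyj⟩
      exact hcon.ne' ((hldf _ (hBO hy).2 j j.2).eq_zero (hop j) hfr)
  refine ⟨B, fun y hy => (hball hy).1.1, Metric.mem_ball_self hδ, fun y hy => (hBO hy).2,
    hW.mono Metric.isOpen_ball hBW, fun y hy => (hBO hy).1, hconv, fun j => (hcd j).mono hBO, hBpos,
    hmem, hnonpos, ?_, ?_, ?_⟩
  · intro y hy j
    constructor
    · rintro ⟨h1, h2⟩
      exact ⟨(hldf _ (hBO hy).2 j j.2).eq_zero (hop j) h2,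
        hnonpos y hy (frontier_subset_closure h1)⟩
    · rintro ⟨h1, h2⟩
      have hnot : e.symm y ∉ Ωs j := fun h' => ((h.mem_iff j j.2 _ (hBO hy).2).1 h').ne h1
      -- The points y - tv, t > 0 small, belong to the domain and tend to `y`.
      have hcl : e.symm y ∈ closure (⋂ j, Ωs j) := by
        have hc : Continuous fun t : ℝ => y - t • v := by fun_prop
        have hty : Tendsto (fun t : ℝ => y - t • v) (𝓝[>] 0) (𝓝 y) := by
          have := hc.tendsto 0
          simp only [zero_smul, sub_zero] at this
          exact this.mono_left nhdsWithin_le_nhds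
        refine mem_closure_of_tendsto ((e.continuousAt_symm (hBO hy).1).tendsto.comp hty) ?_
        filter_upwards [hty.eventually_mem (Metric.isOpen_ball.mem_nhds hy),
          self_mem_nhdsWithin] with t ht ht0
        exact (hmem _ ht).2 fun i =>
          (lt_of_fderiv_pos hconv (hdiff i) (hBpos i) ht0 hy ht).trans_le (h2 i)
      exact ⟨hΩo.frontier_eq ▸ ⟨hcl, fun h' => hnot (mem_iInter.1 h' j)⟩,
        (hop j).frontier_eq ▸ ⟨closure_mono (iInter_subset _ _) hcl, hnot⟩⟩
  · intro y hy j hj hfr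
    rw [(hop j).frontier_eq] at hfr
    exact hfr.2 (h.subset j hj (hBO hy).2)
  · intro y hy j hfr
    exact outwardConormal_eq he (hop j) (hBO hy).1 hfr (hldf _ (hBO hy).2 j j.2)

theorem measurableSet_faceInChart (e : OpenPartialHomeomorph M (Cn n)) (j : Fin N) :
    MeasurableSet (faceInChart Ωs e j) := by
  have hcl : IsClosed (frontier (⋂ i, Ωs i) ∩ frontier (Ωs j)) :=
    isClosed_frontier.inter isClosed_frontier
  have h1 : faceInChart Ωs e j =
      e.target \ (e.target ∩ e.symm ⁻¹' (frontier (⋂ i, Ωs i) ∩ frontier (Ωs j))ᶜ) := by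
    ext y; simp [faceInChart]
  rw [h1]
  exact e.open_target.measurableSet.diff
    (e.symm.isOpen_inter_preimage hcl.isOpen_compl).measurableSet

/-- Bookkeeping that passes from the sum over all faces of Ω to the sum over the faces through the
corner: the other faces contribute zero. -/
theorem sum_setIntegral_eq {X : Type*} [MeasurableSpace X] {μ : Measure X} {J : Finset (Fin N)}
    {S : Fin N → Set X} {S' : J → Set X} {A : Fin N → X → ℂ} {A' : J → X → ℂ}
    (hS : ∀ j, MeasurableSet (S j)) (hS' : ∀ j, MeasurableSet (S' j)) (hsub : ∀ j : J, S' j ⊆ S j)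
    (hdiff : ∀ j : J, ∀ y ∈ S j \ S' j, A j y = 0) (hoff : ∀ j ∉ J, ∀ y ∈ S j, A j y = 0)
    (hcongr : ∀ j : J, EqOn (A j) (A' j) (S' j)) :
    ∑ j, ∫ y in S j, A j y ∂μ = ∑ j : J, ∫ y in S' j, A' j y ∂μ := by
  rw [← Finset.sum_subset (Finset.subset_univ J) fun j _ hj =>
    (setIntegral_congr_fun (hS j) (hoff j hj)).trans (integral_zero _ _),
    ← Finset.sum_coe_sort J]
  exact Finset.sum_congr rfl fun j _ => (setIntegral_eq_of_subset_of_forall_sdiff_eq_zero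
    (hS j) (hsub j) (hdiff j)).trans (setIntegral_congr_fun (hS' j) (hcongr j))

theorem surfaceDensity_smul_zero {k : ℕ} (ν : Cn n →L[ℝ] ℝ) (c : ℂ) :
    surfaceDensity ν (c • (0 : (Cn n) [⋀^Fin k]→L[ℝ] ℂ)) = 0 := by simp [surfaceDensity]

/-- Stokes' theorem in a corner chart, for a holomorphic function times a test form. -/
theorem CornerChart.boundaryIntegral_eq [T2Space M] (hn : 1 ≤ n) {B : Set (Cn n)}
    (hB : CornerChart Ωs e J r v B) (hop : ∀ j, IsOpen (Ωs j)) (he : e ∈ holCharts n M)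
    {ψ : Form n M (n + (n - 1))} (hψ : ψ ∈ testForms n M n (n - 1)) (hψe : tsupport ψ ⊆ e.source)
    (hψB : e '' tsupport ψ ⊆ B) {F : Cn n → ℂ} {V : Set (Cn n)} (hV : IsOpen V)
    (hF : DifferentiableOn ℂ F V)
    (hψV : ∀ y ∈ e '' tsupport ψ, (∀ j, inChartFamily r e J j y ≤ 0) → y ∈ V) :
    BoundaryIntegrable Ωs e (fun y => F y • Form.inChart e ψ y) ∧
    boundaryIntegral Ωs e (fun y => F y • Form.inChart e ψ y) =
      ∫ y in e.target ∩ e.symm ⁻¹' (⋂ j, Ωs j), F y * topCoeff (chartForm e ψ) y := by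
  have hψc : HasCompactSupport ψ := hψ.2.2
  set η := chartForm e ψ with hη
  have hηc : HasCompactSupport η := hasCompactSupport_chartForm hψc hψe
  have hηs : tsupport η ⊆ e '' tsupport ψ := tsupport_chartForm_subset hψc hψe
  have hηB : tsupport η ⊆ B := hηs.trans hψB
  have hηd : ContDiff ℝ 1 η :=
    (contDiff_chartForm hψc hψe (hψ.1 e he)).of_le (by exact_mod_cast le_top)
  -- The closed corner within the support. `F` is holomorphic only near it, so it is replaced by a
  -- global C¹ function agreeing with it there, which changes no integrand.
  set K := tsupport η ∩ ⋂ j, (tsupport η ∩ inChartFamily r e J j ⁻¹' Iic 0) with hK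
  have hKcl : IsClosed K := (isClosed_tsupport _).inter (isClosed_iInter fun j =>
    ((hB.contDiffOn j).continuousOn.mono hηB).preimage_isClosed_of_isClosed (isClosed_tsupport _)
      isClosed_Iic)
  have hKmem : ∀ y ∈ tsupport η, (∀ j, inChartFamily r e J j y ≤ 0) → y ∈ K := fun y hy h' =>
    ⟨hy, mem_iInter.2 fun j => ⟨hy, h' j⟩⟩
  have hKV : K ⊆ V := fun y hy => hψV y (hηs hy.1) fun j => (mem_iInter.1 hy.2 j).2
  obtain ⟨G, hG, hGK⟩ := exists_contDiff_eqOn hKcl hV hKV hF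
  have hzero : ∀ y ∈ e.target, y ∉ B → Form.inChart e ψ y = 0 := fun y hy hyB => by
    rw [← chartForm_apply ψ hy]
    exact image_eq_zero_of_notMem_tsupport fun h' => hyB (hηB h')
  have hface : ∀ j : J, cornerFace (inChartFamily r e J) B j ⊆ faceInChart Ωs e j := fun j y hy =>
    ⟨hB.subset_target hy.1, (hB.face_iff y hy.1 j).2 ⟨hy.2.1, hy.2.2⟩⟩
  have hdiff : ∀ j : J, ∀ y ∈ faceInChart Ωs e j \ cornerFace (inChartFamily r e J) B j,
      surfaceDensity (outwardConormal (Ωs j) e y) (F y • Form.inChart e ψ y) = 0 := by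
    intro j y hy
    have hyB : y ∉ B := fun h' =>
      hy.2 ⟨h', ((hB.face_iff y h' j).1 hy.1.2).1, ((hB.face_iff y h' j).1 hy.1.2).2⟩
    rw [hzero y hy.1.1 hyB, surfaceDensity_smul_zero]
  have hoff : ∀ j ∉ J, ∀ y ∈ faceInChart Ωs e j,
      surfaceDensity (outwardConormal (Ωs j) e y) (F y • Form.inChart e ψ y) = 0 := by
    intro j hj y hy
    have hyB : y ∉ B := fun h' => hB.notMem_frontier y h' j hj hy.2.2
    rw [hzero y hy.1 hyB, surfaceDensity_smul_zero]
  have hcongr : ∀ j : J, EqOn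
      (fun y => surfaceDensity (outwardConormal (Ωs j) e y) (F y • Form.inChart e ψ y))
      (fun y => surfaceDensity (‖fderiv ℝ (inChartFamily r e J j) y‖⁻¹ •
        fderiv ℝ (inChartFamily r e J j) y) (G y • η y))
      (cornerFace (inChartFamily r e J) B j) := by
    intro j y hy
    have hy' := hface j hy
    simp only
    rw [hB.conormal_eq y hy.1 j hy'.2.2, ← chartForm_apply ψ hy'.1]
    by_cases hyη : y ∈ tsupport η
    · rw [(hGK y (hKmem y hyη hy.2.2)).1]
    · have : chartForm e ψ y = 0 := image_eq_zero_of_notMem_tsupport hyη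
      rw [hη, this, surfaceDensity_smul_zero, surfaceDensity_smul_zero]
  have hcm : ∀ j : J, MeasurableSet (cornerFace (inChartFamily r e J) B j) := fun j =>
    measurableSet_cornerFace hB.stokes.isOpen hB.stokes.continuousOn j
  have hint : ∀ j : J, IntegrableOn
      (fun y => surfaceDensity (outwardConormal (Ωs j) e y) (F y • Form.inChart e ψ y))
      (cornerFace (inChartFamily r e J) B j) μHE[n + (n - 1)] := fun j =>
    (hB.stokes.integrableOn_surfaceDensity hG hηd hηc hηB j).congr_fun (hcongr j).symm (hcm j)
  refine ⟨fun j => ?_, ?_⟩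
  · by_cases hj : j ∈ J
    · exact (hint ⟨j, hj⟩).of_forall_sdiff_eq_zero (measurableSet_faceInChart e j)
        (hdiff ⟨j, hj⟩)
    · exact (integrableOn_zero).congr_fun (fun y hy => (hoff j hj y hy).symm)
        (measurableSet_faceInChart e j)
  · have h1 : boundaryIntegral Ωs e (fun y => F y • Form.inChart e ψ y) =
        ∑ j : J, ∫ y in cornerFace (inChartFamily r e J) B j, surfaceDensity
          (‖fderiv ℝ (inChartFamily r e J j) y‖⁻¹ • fderiv ℝ (inChartFamily r e J j) y)
          (G y • η y) ∂μHE[n + (n - 1)] := by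
      unfold boundaryIntegral
      exact sum_setIntegral_eq (A := fun j y => surfaceDensity (outwardConormal (Ωs j) e y)
        (F y • Form.inChart e ψ y)) (measurableSet_faceInChart e) hcm hface hdiff hoff hcongr
    have hkk : n + (n - 1) + 1 = n * 2 := by omega
    rw [h1, ← hB.stokes.integral_mul_topCoeff hkk hG hηd hηc hηB (chartForm_I_smul hn he hψ)
      fun y hy hyη => (hGK y (hKmem y hyη fun j => (hy.2 j).le)).2]
    have hΩo : IsOpen (⋂ j, Ωs j) := isOpen_iInter_of_finite hop
    have htz : ∀ y ∉ tsupport η, topCoeff η y = 0 := fun y hy =>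
      image_eq_zero_of_notMem_tsupport fun h' => hy (tsupport_topCoeff_subset η h')
    have hm : MeasurableSet (e.target ∩ e.symm ⁻¹' ⋂ j, Ωs j) :=
      (e.symm.isOpen_inter_preimage hΩo).measurableSet
    symm
    rw [setIntegral_eq_of_subset_of_forall_sdiff_eq_zero
      (s := cornerDomain (inChartFamily r e J) B) hm]
    · refine setIntegral_congr_fun
        (isOpen_cornerDomain hB.stokes.isOpen hB.stokes.continuousOn).measurableSet fun y hy => ?_
      by_cases hyη : y ∈ tsupport η
      · simp only [(hGK y (hKmem y hyη fun j => (hy.2 j).le)).1]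
      · simp only [htz y hyη, mul_zero]
    · intro y hy
      exact ⟨hB.subset_target hy.1, (hB.mem_iff y hy.1).2 hy.2⟩
    · intro y hy
      have : y ∉ tsupport η := fun h' => hy.2 ⟨hηB h', (hB.mem_iff y (hηB h')).1 hy.1.2⟩
      rw [htz y this, mul_zero]

end CornerChart

/-! ### Riemannian distance, and growth measured by the defining functions -/

section Riemannian

variable {n : ℕ} {M : Type*} [TopologicalSpace M] [ChartedSpace (Cn n) M]
  [IsManifold 𝓘(ℝ, Cn n) 1 M]
  [RiemannianBundle (fun x : M => TangentSpace 𝓘(ℝ, Cn n) x)]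
  [IsContinuousRiemannianBundle (Cn n) (fun x : M => TangentSpace 𝓘(ℝ, Cn n) x)]

/-- Near `x` the coordinate norm of a tangent vector is at most a constant times its Riemannian
norm, and the differential of Φ is bounded in coordinates. -/
theorem eventually_abs_mfderiv_le {Φ : M → ℝ} (hΦ : ContMDiff 𝓘(ℝ, Cn n) 𝓘(ℝ, ℝ) 1 Φ) (x : M) :
    ∃ C : ℝ, ∀ᶠ y in 𝓝 x, ∀ u : TangentSpace 𝓘(ℝ, Cn n) y,
      abs (α := ℝ) (mfderiv 𝓘(ℝ, Cn n) 𝓘(ℝ, ℝ) Φ y u) ≤ C * ‖u‖ := by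
  obtain ⟨C, hC, h⟩ := eventually_norm_trivializationAt_lt (Cn n)
    (fun x : M => TangentSpace 𝓘(ℝ, Cn n) x) x
  let e := chartAt (Cn n) x
  have heM : e ∈ IsManifold.maximalAtlas 𝓘(ℝ, Cn n) 1 M := IsManifold.chart_mem_maximalAtlas x
  let G : Cn n → ℝ := Φ ∘ e.symm
  have hG : ContDiffOn ℝ 1 G e.target := by
    have h1 : ContMDiffOn 𝓘(ℝ, Cn n) 𝓘(ℝ, ℝ) 1 (Φ ∘ e.symm) e.target :=
      hΦ.comp_contMDiffOn (contMDiffOn_symm_of_mem_maximalAtlas heM)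
    exact contMDiffOn_iff_contDiffOn.1 h1
  have hGc : ContinuousAt (fun y => ‖fderiv ℝ G (e y)‖) x := by
    have h1 : ContinuousAt (fderiv ℝ G) (e x) :=
      (hG.continuousOn_fderiv_of_isOpen e.open_target le_rfl).continuousAt
        (e.open_target.mem_nhds (e.map_source (mem_chart_source _ x)))
    exact (ContinuousAt.comp (f := e) (x := x) h1
      (e.continuousAt (mem_chart_source _ x))).norm
  have hev : ∀ᶠ y in 𝓝 x, ‖fderiv ℝ G (e y)‖ < ‖fderiv ℝ G (e x)‖ + 1 :=
    hGc.eventually_lt_const (by simp)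
  refine ⟨(‖fderiv ℝ G (e x)‖ + 1) * C, ?_⟩
  filter_upwards [h, hev, e.open_source.mem_nhds (mem_chart_source _ x)] with y hy hGy hye u
  have hEq : Φ =ᶠ[𝓝 y] G ∘ extChartAt 𝓘(ℝ, Cn n) x := by
    filter_upwards [e.open_source.mem_nhds hye] with z hz
    have : e.symm (e z) = z := e.left_inv hz
    simp only [G, Function.comp]
    exact congrArg Φ this.symm
  have hd : mfderiv 𝓘(ℝ, Cn n) 𝓘(ℝ, ℝ) Φ y u = fderiv ℝ G (e y)
      ((trivializationAt (Cn n) (fun x : M => TangentSpace 𝓘(ℝ, Cn n) x) x).continuousLinearMapAt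
        ℝ y u) := by
    rw [hEq.mfderiv_eq, TangentBundle.continuousLinearMapAt_trivializationAt hye]
    have hGd : DifferentiableAt ℝ G (extChartAt 𝓘(ℝ, Cn n) x y) :=
      (hG.differentiableOn one_ne_zero).differentiableAt
        (e.open_target.mem_nhds (e.map_source hye))
    rw [mfderiv_comp y hGd.mdifferentiableAt (mdifferentiableAt_extChartAt hye),
      mfderiv_eq_fderiv]
    rfl
  have h1 : abs (α := ℝ) (mfderiv 𝓘(ℝ, Cn n) 𝓘(ℝ, ℝ) Φ y u) ≤ ‖fderiv ℝ G (e y)‖ *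
      ‖(trivializationAt (Cn n) (fun x : M => TangentSpace 𝓘(ℝ, Cn n) x) x).continuousLinearMapAt
        ℝ y u‖ := by
    rw [hd]; exact (fderiv ℝ G (e y)).le_opNorm _
  have h2 := ((trivializationAt (Cn n) (fun x : M => TangentSpace 𝓘(ℝ, Cn n) x)
    x).continuousLinearMapAt ℝ y).le_opNorm u
  calc abs (α := ℝ) (mfderiv 𝓘(ℝ, Cn n) 𝓘(ℝ, ℝ) Φ y u) ≤ _ := h1
    _ ≤ (‖fderiv ℝ G (e x)‖ + 1) * (C * ‖u‖) :=
      mul_le_mul hGy.le (h2.trans (by gcongr)) (norm_nonneg _) (by positivity)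
    _ = _ := by ring

theorem exists_abs_mfderiv_le {Φ : M → ℝ} (hΦ : ContMDiff 𝓘(ℝ, Cn n) 𝓘(ℝ, ℝ) 1 Φ)
    (hc : HasCompactSupport Φ) :
    ∃ C : ℝ≥0, ∀ (y : M) (u : TangentSpace 𝓘(ℝ, Cn n) y),
      abs (α := ℝ) (mfderiv 𝓘(ℝ, Cn n) 𝓘(ℝ, ℝ) Φ y u) ≤ C * ‖u‖ := by
  obtain ⟨C, hC⟩ : ∃ C : ℝ, 0 ≤ C ∧ ∀ y ∈ tsupport Φ, ∀ (u : TangentSpace 𝓘(ℝ, Cn n) y),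
      abs (α := ℝ) (mfderiv 𝓘(ℝ, Cn n) 𝓘(ℝ, ℝ) Φ y u) ≤ C * ‖u‖ := by
    refine hc.isCompact.induction_on ?_ ?_ ?_ ?_
      (p := fun s => ∃ C : ℝ, 0 ≤ C ∧ ∀ y ∈ s, ∀ (u : TangentSpace 𝓘(ℝ, Cn n) y),
      abs (α := ℝ) (mfderiv 𝓘(ℝ, Cn n) 𝓘(ℝ, ℝ) Φ y u) ≤ C * ‖u‖)
    · exact ⟨0, le_rfl, by simp⟩
    · rintro s t hst ⟨C, h0, h⟩
      exact ⟨C, h0, fun y hy => h y (hst hy)⟩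
    · rintro s t ⟨C, h0, h⟩ ⟨C', h0', h'⟩
      refine ⟨C + C', by positivity, ?_⟩
      rintro y (hy | hy) u
      · exact (h y hy u).trans (by gcongr; linarith)
      · exact (h' y hy u).trans (by gcongr; linarith)
    · intro x _
      obtain ⟨C, h⟩ := eventually_abs_mfderiv_le hΦ x
      refine ⟨_, mem_nhdsWithin_of_mem_nhds h, |C|, abs_nonneg _, fun y hy u => (hy u).trans ?_⟩
      gcongr
      exact le_abs_self C
  refine ⟨⟨C, hC.1⟩, fun y u => ?_⟩
  by_cases hy : y ∈ tsupport Φ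
  · exact hC.2 y hy u
  · have : Φ =ᶠ[𝓝 y] fun _ => 0 := notMem_tsupport_iff_eventuallyEq.1 hy
    rw [this.mfderiv_eq, mfderiv_const]
    change |(0 : ℝ)| ≤ _
    rw [abs_zero]
    exact mul_nonneg hC.1 (norm_nonneg _)

/-- Integrate the differential, bounded by compactness of the support, along a path whose length is
close to the distance. -/
theorem exists_enorm_sub_le_riemannianEDist {Φ : M → ℝ}
    (hΦ : ContMDiff 𝓘(ℝ, Cn n) 𝓘(ℝ, ℝ) 1 Φ) (hc : HasCompactSupport Φ) :
    ∃ C : ℝ≥0, ∀ z w, ‖Φ w - Φ z‖ₑ ≤ C * Manifold.riemannianEDist 𝓘(ℝ, Cn n) z w := by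
  obtain ⟨C, hC⟩ := exists_abs_mfderiv_le hΦ hc
  -- `C + 1` rather than `C`, so that the constant can be divided by in `ℝ≥0∞`.
  refine ⟨C + 1, fun z w => ?_⟩
  by_contra! hlt
  have hlt' : Manifold.riemannianEDist 𝓘(ℝ, Cn n) z w < ‖Φ w - Φ z‖ₑ / (C + 1 : ℝ≥0) := by
    rw [ENNReal.lt_div_iff_mul_lt (by simp) (by simp), mul_comm]
    exact hlt
  obtain ⟨γ, h0, h1, hγ, hlen⟩ := Manifold.exists_lt_of_riemannianEDist_lt hlt'
  have hle : ‖Φ w - Φ z‖ₑ ≤ (C + 1 : ℝ≥0) * Manifold.pathELength 𝓘(ℝ, Cn n) γ 0 1 := by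
    have hcomp : ContMDiffOn 𝓘(ℝ, ℝ) 𝓘(ℝ, ℝ) 1 (Φ ∘ γ) (Icc 0 1) := hΦ.comp_contMDiffOn hγ
    rw [← h0, ← h1]
    calc ‖Φ (γ 1) - Φ (γ 0)‖ₑ
        ≤ ∫⁻ t in Icc (0 : ℝ) 1, ‖derivWithin (Φ ∘ γ) (Icc 0 1) t‖ₑ := by
          apply enorm_sub_le_lintegral_derivWithin_Icc_of_contDiffOn_Icc (f := Φ ∘ γ) _ zero_le_one
          rwa [← contMDiffOn_iff_contDiffOn]
      _ ≤ ∫⁻ t in Icc (0 : ℝ) 1, (C + 1 : ℝ≥0) *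
          ‖mfderivWithin 𝓘(ℝ, ℝ) 𝓘(ℝ, Cn n) γ (Icc 0 1) t 1‖ₑ := by
          apply setLIntegral_mono' measurableSet_Icc (fun t ht => ?_)
          have h3 : derivWithin (Φ ∘ γ) (Icc 0 1) t = mfderiv 𝓘(ℝ, Cn n) 𝓘(ℝ, ℝ) Φ (γ t)
              (mfderivWithin 𝓘(ℝ, ℝ) 𝓘(ℝ, Cn n) γ (Icc 0 1) t 1) := by
            rw [← fderivWithin_derivWithin, ← mfderivWithin_eq_fderivWithin,
              mfderiv_comp_mfderivWithin t (hΦ.mdifferentiable one_ne_zero _)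
                (hγ.mdifferentiableOn one_ne_zero t ht)
                ((uniqueMDiffWithinAt_iff_uniqueDiffWithinAt).2
                  (uniqueDiffOn_Icc zero_lt_one t ht))]
            rfl
          have h4 := hC (γ t) (mfderivWithin 𝓘(ℝ, ℝ) 𝓘(ℝ, Cn n) γ (Icc 0 1) t 1)
          have h5 : |derivWithin (Φ ∘ γ) (Icc 0 1) t| ≤ C *
              ‖mfderivWithin 𝓘(ℝ, ℝ) 𝓘(ℝ, Cn n) γ (Icc 0 1) t 1‖ := by rw [h3]; exact h4
          rw [← ofReal_norm, ← ofReal_norm, ← ENNReal.ofReal_coe_nnreal,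
            ← ENNReal.ofReal_mul (by positivity)]
          apply ENNReal.ofReal_le_ofReal
          refine h5.trans ?_
          gcongr
          simp
      _ = _ := by
          rw [lintegral_const_mul' _ _ ENNReal.coe_ne_top,
            Manifold.pathELength_eq_lintegral_mfderivWithin_Icc]
  have : (C + 1 : ℝ≥0) * Manifold.pathELength 𝓘(ℝ, Cn n) γ 0 1 < ‖Φ w - Φ z‖ₑ := by
    rw [mul_comm]
    rwa [ENNReal.lt_div_iff_mul_lt (by simp) (by simp)] at hlen
  exact absurd hle (not_le.2 this)

end Riemannian

variable {n : ℕ} {M : Type*} [TopologicalSpace M] [ChartedSpace (Cn n) M]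
  [IsManifold 𝓘(ℂ, Cn n) ω M]

/-- A smooth compactly supported function vanishing on `A` is dominated by the distance to `A`. -/
theorem exists_enorm_le_distTo (g : RiemannianMetricOn n M) {Φ : M → ℝ} {A : Set M}
    (hΦ : ContMDiff 𝓘(ℝ, Cn n) 𝓘(ℝ, ℝ) 1 Φ) (hc : HasCompactSupport Φ) (hA : ∀ w ∈ A, Φ w = 0) :
    ∃ C : ℝ≥0, ∀ z, ‖Φ z‖ₑ ≤ C * distTo g z A := by
  let : RiemannianBundle (fun x : M => TangentSpace 𝓘(ℝ, Cn n) x) := ⟨g.toRiemannianMetric⟩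
  have : IsContinuousRiemannianBundle (Cn n) (fun x : M => TangentSpace 𝓘(ℝ, Cn n) x) :=
    ⟨⟨g.inner, g.contMDiff.continuous, fun _ _ _ => rfl⟩⟩
  have : IsManifold 𝓘(ℝ, Cn n) 1 M := IsManifold.of_le (n := ω) (by exact le_top)
  obtain ⟨C, hC⟩ := exists_enorm_sub_le_riemannianEDist hΦ hc
  refine ⟨C + 1, fun z => ?_⟩
  rw [mul_comm, ← ENNReal.div_le_iff (by simp) (by simp)]
  refine le_iInf₂ fun w hw => ?_
  rw [ENNReal.div_le_iff (by simp) (by simp), mul_comm]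
  have := hC z w
  rw [hA w hw, zero_sub, enorm_neg] at this
  refine this.trans ?_
  gcongr
  simp

variable {N : ℕ} {Ωs : Fin N → Set M} {J : Finset (Fin N)} {r : Fin N → M → ℝ} {O : Set M}

theorem CornerNbhd.exists_eq_zero (h : CornerNbhd (n := n) Ωs J r O)
    (hop : ∀ j, IsOpen (Ωs j)) {z : M} (hz : z ∈ O) (hzΩ : z ∈ frontier (⋂ j, Ωs j)) :
    ∃ j ∈ J, z ∈ frontier (Ωs j) ∧ r j z = 0 := by
  have hΩ : IsOpen (⋂ j, Ωs j) := isOpen_iInter_of_finite hop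
  rw [hΩ.frontier_eq] at hzΩ
  obtain ⟨j, hj⟩ : ∃ j, z ∉ Ωs j := by simpa using hzΩ.2
  have hjJ : j ∈ J := by
    by_contra hjJ
    exact hj (h.subset j hjJ hz)
  have hzj : z ∈ frontier (Ωs j) := by
    rw [(hop j).frontier_eq]
    exact ⟨closure_mono (iInter_subset _ j) hzΩ.1, hj⟩
  exact ⟨j, hjJ, hzj, (h.isLocalDefiningFunction hjJ hz).eq_zero (hop j) hzj⟩

/-- Polynomial growth in terms of the defining functions. -/
theorem CornerNbhd.exists_growth [T2Space M] (g : RiemannianMetricOn n M)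
    (h : CornerNbhd (n := n) Ωs J r O) (hop : ∀ j, IsOpen (Ωs j)) {q : M} (hq : q ∈ O)
    {f : M → ℂ} {C : ℝ≥0} {k : ℕ}
    (hf : ∀ z ∈ ⋂ j, Ωs j, ‖f z‖ₑ ≤ C / distTo g z (frontier (⋂ j, Ωs j)) ^ k) :
    ∃ A : ℝ, ∀ᶠ z in 𝓝 q, z ∈ (⋂ j, Ωs j) → ‖f z‖ * ∏ j ∈ J, |r j z| ^ k ≤ A := by
  have : IsManifold 𝓘(ℝ, Cn n) ∞ M := IsManifold.of_le (n := ω) (by exact le_top)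
  obtain ⟨χ, -, hχ⟩ := (SmoothBumpFunction.nhds_basis_tsupport (I := 𝓘(ℝ, Cn n)) q).mem_iff.1
    (h.isOpen.mem_nhds hq)
  -- At a boundary point in the neighbourhood some r_j vanishes, so the product vanishes on the
  -- whole boundary. Being Lipschitz, it is at most a multiple of the distance to the boundary.
  let Φ : M → ℝ := fun z => χ z * ∏ j ∈ J, r j z
  have hsupp : tsupport Φ ⊆ tsupport χ := tsupport_mul_subset_left
  have hΦ : ContMDiff 𝓘(ℝ, Cn n) 𝓘(ℝ, ℝ) 1 Φ := by
    refine contMDiff_of_tsupport fun z hz => ?_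
    have hzO := hχ (hsupp hz)
    refine ContMDiffAt.mul ((χ.contMDiff.contMDiffAt).of_le (by exact_mod_cast le_top)) ?_
    refine contMDiffAt_finsetProd fun j hj => ?_
    exact ((h.contMDiffOn j hj).contMDiffAt (h.isOpen.mem_nhds hzO)).of_le (by exact_mod_cast le_top)
  have hc : HasCompactSupport Φ := χ.hasCompactSupport.mul_right
  obtain ⟨C', hC'⟩ := exists_enorm_le_distTo g (A := frontier (⋂ j, Ωs j)) hΦ hc (by
    intro w hw
    by_cases hwχ : w ∈ tsupport χ
    · obtain ⟨j, hj, -, hj0⟩ := h.exists_eq_zero hop (hχ hwχ) hw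
      simp only [Φ]
      rw [Finset.prod_eq_zero hj hj0, mul_zero]
    · simp only [Φ]
      rw [image_eq_zero_of_notMem_tsupport hwχ, zero_mul])
  refine ⟨(C * C' ^ k : ℝ≥0), ?_⟩
  filter_upwards [χ.eventuallyEq_one] with z hz hzΩ
  have hΦz : ∏ j ∈ J, |r j z| ^ k = ‖Φ z‖ ^ k := by
    simp only [Φ]
    rw [hz, Pi.one_apply, one_mul, Real.norm_eq_abs, Finset.abs_prod, Finset.prod_pow]
  have key : ‖f z‖ₑ * ‖Φ z‖ₑ ^ k ≤ (C * C' ^ k : ℝ≥0) := by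
    set d := distTo g z (frontier (⋂ j, Ωs j))
    calc ‖f z‖ₑ * ‖Φ z‖ₑ ^ k ≤ C / d ^ k * (C' * d) ^ k := by
          gcongr
          · exact hf z hzΩ
          · exact hC' z
      _ = C' ^ k * (d ^ k * (C / d ^ k)) := by rw [mul_pow]; ring
      -- This inequality also covers the distances 0 and ∞, where cancellation fails.
      _ ≤ C' ^ k * C := by gcongr; exact ENNReal.mul_div_le
      _ = _ := by push_cast; ring
  rw [hΦz]
  have h2 : ‖f z‖₊ * ‖Φ z‖₊ ^ k ≤ C * C' ^ k := by
    have : ((‖f z‖₊ * ‖Φ z‖₊ ^ k : ℝ≥0) : ℝ≥0∞) ≤ (C * C' ^ k : ℝ≥0) := by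
      push_cast at key ⊢
      exact key
    exact_mod_cast this
  exact_mod_cast h2

/-! ### Regularized integrals and dominated convergence -/

section Regularization

variable {n : ℕ} {ι : Type*} [Fintype ι] {ρ : ι → Cn n → ℝ} {W : Set (Cn n)} {k m : ℕ}

/-- `P` replaces a test function by one that comes with a factor `∏ᵢ ρᵢᵏ`, without changing its
integrals against holomorphic functions. -/
structure Regularization (ρ : ι → Cn n → ℝ) (W : Set (Cn n)) (k : ℕ)
    (P : TestFn W →ₗ[ℂ] TestFn W) : Prop where
  jetBounded : JetBounded P
  tsupport_subset : ∀ u, tsupport (P u : Cn n → ℂ) ⊆ tsupport (u : Cn n → ℂ)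
  integral_eq : ∀ F : Cn n → ℂ, ContDiff ℝ 1 F → ∀ u : TestFn W,
    (∀ y ∈ cornerDomain ρ W, y ∈ tsupport (u : Cn n → ℂ) → ∀ x, dbarAt F y x = 0) →
    ∫ y in cornerDomain ρ W, F y * (u : Cn n → ℂ) y =
      ∫ y in cornerDomain ρ W, F y * (monomialFn ρ (fun _ => k) y : ℂ) * (P u : Cn n → ℂ) y

theorem StokesNbhd.isOpen_cornerDomain (hW : StokesNbhd m ρ W) : IsOpen (cornerDomain ρ W) :=
  BoundaryCurrent.isOpen_cornerDomain hW.isOpen fun j => (hW.contDiffOn j).continuousOn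

variable {P : TestFn W →ₗ[ℂ] TestFn W}

/-- The regularization is stated for global C¹ functions. A function holomorphic near the closed
corner inside the support may be replaced by such a function without affecting either integral, as
`P` does not enlarge supports. -/
theorem Regularization.integral_eq_of_differentiableOn (hP : Regularization ρ W k P)
    (hW : StokesNbhd m ρ W) (u : TestFn W) {F : Cn n → ℂ} {V : Set (Cn n)} (hV : IsOpen V)
    (hF : DifferentiableOn ℂ F V)
    (huV : ∀ y ∈ tsupport (u : Cn n → ℂ), (∀ j, ρ j y ≤ 0) → y ∈ V) :
    ∫ y in cornerDomain ρ W, F y * (u : Cn n → ℂ) y =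
      ∫ y in cornerDomain ρ W, F y * (monomialFn ρ (fun _ => k) y : ℂ) * (P u : Cn n → ℂ) y ∧
    AEStronglyMeasurable
      (fun y => F y * (monomialFn ρ (fun _ => k) y : ℂ) * (P u : Cn n → ℂ) y)
      (volume.restrict (cornerDomain ρ W)) := by
  have hD := hW.isOpen_cornerDomain.measurableSet
  let K : Set (Cn n) := tsupport (u : Cn n → ℂ) ∩ ⋂ j, {y ∈ tsupport (u : Cn n → ℂ) | ρ j y ≤ 0}
  have hK : IsClosed K := by
    refine (isClosed_tsupport _).inter (isClosed_iInter fun j => ?_)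
    exact ((hW.contDiffOn j).continuousOn.mono u.2.2.2).preimage_isClosed_of_isClosed
      (isClosed_tsupport _) isClosed_Iic
  have hKV : K ⊆ V := fun y hy => huV y hy.1 fun j => (mem_iInter.1 hy.2 j).2
  obtain ⟨G, hG, hGK⟩ := exists_contDiff_eqOn hK hV hKV hF
  have hmem : ∀ y ∈ cornerDomain ρ W, y ∈ tsupport (u : Cn n → ℂ) → y ∈ K := fun y hy hyu =>
    ⟨hyu, mem_iInter.2 fun j => ⟨hyu, (hy.2 j).le⟩⟩
  have h1 : ∀ y ∈ cornerDomain ρ W, G y * (u : Cn n → ℂ) y = F y * (u : Cn n → ℂ) y := by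
    intro y hy
    by_cases hyu : y ∈ tsupport (u : Cn n → ℂ)
    · rw [(hGK y (hmem y hy hyu)).1]
    · rw [image_eq_zero_of_notMem_tsupport hyu, mul_zero, mul_zero]
  have h2 : ∀ y ∈ cornerDomain ρ W,
      G y * (monomialFn ρ (fun _ => k) y : ℂ) * (P u : Cn n → ℂ) y =
      F y * (monomialFn ρ (fun _ => k) y : ℂ) * (P u : Cn n → ℂ) y := by
    intro y hy
    by_cases hyu : y ∈ tsupport (u : Cn n → ℂ)
    · rw [(hGK y (hmem y hy hyu)).1]
    · rw [image_eq_zero_of_notMem_tsupport (fun h => hyu (hP.tsupport_subset u h)), mul_zero,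
        mul_zero]
  constructor
  · rw [← setIntegral_congr_fun hD h1, ← setIntegral_congr_fun hD h2]
    exact hP.integral_eq G hG u fun y hy hyu => (hGK y (hmem y hy hyu)).2
  · have hcont : ContinuousOn
        (fun y => G y * (monomialFn ρ (fun _ => k) y : ℂ) * (P u : Cn n → ℂ) y)
        (cornerDomain ρ W) := by
      refine (hG.continuous.continuousOn.mul ?_).mul (P u).2.1.continuous.continuousOn
      exact Complex.continuous_ofReal.comp_continuousOn
        ((contDiffOn_monomialFn hW.contDiffOn _).continuousOn.mono fun y hy => hy.1)
    exact (hcont.aestronglyMeasurable hD).congr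
      ((ae_restrict_iff' hD).2 (Eventually.of_forall h2))

/-- Before regularization nothing dominates the integrands; afterwards A|Pu|, continuous with
compact support, does. -/
theorem Regularization.tendsto_integral (hP : Regularization ρ W k P) (hW : StokesNbhd m ρ W)
    (u : TestFn W) {α : Type*} {l : Filter α} [l.IsCountablyGenerated] {F : α → Cn n → ℂ}
    {F₀ : Cn n → ℂ} {A : ℝ}
    (hF : ∀ᶠ ε in l, ∃ V, IsOpen V ∧ DifferentiableOn ℂ (F ε) V ∧
      ∀ y ∈ tsupport (u : Cn n → ℂ), (∀ j, ρ j y ≤ 0) → y ∈ V)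
    (hA : ∀ᶠ ε in l, ∀ y ∈ tsupport (u : Cn n → ℂ), (∀ j, ρ j y < 0) →
      ‖F ε y‖ * |monomialFn ρ (fun _ => k) y| ≤ A)
    (hlim : ∀ y ∈ tsupport (u : Cn n → ℂ), (∀ j, ρ j y < 0) →
      Tendsto (fun ε => F ε y) l (𝓝 (F₀ y))) :
    Tendsto (fun ε => ∫ y in cornerDomain ρ W, F ε y * (u : Cn n → ℂ) y) l
      (𝓝 (∫ y in cornerDomain ρ W,
        F₀ y * (monomialFn ρ (fun _ => k) y : ℂ) * (P u : Cn n → ℂ) y)) := by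
  have hD := hW.isOpen_cornerDomain.measurableSet
  have heq : (fun ε => ∫ y in cornerDomain ρ W, F ε y * (u : Cn n → ℂ) y) =ᶠ[l]
      fun ε => ∫ y in cornerDomain ρ W,
        F ε y * (monomialFn ρ (fun _ => k) y : ℂ) * (P u : Cn n → ℂ) y := by
    filter_upwards [hF] with ε ⟨V, hV, hFV, hKV⟩
    exact (hP.integral_eq_of_differentiableOn hW u hV hFV hKV).1
  refine Tendsto.congr' heq.symm ?_
  refine tendsto_integral_filter_of_dominated_convergence (fun y => A * ‖(P u : Cn n → ℂ) y‖)
    ?_ ?_ ?_ ?_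
  · filter_upwards [hF] with ε ⟨V, hV, hFV, hKV⟩
    exact (hP.integral_eq_of_differentiableOn hW u hV hFV hKV).2
  · filter_upwards [hA] with ε hε
    refine (ae_restrict_iff' hD).2 (Eventually.of_forall fun y hy => ?_)
    by_cases hyu : y ∈ tsupport (u : Cn n → ℂ)
    · rw [norm_mul, norm_mul, Complex.norm_real, Real.norm_eq_abs]
      gcongr
      exact hε y hyu hy.2
    · rw [image_eq_zero_of_notMem_tsupport (fun h => hyu (hP.tsupport_subset u h))]
      simp
  · exact ((((P u).2.1.continuous).integrable_of_hasCompactSupport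
      (P u).2.2.1).norm.const_mul A).integrableOn
  · refine (ae_restrict_iff' hD).2 (Eventually.of_forall fun y hy => ?_)
    by_cases hyu : y ∈ tsupport (u : Cn n → ℂ)
    · exact ((hlim y hyu hy.2).mul_const _).mul_const _
    · rw [image_eq_zero_of_notMem_tsupport (fun h => hyu (hP.tsupport_subset u h))]
      simp only [mul_zero]
      exact tendsto_const_nhds

end Regularization

/-! ### Shifting boundary points into the domain -/

section Shift

variable {n : ℕ} {M : Type*} [TopologicalSpace M] [ChartedSpace (Cn n) M]
  [IsManifold 𝓘(ℂ, Cn n) ω M] {e : OpenPartialHomeomorph M (Cn n)} {N : ℕ}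
  {Ωs : Fin N → Set M} {J : Finset (Fin N)} {r : Fin N → M → ℝ} {O : Set M} {v : Cn n}
  {B : Set (Cn n)}

theorem CornerChart.shift_lt (hB : CornerChart Ωs e J r v B) {ε : ℝ} (hε : 0 < ε) {y : Cn n}
    (hy : y ∈ B) (hyε : y - ε • v ∈ B) (j : J) :
    inChartFamily r e J j (y - ε • v) < inChartFamily r e J j y :=
  lt_of_fderiv_pos hB.convex (fun x hx => ((hB.contDiffOn j).contDiffAt
    (hB.stokes.isOpen.mem_nhds hx)).differentiableAt (by simp)) (hB.pos j) hε hy hyε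

theorem CornerChart.shift_mem (hB : CornerChart Ωs e J r v B) {ε : ℝ} (hε : 0 < ε) {y : Cn n}
    (hy : y ∈ B) (hyε : y - ε • v ∈ B) (hle : ∀ j, inChartFamily r e J j y ≤ 0) :
    e.symm (y - ε • v) ∈ ⋂ j, Ωs j :=
  (hB.mem_iff _ hyε).2 fun j => (hB.shift_lt hε hy hyε j).trans_le (hle j)

/-- Around a boundary point, a vector which points outward along all faces has a corner chart. -/
theorem CornerNbhd.exists_cornerChart_of_pointsOutward (hn : 1 ≤ n)
    (h : CornerNbhd (n := n) Ωs J r O) (hΩ : IsDomainWithGenericCorners n Ωs)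
    (he : e ∈ holCharts n M) (hv : PointsOutward Ωs e v) {q : M} (hqe : q ∈ e.source)
    (hq : q ∈ O) (hqΩ : q ∈ frontier (⋂ j, Ωs j)) {V : Set M} (hV : V ∈ 𝓝 q) :
    ∃ J' ⊆ J, (∀ j ∈ J, j ∉ J' → q ∈ Ωs j) ∧ ∃ B, CornerChart Ωs e J' r v B ∧ e q ∈ B ∧
      B ⊆ e.symm ⁻¹' V ∧ ∃ U, IsOpen U ∧ q ∈ U ∧ U ⊆ e.source ∧ U ⊆ e ⁻¹' B ∧
        ∀ᶠ ε : ℝ in 𝓝[>] 0, ∀ z ∈ U, e z - ε • v ∈ B := by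
  have hop : ∀ j, IsOpen (Ωs j) := fun j => (hΩ.smoothlyBounded j).isOpen
  obtain ⟨J', hJ', O', hO', h', hqO', hqJ'⟩ :=
    h.exists_of_mem hop hq (frontier_subset_closure hqΩ)
  obtain ⟨j₀, hj₀, -, -⟩ := h'.exists_eq_zero hop hqO' hqΩ
  have hpos : ∀ j : J', 0 < fderiv ℝ (inChartFamily r e J' j) (e q) v := fun j =>
    hv j q ⟨hqe, hqΩ, hqJ' j j.2⟩ (r j) (h'.isLocalDefiningFunction j.2 hqO')
  have hVe : e.symm ⁻¹' V ∈ 𝓝 (e q) := by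
    refine (e.continuousAt_symm (e.map_source hqe)).preimage_mem_nhds ?_
    rwa [e.left_inv hqe]
  obtain ⟨B, hBV, hqB, -, hB⟩ := h'.exists_cornerChart hn hΩ he hqe hqO' hqJ' ⟨j₀, hj₀⟩ hpos hVe
  refine ⟨J', hJ', fun j hj hj' => h'.subset j hj' hqO', B, hB, hqB, hBV, ?_⟩
  obtain ⟨R, hR, hRB⟩ := Metric.isOpen_iff.1 hB.stokes.isOpen (e q) hqB
  refine ⟨e.source ∩ e ⁻¹' Metric.ball (e q) (R / 2), e.isOpen_inter_preimage Metric.isOpen_ball,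
    ⟨hqe, Metric.mem_ball_self (by positivity)⟩, inter_subset_left, fun z hz => hRB
      (Metric.ball_subset_ball (by linarith) hz.2), ?_⟩
  have hlim : Tendsto (fun ε : ℝ => ‖ε • v‖) (𝓝[>] 0) (𝓝 0) := by
    have : Continuous fun ε : ℝ => ‖ε • v‖ := by fun_prop
    simpa using (this.tendsto 0).mono_left nhdsWithin_le_nhds
  filter_upwards [hlim.eventually_lt_const (show (0 : ℝ) < R / 2 by positivity)] with ε hε z hz
  refine hRB ?_
  have hz2 : dist (e z) (e q) < R / 2 := hz.2
  rw [Metric.mem_ball]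
  calc dist (e z - ε • v) (e q) ≤ dist (e z - ε • v) (e z) + dist (e z) (e q) := dist_triangle _ _ _
    _ < R / 2 + R / 2 := by
      gcongr
      rw [dist_eq_norm]; simpa using hε
    _ = R := by ring

/-- Points of the boundary are moved into the domain. -/
theorem eventually_shift_mem (hn : 1 ≤ n) (hΩ : IsDomainWithGenericCorners n Ωs)
    (he : e ∈ holCharts n M) (hv : PointsOutward Ωs e v) {K : Set M} (hK : IsCompact K)
    (hKe : K ⊆ e.source) (hKΩ : K ⊆ frontier (⋂ j, Ωs j)) :
    ∀ᶠ ε : ℝ in 𝓝[>] 0, ∀ z ∈ K, e z - ε • v ∈ e.target ∧ e.symm (e z - ε • v) ∈ ⋂ j, Ωs j := by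
  refine hK.induction_on (p := fun s => ∀ᶠ ε : ℝ in 𝓝[>] 0, ∀ z ∈ s,
    e z - ε • v ∈ e.target ∧ e.symm (e z - ε • v) ∈ ⋂ j, Ωs j) (by simp) ?_ ?_ ?_
  · intro s t hst ht
    filter_upwards [ht] with ε hε z hz using hε z (hst hz)
  · intro s t hs ht
    filter_upwards [hs, ht] with ε hε hε' z hz
    exact hz.elim (hε z) (hε' z)
  · intro q hq
    obtain ⟨J, r, O, h, hqO, hqJ⟩ := exists_cornerNbhd hΩ (frontier_subset_closure (hKΩ hq))
    obtain ⟨J', -, -, B, hB, hqB, -, U, hU, hqU, hUe, hUB, hev⟩ :=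
      h.exists_cornerChart_of_pointsOutward hn hΩ he hv (hKe hq) hqO (hKΩ hq) univ_mem
    refine ⟨K ∩ U, inter_mem self_mem_nhdsWithin (mem_nhdsWithin_of_mem_nhds (hU.mem_nhds hqU)), ?_⟩
    filter_upwards [hev, self_mem_nhdsWithin] with ε hε hpos z hz
    refine ⟨hB.subset_target (hε z hz.2), hB.shift_mem hpos (hUB hz.2) (hε z hz.2)
      (hB.nonpos _ (hUB hz.2) ?_)⟩
    rw [e.left_inv (hUe hz.2)]
    exact frontier_subset_closure (hKΩ hz.1)

end Shift

/-! ### The limit of the boundary integrals near one boundary point -/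

section LocalModel

variable {n : ℕ} {M : Type*} [TopologicalSpace M] [ChartedSpace (Cn n) M]
  [IsManifold 𝓘(ℂ, Cn n) ω M] {e e₀ : OpenPartialHomeomorph M (Cn n)} {N : ℕ}
  {Ωs : Fin N → Set M} {J : Finset (Fin N)} {r : Fin N → M → ℝ} {O : Set M} {v v₀ : Cn n}
  {B : Set (Cn n)} {f : M → ℂ} {k : ℕ}

/-- The integrals `∫_{∂Ω} f_ε φ` exist for small `ε` and converge to `c`. -/
def HasBoundaryLimit (Ωs : Fin N → Set M) (f : M → ℂ) (e : OpenPartialHomeomorph M (Cn n))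
    (v : Cn n) (φ : Form n M (n + (n - 1))) (c : ℂ) : Prop :=
  (∀ᶠ ε : ℝ in 𝓝[>] 0, BoundaryIntegrable Ωs e (shiftedForm e f v φ ε)) ∧
    Tendsto (fun ε : ℝ => boundaryIntegral Ωs e (shiftedForm e f v φ ε)) (𝓝[>] 0) (𝓝 c)

theorem differentiableOn_comp_symm (he : e ∈ holCharts n M) {Ω : Set M}
    (hf : MDifferentiableOn 𝓘(ℂ, Cn n) 𝓘(ℂ, ℂ) f Ω) :
    DifferentiableOn ℂ (fun y => f (e.symm y)) (e.target ∩ e.symm ⁻¹' Ω) := by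
  have h1 : MDifferentiableOn 𝓘(ℂ, Cn n) 𝓘(ℂ, Cn n) e.symm e.target :=
    (contMDiffOn_symm_of_mem_maximalAtlas he).mdifferentiableOn (by simp)
  have h2 : MDifferentiableOn 𝓘(ℂ, Cn n) 𝓘(ℂ, ℂ) (f ∘ e.symm) (e.target ∩ e.symm ⁻¹' Ω) :=
    hf.comp (h1.mono inter_subset_left) inter_subset_right
  exact mdifferentiableOn_iff_differentiableOn.1 h2

theorem abs_monomialFn_le {ι : Type*} [Fintype ι] {ρ : ι → Cn n → ℝ} {c : ℝ}
    {y y' : Cn n} (h : ∀ j, |ρ j y| ≤ c * |ρ j y'|) :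
    |monomialFn ρ (fun _ => k) y| ≤
      (c ^ k) ^ Fintype.card ι * |monomialFn ρ (fun _ => k) y'| := by
  rw [monomialFn, monomialFn, Finset.abs_prod, Finset.abs_prod, ← Finset.card_univ,
    ← Finset.prod_const, ← Finset.prod_mul_distrib]
  refine Finset.prod_le_prod (fun _ _ => abs_nonneg _) fun j _ => ?_
  rw [abs_pow, abs_pow, ← mul_pow]
  exact pow_le_pow_left₀ (abs_nonneg _) (h j) k

/-- A corner chart with a regularization adapted to the growth of `f`. -/
structure LocalModel (Ωs : Fin N → Set M) (f : M → ℂ) (e : OpenPartialHomeomorph M (Cn n))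
    (J : Finset (Fin N)) (r : Fin N → M → ℝ) (O : Set M) (v : Cn n) (B : Set (Cn n)) (k : ℕ)
    (P : TestFn B →ₗ[ℂ] TestFn B) : Prop where
  mem_holCharts : e ∈ holCharts n M
  nbhd : CornerNbhd (n := n) Ωs J r O
  subset : B ⊆ e.symm ⁻¹' O
  chart : CornerChart Ωs e J r v B
  reg : Regularization (inChartFamily r e J) B k P
  growth : ∃ A : ℝ, ∀ y ∈ B, e.symm y ∈ (⋂ j, Ωs j) →
    ‖f (e.symm y)‖ * |monomialFn (inChartFamily r e J) (fun _ => k) y| ≤ A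

variable {P : TestFn B →ₗ[ℂ] TestFn B}

/-- The regularized integral `∫_Ω f du`. -/
def regularizedIntegral (f : M → ℂ) (e : OpenPartialHomeomorph M (Cn n)) (J : Finset (Fin N))
    (r : Fin N → M → ℝ) (k : ℕ) (P : TestFn B →ₗ[ℂ] TestFn B) (u : TestFn B) : ℂ :=
  ∫ y in cornerDomain (inChartFamily r e J) B,
    f (e.symm y) * (monomialFn (inChartFamily r e J) (fun _ => k) y : ℂ) * (P u : Cn n → ℂ) y

theorem setIntegral_eq_cornerDomain [T2Space M] {G : M → ℂ} {φ : Form n M (n + (n - 1))}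
    (hΩ : IsOpen (⋂ j, Ωs j)) (hB : CornerChart Ωs e J r v B)
    (hφB : e '' tsupport φ ⊆ B) :
    ∫ y in e.target ∩ e.symm ⁻¹' (⋂ j, Ωs j), G (e.symm y) * topCoeff (chartForm e φ) y =
      ∫ y in cornerDomain (inChartFamily r e J) B,
        G (e.symm y) * topCoeff (chartForm e φ) y := by
  have hm : MeasurableSet (e.target ∩ e.symm ⁻¹' (⋂ j, Ωs j)) :=
    (e.symm.isOpen_inter_preimage hΩ).measurableSet
  refine setIntegral_eq_of_subset_of_forall_sdiff_eq_zero hm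
    (fun y hy => ⟨hB.subset_target hy.1, (hB.mem_iff y hy.1).2 hy.2⟩) fun y hy => ?_
  have hyB : y ∉ B := fun h => hy.2 ⟨h, (hB.mem_iff y h).1 hy.1.2⟩
  rw [topCoeff_chartForm_of_notMem φ hy.1.1, mul_zero]
  intro hs
  exact hyB (hφB ⟨_, hs, e.right_inv hy.1.1⟩)

theorem tsupport_topCoeff_chartForm_subset [T2Space M] {φ : Form n M (n + (n - 1))}
    (hc : HasCompactSupport φ) (hφe : tsupport φ ⊆ e.source) :
    tsupport (topCoeff (chartForm e φ)) ⊆ e '' tsupport φ :=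
  (tsupport_topCoeff_subset _).trans (tsupport_chartForm_subset hc hφe)

/-- Two charts are in play: the regularization is fixed in `e₀`, the shift takes place in `e`.
Stokes' theorem in a corner chart of `e` gives a volume integral, which is carried over to `e₀`;
there it is regularized and the limit is taken. The value found does not involve `e` or `v`. -/
theorem LocalModel.exists_nbhd_of_mem_frontier [T2Space M] (hn : 1 ≤ n)
    (hL : LocalModel Ωs f e₀ J r O v₀ B k P) (hΩ : IsDomainWithGenericCorners n Ωs)
    (hf : MDifferentiableOn 𝓘(ℂ, Cn n) 𝓘(ℂ, ℂ) f (⋂ j, Ωs j)) (he : e ∈ holCharts n M)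
    (hv : PointsOutward Ωs e v) {q : M} (hq : q ∈ frontier (⋂ j, Ωs j)) (hqe : q ∈ e.source)
    (hqe₀ : q ∈ e₀.source) (hqB : e₀ q ∈ B) :
    ∃ U, IsOpen U ∧ q ∈ U ∧ ∀ φ ∈ testForms n M n (n - 1), tsupport φ ⊆ U → ∀ u : TestFn B,
      (u : Cn n → ℂ) = topCoeff (chartForm e₀ φ) →
      HasBoundaryLimit Ωs f e v φ (regularizedIntegral f e₀ J r k P u) := by
  have hop : ∀ j, IsOpen (Ωs j) := fun j => (hΩ.smoothlyBounded j).isOpen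
  have hΩo : IsOpen (⋂ j, Ωs j) := isOpen_iInter_of_finite hop
  have hqO : q ∈ O := by
    have : e₀.symm (e₀ q) ∈ O := hL.subset hqB
    rwa [e₀.left_inv hqe₀] at this
  let V₁ : Set M := e₀.source ∩ e₀ ⁻¹' B
  have hV₁ : IsOpen V₁ := e₀.isOpen_inter_preimage hL.chart.stokes.isOpen
  have hV₁O : V₁ ⊆ O := fun z hz => by
    have : e₀.symm (e₀ z) ∈ O := hL.subset hz.2
    rwa [e₀.left_inv hz.1] at this
  -- Not every face of the local model need pass through `q`, and `v` is known to be outward only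
  -- along those that do. The remaining r_j are nonzero at `q`, so near `q` they stay within the
  -- factors 1/2 and 3/2 of that value.
  have hV₂ : ∀ᶠ z in 𝓝 q, ∀ j ∈ J, q ∈ Ωs j → |r j z - r j q| < |r j q| / 2 := by
    refine (Finset.eventually_all J).2 fun j hj => ?_
    by_cases hqj : q ∈ Ωs j
    · have hneg := (hL.nbhd.mem_iff j hj q hqO).1 hqj
      have hcont : ContinuousAt (r j) q :=
        (hL.nbhd.contMDiffOn j hj).continuousOn.continuousAt (hL.nbhd.isOpen.mem_nhds hqO)
      have h0 : ContinuousAt (fun z => |r j z - r j q|) q := (hcont.sub continuousAt_const).abs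
      have := h0.eventually_lt_const (u := |r j q| / 2)
        (by simp only [sub_self, abs_zero]; have := abs_pos.2 hneg.ne; positivity)
      filter_upwards [this] with z hz _ using hz
    · exact Eventually.of_forall fun z h => absurd h hqj
  obtain ⟨J', hJ', hJJ', B', hB', hqB', hB'V, U, hU, hqU, hUe, hUB', hev⟩ :=
    hL.nbhd.exists_cornerChart_of_pointsOutward hn hΩ he hv hqe hqO hq
      (inter_mem (hV₁.mem_nhds ⟨hqe₀, hqB⟩) hV₂)
  refine ⟨U ∩ V₁, hU.inter hV₁, ⟨hqU, hqe₀, hqB⟩, fun φ hφ hφU u hu => ?_⟩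
  have hφe : tsupport φ ⊆ e.source := fun z hz => hUe (hφU hz).1
  have hφe₀ : tsupport φ ⊆ e₀.source := fun z hz => (hφU hz).2.1
  have hφB' : e '' tsupport φ ⊆ B' := by
    rintro _ ⟨z, hz, rfl⟩; exact hUB' (hφU hz).1
  have hφB : e₀ '' tsupport φ ⊆ B := by
    rintro _ ⟨z, hz, rfl⟩; exact (hφU hz).2.2
  have husupp : tsupport (u : Cn n → ℂ) ⊆ e₀ '' tsupport φ := by
    rw [hu]; exact tsupport_topCoeff_chartForm_subset hφ.2.2 hφe₀
  have hΩe : IsOpen (e.target ∩ e.symm ⁻¹' (⋂ j, Ωs j)) := e.symm.isOpen_inter_preimage hΩo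
  have hfe := differentiableOn_comp_symm he hf
  -- the shifted point of a point of the closed corner
  have hshift : ∀ᶠ ε : ℝ in 𝓝[>] 0, ∀ z ∈ U, (∀ j ∈ J', r j z ≤ 0) →
      e z - ε • v ∈ B' ∧ e.symm (e z - ε • v) ∈ (⋂ j, Ωs j) ∧
      ∀ j ∈ J', r j (e.symm (e z - ε • v)) < r j z := by
    filter_upwards [hev, self_mem_nhdsWithin] with ε hε hpos z hz hle
    have hzB := hUB' hz
    have hinv : e.symm (e z) = z := e.left_inv (hUe hz)
    refine ⟨hε z hz, hB'.shift_mem hpos hzB (hε z hz) fun j => ?_, fun j hj => ?_⟩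
    · change r j (e.symm (e z)) ≤ 0
      rw [hinv]; exact hle j j.2
    · have := hB'.shift_lt hpos hzB (hε z hz) ⟨j, hj⟩
      simp only [inChartFamily] at this
      rwa [hinv] at this
  -- The shifted function as a function on the manifold, so that it can be read in either chart.
  let G : ℝ → M → ℂ := fun ε z => f (e.symm (e z - ε • v))
  have hVε : ∀ ε : ℝ, IsOpen {y : Cn n | y - ε • v ∈ e.target ∩ e.symm ⁻¹' (⋂ j, Ωs j)} :=
    fun ε => hΩe.preimage (by fun_prop)
  have hFε : ∀ ε : ℝ, DifferentiableOn ℂ (fun y => f (e.symm (y - ε • v)))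
      {y : Cn n | y - ε • v ∈ e.target ∩ e.symm ⁻¹' (⋂ j, Ωs j)} := fun ε =>
    hfe.comp (f := fun y : Cn n => y - ε • v) (by fun_prop) fun y hy => hy
  have hstokes : ∀ᶠ ε : ℝ in 𝓝[>] 0, BoundaryIntegrable Ωs e (shiftedForm e f v φ ε) ∧
      boundaryIntegral Ωs e (shiftedForm e f v φ ε) =
        ∫ y in cornerDomain (inChartFamily r e₀ J) B, G ε (e₀.symm y) * (u : Cn n → ℂ) y := by
    filter_upwards [hshift] with ε hε
    have h1 := hB'.boundaryIntegral_eq hn hop he hφ hφe hφB' (hVε ε) (hFε ε) (by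
      rintro _ ⟨z, hz, rfl⟩ hle
      obtain ⟨h2, h3, -⟩ := hε z (hφU hz).1 fun j hj => by
        have := hle ⟨j, hj⟩
        simp only [inChartFamily] at this
        rwa [e.left_inv (hφe hz)] at this
      exact ⟨hB'.subset_target h2, h3⟩)
    refine ⟨h1.1, h1.2.trans ?_⟩
    have hm : MeasurableSet (e.target ∩ e.symm ⁻¹' (⋂ j, Ωs j)) := hΩe.measurableSet
    rw [hu, ← setIntegral_eq_cornerDomain hΩo hL.chart hφB,
      ← setIntegral_topCoeff_chartForm (by omega) he hL.mem_holCharts (hφ.1 e₀ hL.mem_holCharts)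
        (fun z hz => ⟨hφe hz, hφe₀ hz⟩) hΩo (G ε)]
    refine setIntegral_congr_fun hm fun y hy => ?_
    simp only [G]
    rw [e.right_inv hy.1]
  refine ⟨hstokes.mono fun ε h => h.1, Tendsto.congr' (hstokes.mono fun ε h => h.2.symm) ?_⟩
  obtain ⟨A, hA⟩ := hL.growth
  have hpt : ∀ y ∈ tsupport (u : Cn n → ℂ), y ∈ B ∧ e₀.symm y ∈ U ∧ e₀.symm y ∈ V₁ := by
    intro y hy
    obtain ⟨z, hz, rfl⟩ := husupp hy
    rw [e₀.left_inv (hφe₀ hz)]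
    exact ⟨hφB ⟨z, hz, rfl⟩, hφU hz⟩
  -- The constant comes from |r_j(z)| ≤ 3|r_j(z')|, z' being the shifted point: the k-th power for
  -- each of the faces in `J`, times the growth bound at z'.
  refine hL.reg.tendsto_integral hL.chart.stokes u (F := fun ε y => G ε (e₀.symm y))
    (F₀ := fun y => f (e₀.symm y)) (A := ((3 : ℝ) ^ k) ^ Fintype.card J * A) ?_ ?_ ?_
  · filter_upwards [hshift] with ε hε
    have htr : DifferentiableOn ℂ (e ∘ e₀.symm) (e₀.symm.trans e).source :=
      (contDiffOn_transition hL.mem_holCharts he).differentiableOn (by simp)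
    have hopen : IsOpen (e₀.symm.trans e).source := (e₀.symm.trans e).open_source
    refine ⟨(e₀.symm.trans e).source ∩ (e ∘ e₀.symm) ⁻¹'
      {y : Cn n | y - ε • v ∈ e.target ∩ e.symm ⁻¹' (⋂ j, Ωs j)},
      htr.continuousOn.isOpen_inter_preimage hopen (hVε ε),
      (hFε ε).comp (htr.mono inter_subset_left) inter_subset_right, fun y hy hle => ?_⟩
    obtain ⟨hyB, hyU, hyV⟩ := hpt y hy
    obtain ⟨h2, h3, -⟩ := hε _ hyU fun j hj => hle ⟨j, hJ' hj⟩
    refine ⟨?_, hB'.subset_target h2, h3⟩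
    rw [OpenPartialHomeomorph.trans_source]
    exact ⟨hL.chart.subset_target hyB, hUe hyU⟩
  · filter_upwards [hshift] with ε hε y hy hlt
    obtain ⟨hyB, hyU, hyV⟩ := hpt y hy
    obtain ⟨h2, h3, h4⟩ := hε _ hyU fun j hj => (hlt ⟨j, hJ' hj⟩).le
    set z := e₀.symm y with hz
    set z' := e.symm (e z - ε • v) with hz'
    have hz'V : z' ∈ V₁ ∧ ∀ j ∈ J, q ∈ Ωs j → |r j z' - r j q| < |r j q| / 2 := hB'V h2
    have hzV : z ∈ V₁ ∧ ∀ j ∈ J, q ∈ Ωs j → |r j z - r j q| < |r j q| / 2 := by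
      have h5 : e.symm (e z) ∈ V₁ ∧
          ∀ j ∈ J, q ∈ Ωs j → |r j (e.symm (e z)) - r j q| < |r j q| / 2 := hB'V (hUB' hyU)
      rwa [e.left_inv (hUe hyU)] at h5
    have hinv : e₀.symm (e₀ z') = z' := e₀.left_inv hz'V.1.1
    -- For faces through `q` the shift makes the negative number r_j more negative; for the others 3
    -- is the quotient of 3/2 and 1/2.
    have hcomp : ∀ j : J, |inChartFamily r e₀ J j y| ≤ 3 * |inChartFamily r e₀ J j (e₀ z')| := by
      intro j
      change |r j z| ≤ 3 * |r j (e₀.symm (e₀ z'))|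
      rw [hinv]
      by_cases hj : (j : Fin N) ∈ J'
      · have hlt' := h4 j hj
        have hz0 : r j z < 0 := hlt j
        rw [abs_of_neg hz0, abs_of_neg (hlt'.trans hz0)]
        linarith
      · have hqj := hJJ' j j.2 hj
        have h5 := hz'V.2 j j.2 hqj
        have h6 := hzV.2 j j.2 hqj
        have h7 := abs_sub_abs_le_abs_sub (r j z) (r j q)
        have h8 := abs_sub_abs_le_abs_sub (r j q) (r j z')
        rw [abs_sub_comm] at h8
        linarith
    have hmono := abs_monomialFn_le (k := k) hcomp
    have hgr := hA (e₀ z') hz'V.1.2 (by rw [hinv]; exact h3)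
    rw [hinv] at hgr
    calc ‖f z'‖ * |monomialFn (inChartFamily r e₀ J) (fun _ => k) y|
        ≤ ‖f z'‖ * (((3 : ℝ) ^ k) ^ Fintype.card J *
          |monomialFn (inChartFamily r e₀ J) (fun _ => k) (e₀ z')|) := by gcongr
      _ = ((3 : ℝ) ^ k) ^ Fintype.card J * (‖f z'‖ *
          |monomialFn (inChartFamily r e₀ J) (fun _ => k) (e₀ z')|) := by ring
      _ ≤ _ := by gcongr
  · intro y hy hlt
    obtain ⟨hyB, hyU, hyV⟩ := hpt y hy
    have hzΩ : e₀.symm y ∈ ⋂ j, Ωs j := (hL.chart.mem_iff y hyB).2 hlt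
    have hze : e₀.symm y ∈ e.source := hUe hyU
    have hc : ContinuousAt (fun y => f (e.symm y)) (e (e₀.symm y)) :=
      hfe.continuousOn.continuousAt (hΩe.mem_nhds ⟨e.map_source hze, by
        rw [mem_preimage, e.left_inv hze]; exact hzΩ⟩)
    have hlim : Tendsto (fun ε : ℝ => e (e₀.symm y) - ε • v) (𝓝[>] 0) (𝓝 (e (e₀.symm y))) := by
      have : Continuous fun ε : ℝ => e (e₀.symm y) - ε • v := by fun_prop
      simpa using (this.tendsto 0).mono_left nhdsWithin_le_nhds
    have h9 := hc.tendsto.comp hlim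
    simp only [e.left_inv hze] at h9
    exact h9

end LocalModel

/-! ### Additivity of the boundary limit -/

section Sums

variable {n k : ℕ} {M : Type*} [TopologicalSpace M] [ChartedSpace (Cn n) M]
  [IsManifold 𝓘(ℂ, Cn n) ω M] {e : OpenPartialHomeomorph M (Cn n)} {N : ℕ} {Ωs : Fin N → Set M} {ι : Type*}

theorem surfaceDensity_sum (ν : Cn n →L[ℝ] ℝ) (t : Finset ι)
    (η : ι → (Cn n) [⋀^Fin k]→L[ℝ] ℂ) :
    surfaceDensity ν (∑ i ∈ t, η i) = ∑ i ∈ t, surfaceDensity ν (η i) := by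
  simp only [surfaceDensity, ContinuousAlternatingMap.sum_apply, Finset.mul_sum]
  rw [Finset.sum_comm]

theorem boundaryIntegral_eq_sum {η : Cn n → (Cn n) [⋀^Fin k]→L[ℝ] ℂ} (t : Finset ι)
    {ηs : ι → Cn n → (Cn n) [⋀^Fin k]→L[ℝ] ℂ}
    (h : ∀ y ∈ e.target, e.symm y ∈ frontier (⋂ j, Ωs j) → η y = ∑ i ∈ t, ηs i y)
    (hi : ∀ i ∈ t, BoundaryIntegrable Ωs e (ηs i)) :
    BoundaryIntegrable Ωs e η ∧
      boundaryIntegral Ωs e η = ∑ i ∈ t, boundaryIntegral Ωs e (ηs i) := by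
  have hpt : ∀ j, EqOn (fun y => ∑ i ∈ t, surfaceDensity (outwardConormal (Ωs j) e y) (ηs i y))
      (fun y => surfaceDensity (outwardConormal (Ωs j) e y) (η y)) (faceInChart Ωs e j) := by
    intro j y hy
    simp only
    rw [h y hy.1 hy.2.1, surfaceDensity_sum]
  constructor
  · intro j
    exact (integrable_finsetSum t fun i hit => hi i hit j).congr
      ((ae_restrict_iff' (measurableSet_faceInChart e j)).2 (Eventually.of_forall (hpt j)))
  · simp only [boundaryIntegral]
    rw [Finset.sum_comm]
    refine Finset.sum_congr rfl fun j _ => ?_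
    rw [← integral_finsetSum t fun i hit => hi i hit j]
    exact (setIntegral_congr_fun (measurableSet_faceInChart e j) (hpt j)).symm

/-- The decomposition is required on the boundary only, since the boundary integrals see nothing
else. Hence a partition of unity on ∂Ω is enough for gluing. -/
theorem hasBoundaryLimit_sum {f : M → ℂ} {v : Cn n} {φ : Form n M (n + (n - 1))} (t : Finset ι)
    {φs : ι → Form n M (n + (n - 1))} {c : ι → ℂ}
    (h : ∀ z ∈ frontier (⋂ j, Ωs j), φ z = ∑ i ∈ t, φs i z)
    (hi : ∀ i ∈ t, HasBoundaryLimit Ωs f e v (φs i) (c i)) :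
    HasBoundaryLimit Ωs f e v φ (∑ i ∈ t, c i) := by
  have key : ∀ᶠ ε : ℝ in 𝓝[>] 0, BoundaryIntegrable Ωs e (shiftedForm e f v φ ε) ∧
      boundaryIntegral Ωs e (shiftedForm e f v φ ε) =
        ∑ i ∈ t, boundaryIntegral Ωs e (shiftedForm e f v (φs i) ε) := by
    filter_upwards [(Finset.eventually_all t).2 fun i hit => (hi i hit).1] with ε hε
    refine boundaryIntegral_eq_sum t (fun y hy hyΩ => ?_) hε
    apply ContinuousAlternatingMap.ext
    intro m
    let m' : Fin (n + (n - 1)) → Cn n := fun a =>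
      (mfderiv 𝓘(ℝ, Cn n) 𝓘(ℝ, Cn n) e.symm y : Cn n →L[ℝ] Cn n) (m a)
    rw [ContinuousAlternatingMap.sum_apply]
    change f (e.symm (y - ε • v)) * φ (e.symm y) m' =
      ∑ i ∈ t, f (e.symm (y - ε • v)) * φs i (e.symm y) m'
    rw [h _ hyΩ, ContinuousAlternatingMap.sum_apply, Finset.mul_sum]
  exact ⟨key.mono fun ε h => h.1, Tendsto.congr' (key.mono fun ε h => h.2.symm)
    (tendsto_finsetSum t fun i hit => (hi i hit).2)⟩

end Sums

/-! ### Cutting off test forms, and the coefficient of the differential as a linear map -/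

section TestForms

variable {n : ℕ} {M : Type*} [TopologicalSpace M] [ChartedSpace (Cn n) M]
  [IsManifold 𝓘(ℂ, Cn n) ω M] {e e₀ : OpenPartialHomeomorph M (Cn n)}

theorem contDiffOn_ofReal_comp_symm (he : e ∈ holCharts n M) {χ : M → ℝ}
    (hχ : ContMDiff 𝓘(ℝ, Cn n) 𝓘(ℝ, ℝ) ∞ χ) :
    ContDiffOn ℝ ∞ (fun y => (χ (e.symm y) : ℂ)) e.target := by
  have h1 := contDiffOn_comp_symm he (hχ.contMDiffOn (s := univ))
  simp only [preimage_univ, inter_univ] at h1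
  exact Complex.ofRealCLM.contDiff.comp_contDiffOn h1

/-- The test forms with support in `V`. -/
def testFormsIn (n : ℕ) {M : Type*} [TopologicalSpace M] [ChartedSpace (Cn n) M] (V : Set M) :
    Submodule ℂ (Form n M (n + (n - 1))) where
  carrier := {φ | φ ∈ testForms n M n (n - 1) ∧ tsupport φ ⊆ V}
  add_mem' := fun {a b} ha hb => ⟨add_mem ha.1 hb.1,
    (tsupport_add a b).trans (union_subset ha.2 hb.2)⟩
  zero_mem' := ⟨zero_mem _, by simp [tsupport]⟩
  smul_mem' := fun c a ha => ⟨Submodule.smul_mem _ c ha.1,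
    (tsupport_smul_subset_right (fun _ => c) a).trans ha.2⟩

/-- Multiplication of test forms by a smooth function. -/
def mulForm {V : Set M} (χ : M → ℝ) (hχ : ContMDiff 𝓘(ℝ, Cn n) 𝓘(ℝ, ℝ) ∞ χ)
    (hV : tsupport χ ⊆ V) : testForms n M n (n - 1) →ₗ[ℂ] testFormsIn n V where
  toFun ψ := ⟨fun z => (χ z : ℂ) • (ψ : Form n M (n + (n - 1))) z, by
    refine ⟨⟨fun e he => ?_, fun x c w => ?_, ?_⟩, ?_⟩
    · exact (contDiffOn_ofReal_comp_symm he hχ).smul (ψ.2.1 e he)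
    · simp only [ContinuousAlternatingMap.smul_apply, ψ.2.2.1 x c w, smul_eq_mul]; ring
    · exact ψ.2.2.2.smul_left (f := fun z => (χ z : ℂ))
    · refine subset_trans ?_ hV
      refine closure_mono fun z hz hz' => hz ?_
      simp only
      rw [hz', Complex.ofReal_zero]
      apply ContinuousAlternatingMap.ext
      intro m
      exact zero_mul _⟩
  map_add' a b := by
    apply Subtype.ext; funext z
    exact smul_add _ _ _
  map_smul' c a := by
    apply Subtype.ext; funext z
    apply ContinuousAlternatingMap.ext
    intro m
    exact mul_left_comm _ _ _

theorem topCoeff_mem_testFn [T2Space M] (he : e ∈ holCharts n M) {B : Set (Cn n)} {V : Set M}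
    (hVe : V ⊆ e.source) (hVB : V ⊆ e ⁻¹' B) {φ : Form n M (n + (n - 1))}
    (hφ : φ ∈ testFormsIn n V) : topCoeff (chartForm e φ) ∈ TestFn B := by
  have hφe := hφ.2.trans hVe
  have hc : ContDiff ℝ ∞ (chartForm e φ) := contDiff_chartForm hφ.1.2.2 hφe (hφ.1.1 e he)
  refine ⟨?_, ?_, ?_⟩
  · have : topCoeff (chartForm e φ) = fun y => ∑ i : Fin (n + (n - 1) + 1), (-1) ^ (i : ℕ) *
      fderiv ℝ (chartForm e φ) y (realFrame n i) fun a => realFrame n (i.succAbove a) :=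
      funext fun y => topCoeff_eq_sum _ y
    rw [this]
    refine ContDiff.sum fun i _ => contDiff_const.mul ?_
    have h1 : ContDiff ℝ ∞ (fun y => fderiv ℝ (chartForm e φ) y (realFrame n i)) :=
      (hc.fderiv_right (by simp)).clm_apply contDiff_const
    exact (ContinuousAlternatingMap.apply ℝ (Cn n) ℂ
      (fun a => realFrame n (i.succAbove a))).contDiff.comp h1
  · exact (hasCompactSupport_chartForm hφ.1.2.2 hφe).of_isClosed_subset (isClosed_tsupport _)
      (tsupport_topCoeff_subset _)
  · refine (tsupport_topCoeff_chartForm_subset hφ.1.2.2 hφe).trans ?_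
    rintro _ ⟨z, hz, rfl⟩
    exact hVB (hφ.2 hz)

/-- The coefficient of the exterior derivative of a test form, in a chart. -/
def coeffMap [T2Space M] (he : e ∈ holCharts n M) {B : Set (Cn n)} {V : Set M}
    (hVe : V ⊆ e.source) (hVB : V ⊆ e ⁻¹' B) : testFormsIn n V →ₗ[ℂ] TestFn B where
  toFun φ := ⟨topCoeff (chartForm e (φ : Form n M (n + (n - 1)))),
    topCoeff_mem_testFn he hVe hVB φ.2⟩
  map_add' a b := by
    apply Subtype.ext; funext y
    have hc : ∀ a : testFormsIn n V, DifferentiableAt ℝ (chartForm e a.1) y := fun a =>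
      (contDiff_chartForm a.2.1.2.2 (a.2.2.trans hVe) (a.2.1.1 e he)).contDiffAt.differentiableAt
        (by simp)
    have hadd : chartForm e (a + b : testFormsIn n V).1 = chartForm e a.1 + chartForm e b.1 := by
      funext y
      simp only [chartForm, Pi.add_apply]
      by_cases hy : y ∈ e.target
      · simp only [indicator_of_mem hy]
        rfl
      · simp only [indicator_of_notMem hy, add_zero]
    change topCoeff (chartForm e (a + b : testFormsIn n V).1) y =
      topCoeff (chartForm e a.1) y + topCoeff (chartForm e b.1) y
    rw [hadd, topCoeff, extDeriv_add (hc a) (hc b)]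
    rfl
  map_smul' c a := by
    apply Subtype.ext; funext y
    have hc : DifferentiableAt ℝ (chartForm e a.1) y :=
      (contDiff_chartForm a.2.1.2.2 (a.2.2.trans hVe) (a.2.1.1 e he)).contDiffAt.differentiableAt
        (by simp)
    have hsmul : chartForm e (c • a : testFormsIn n V).1 = c • chartForm e a.1 := by
      funext y
      simp only [chartForm, Pi.smul_apply]
      by_cases hy : y ∈ e.target
      · simp only [indicator_of_mem hy]
        rfl
      · simp only [indicator_of_notMem hy]
        apply ContinuousAlternatingMap.ext
        intro m
        exact (mul_zero c).symm
    change topCoeff (chartForm e (c • a : testFormsIn n V).1) y = c * topCoeff (chartForm e a.1) y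
    rw [hsmul, topCoeff_eq_sum, topCoeff_eq_sum, Finset.mul_sum]
    refine Finset.sum_congr rfl fun i _ => ?_
    rw [fderiv_const_smul hc c]
    simp only [smul_apply, ContinuousAlternatingMap.smul_apply, smul_eq_mul]
    ring

end TestForms

/-! ### The local functional: boundedness, and limits in arbitrary charts -/

section Glue

variable {n : ℕ} {M : Type*} [TopologicalSpace M] [ChartedSpace (Cn n) M]
  [IsManifold 𝓘(ℂ, Cn n) ω M] {e e₀ : OpenPartialHomeomorph M (Cn n)} {N : ℕ}
  {Ωs : Fin N → Set M} {J : Finset (Fin N)} {r : Fin N → M → ℝ} {O : Set M} {v v₀ : Cn n}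
  {B : Set (Cn n)} {f : M → ℂ} {k : ℕ} {P : TestFn B →ₗ[ℂ] TestFn B}

theorem exists_smooth_partition [T2Space M] [SigmaCompactSpace M] {K : Set M} (hK : IsCompact K)
    {ι : Type*} {U : ι → Set M} (hU : ∀ i, IsOpen (U i)) (hKU : K ⊆ ⋃ i, U i) :
    ∃ (t : Finset ι) (χ : t → M → ℝ), (∀ i, ContMDiff 𝓘(ℝ, Cn n) 𝓘(ℝ, ℝ) ∞ (χ i)) ∧
      (∀ i, tsupport (χ i) ⊆ U i) ∧ ∀ x ∈ K, ∑ i, χ i x = 1 := by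
  have : IsManifold 𝓘(ℝ, Cn n) ∞ M := IsManifold.of_le (n := ω) (by exact le_top)
  obtain ⟨t, ht⟩ := hK.elim_finite_subcover U hU hKU
  obtain ⟨F, hF⟩ := SmoothPartitionOfUnity.exists_isSubordinate 𝓘(ℝ, Cn n) hK.isClosed
    (fun i : t => U i) (fun i => hU i) (fun x hx => by
      obtain ⟨i, hi, hx⟩ := mem_iUnion₂.1 (ht hx)
      exact mem_iUnion.2 ⟨⟨i, hi⟩, hx⟩)
  refine ⟨t, fun i => F i, fun i => (F i).contMDiff, hF, fun x hx => ?_⟩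
  rw [← finsum_eq_sum_of_fintype]
  exact F.sum_eq_one hx

theorem LocalModel.integrable (hL : LocalModel Ωs f e₀ J r O v₀ B k P)
    (hf : MDifferentiableOn 𝓘(ℂ, Cn n) 𝓘(ℂ, ℂ) f (⋂ j, Ωs j))
    (u : TestFn B) :
    IntegrableOn (fun y => f (e₀.symm y) *
      (monomialFn (inChartFamily r e₀ J) (fun _ => k) y : ℂ) * (P u : Cn n → ℂ) y)
      (cornerDomain (inChartFamily r e₀ J) B) := by
  have hD := hL.chart.stokes.isOpen_cornerDomain.measurableSet
  obtain ⟨A, hA⟩ := hL.growth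
  have hsub : cornerDomain (inChartFamily r e₀ J) B ⊆ e₀.target ∩ e₀.symm ⁻¹' (⋂ j, Ωs j) :=
    fun y hy => ⟨hL.chart.subset_target hy.1, (hL.chart.mem_iff y hy.1).2 hy.2⟩
  refine Integrable.mono' (g := fun y => A * ‖(P u : Cn n → ℂ) y‖) ?_ ?_ ?_
  · exact ((((P u).2.1.continuous).integrable_of_hasCompactSupport
      (P u).2.2.1).norm.const_mul A).integrableOn
  · refine ContinuousOn.aestronglyMeasurable ?_ hD
    refine (ContinuousOn.mul ((differentiableOn_comp_symm hL.mem_holCharts hf).continuousOn.mono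
      hsub) ?_).mul (P u).2.1.continuous.continuousOn
    exact Complex.continuous_ofReal.comp_continuousOn
      ((contDiffOn_monomialFn hL.chart.stokes.contDiffOn _).continuousOn.mono fun y hy => hy.1)
  · refine (ae_restrict_iff' hD).2 (Eventually.of_forall fun y hy => ?_)
    rw [norm_mul, norm_mul, Complex.norm_real, Real.norm_eq_abs]
    gcongr
    exact hA y hy.1 (hsub hy).2

/-- The local boundary current, as a functional of the exterior derivative of the test form. -/
def LocalModel.functional (hL : LocalModel Ωs f e₀ J r O v₀ B k P)
    (hf : MDifferentiableOn 𝓘(ℂ, Cn n) 𝓘(ℂ, ℂ) f (⋂ j, Ωs j)) :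
    TestFn B →ₗ[ℂ] ℂ where
  toFun := regularizedIntegral f e₀ J r k P
  map_add' a b := by
    simp only [regularizedIntegral]
    rw [← integral_add (hL.integrable hf a) (hL.integrable hf b), map_add]
    refine integral_congr_ae (Eventually.of_forall fun y => ?_)
    exact mul_add _ _ _
  map_smul' c a := by
    simp only [regularizedIntegral]
    rw [RingHom.id_apply, smul_eq_mul, ← integral_const_mul, map_smul]
    refine integral_congr_ae (Eventually.of_forall fun y => ?_)
    exact mul_left_comm _ _ _

/-- The integrand is at most the growth bound times |Pu|, and jet boundedness of `P` at order 0
controls |Pu| by finitely many derivatives of `u` on `K`, outside of which Pu vanishes. -/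
theorem LocalModel.exists_bound (hL : LocalModel Ωs f e₀ J r O v₀ B k P)
    (hf : MDifferentiableOn 𝓘(ℂ, Cn n) 𝓘(ℂ, ℂ) f (⋂ j, Ωs j))
    {K : Set (Cn n)} (hK : IsCompact K) (hKB : K ⊆ B) :
    ∃ (m : ℕ) (C : ℝ), ∀ u : TestFn B, tsupport (u : Cn n → ℂ) ⊆ K → ∀ A : ℝ, 0 ≤ A →
      (∀ y ∈ K, ∀ i ≤ m, ‖iteratedFDeriv ℝ i (u : Cn n → ℂ) y‖ ≤ A) →
      ‖hL.functional hf u‖ ≤ C * A := by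
  obtain ⟨m, C, hC, h⟩ := hL.reg.jetBounded K hKB hK 0
  obtain ⟨A₀, hA₀⟩ := hL.growth
  have hD := hL.chart.stokes.isOpen_cornerDomain.measurableSet
  refine ⟨m, |A₀| * C * volume.real K, fun u hu A hA hjet => ?_⟩
  have hbd : ∀ y, ‖(P u : Cn n → ℂ) y‖ ≤ K.indicator (fun _ => C * A) y := by
    intro y
    by_cases hy : y ∈ K
    · rw [indicator_of_mem hy]
      simpa using h u y hy A (hjet y hy) 0 le_rfl
    · rw [indicator_of_notMem hy, image_eq_zero_of_notMem_tsupport fun h' =>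
        hy (hu (hL.reg.tsupport_subset u h')), norm_zero]
  change ‖∫ y in _, _‖ ≤ _
  have hint : Integrable (K.indicator fun _ : Cn n => C * A) :=
    (integrable_indicator_iff hK.isClosed.measurableSet).2
      (integrableOn_const hK.measure_lt_top.ne)
  calc ‖∫ y in cornerDomain (inChartFamily r e₀ J) B, f (e₀.symm y) *
        (monomialFn (inChartFamily r e₀ J) (fun _ => k) y : ℂ) * (P u : Cn n → ℂ) y‖
      ≤ ∫ y in cornerDomain (inChartFamily r e₀ J) B, |A₀| * K.indicator (fun _ => C * A) y := by
        refine norm_integral_le_of_norm_le (hint.const_mul _).integrableOn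
          ((ae_restrict_iff' hD).2 (Eventually.of_forall fun y hy => ?_))
        rw [norm_mul, norm_mul, Complex.norm_real, Real.norm_eq_abs]
        refine mul_le_mul ?_ (hbd y) (norm_nonneg _) (abs_nonneg _)
        exact (hA₀ y hy.1 ((hL.chart.mem_iff y hy.1).2 hy.2)).trans (le_abs_self _)
    _ ≤ ∫ y, |A₀| * K.indicator (fun _ => C * A) y := by
        refine setIntegral_le_integral (hint.const_mul _) (Eventually.of_forall fun y => ?_)
        exact mul_nonneg (abs_nonneg _) (indicator_nonneg (fun _ _ => by positivity) _)
    _ = |A₀| * C * volume.real K * A := by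
        rw [integral_const_mul, integral_indicator_const _ hK.isClosed.measurableSet, smul_eq_mul]
        ring

/-- The boundary integrals vanish trivially. The regularized integral vanishes as well: away from
the boundary `f` itself is holomorphic near the closed corner inside the support, so the
regularization can be undone and Stokes' theorem applied to `f`. -/
theorem LocalModel.hasBoundaryLimit_of_disjoint [T2Space M] (hn : 1 ≤ n)
    (hL : LocalModel Ωs f e₀ J r O v₀ B k P) (hΩ : IsDomainWithGenericCorners n Ωs)
    (hf : MDifferentiableOn 𝓘(ℂ, Cn n) 𝓘(ℂ, ℂ) f (⋂ j, Ωs j))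
    {φ : Form n M (n + (n - 1))} (hφ : φ ∈ testForms n M n (n - 1))
    (hφe₀ : tsupport φ ⊆ e₀.source) (hφB : e₀ '' tsupport φ ⊆ B)
    (hφΩ : Disjoint (tsupport φ) (frontier (⋂ j, Ωs j))) {u : TestFn B}
    (hu : (u : Cn n → ℂ) = topCoeff (chartForm e₀ φ)) :
    HasBoundaryLimit Ωs f e v φ (regularizedIntegral f e₀ J r k P u) := by
  have hop : ∀ j, IsOpen (Ωs j) := fun j => (hΩ.smoothlyBounded j).isOpen
  have hΩo : IsOpen (⋂ j, Ωs j) := isOpen_iInter_of_finite hop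
  have hzero : ∀ z ∈ frontier (⋂ j, Ωs j), φ z = 0 := fun z hz =>
    image_eq_zero_of_notMem_tsupport fun h => disjoint_left.1 hφΩ h hz
  have hV : IsOpen (e₀.target ∩ e₀.symm ⁻¹' (⋂ j, Ωs j)) := e₀.symm.isOpen_inter_preimage hΩo
  have hfe := differentiableOn_comp_symm hL.mem_holCharts hf
  have husupp : tsupport (u : Cn n → ℂ) ⊆ e₀ '' tsupport φ := by
    rw [hu]; exact tsupport_topCoeff_chartForm_subset hφ.2.2 hφe₀
  have hmem : ∀ y ∈ e₀ '' tsupport φ, (∀ j, inChartFamily r e₀ J j y ≤ 0) →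
      y ∈ e₀.target ∩ e₀.symm ⁻¹' (⋂ j, Ωs j) := by
    rintro _ ⟨z, hz, rfl⟩ hle
    have hB := hφB ⟨z, hz, rfl⟩
    refine ⟨hL.chart.subset_target hB, (hL.chart.mem_iff _ hB).2 fun j => ?_⟩
    refine lt_of_le_of_ne (hle j) fun h0 => ?_
    have := ((hL.chart.face_iff _ hB j).2 ⟨h0, hle⟩).1
    rw [e₀.left_inv (hφe₀ hz)] at this
    exact disjoint_left.1 hφΩ hz this
  have h0 : regularizedIntegral f e₀ J r k P u = 0 := by
    rw [regularizedIntegral, ← (hL.reg.integral_eq_of_differentiableOn hL.chart.stokes u hV hfe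
      fun y hy => hmem y (husupp hy)).1, hu,
      ← setIntegral_eq_cornerDomain hΩo hL.chart hφB,
      ← (hL.chart.boundaryIntegral_eq hn hop hL.mem_holCharts hφ hφe₀ hφB hV hfe hmem).2,
      (boundaryIntegral_eq_sum (∅ : Finset ℕ) (ηs := fun _ _ => 0) (fun y _ hyΩ => ?_) (by simp)).2,
      Finset.sum_empty]
    rw [Finset.sum_empty, inChart_eq_zero (hzero _ hyΩ)]
    apply ContinuousAlternatingMap.ext
    intro m
    exact mul_zero _
  rw [h0]
  simpa using hasBoundaryLimit_sum (f := f) (e := e) (v := v) (∅ : Finset ℕ) (φs := fun _ => 0)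
    (c := fun _ => 0) (by simpa using hzero) (by simp)

theorem smul_mem_testFormsIn {V : Set M} {φ : Form n M (n + (n - 1))} (hφ : φ ∈ testFormsIn n V)
    {χ : M → ℝ} (hχ : ContMDiff 𝓘(ℝ, Cn n) 𝓘(ℝ, ℝ) ∞ χ) :
    (fun z => (χ z : ℂ) • φ z) ∈ testFormsIn n V ∧
      tsupport (fun z => (χ z : ℂ) • φ z) ⊆ tsupport χ := by
  have h := (mulForm χ hχ subset_rfl ⟨φ, hφ.1⟩).2
  exact ⟨⟨h.1, (tsupport_smul_subset_right (fun z => (χ z : ℂ)) φ).trans hφ.2⟩, h.2⟩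

theorem exists_sum_eq_of_cover [T2Space M] [SigmaCompactSpace M] {V : Set M}
    (φ : testFormsIn n V) {ι : Type*} {U : ι → Set M} (hU : ∀ i, IsOpen (U i))
    (hφU : tsupport (φ : Form n M (n + (n - 1))) ⊆ ⋃ i, U i) :
    ∃ (t : Finset ι) (φs : t → testFormsIn n V),
      (∀ i, tsupport (φs i : Form n M (n + (n - 1))) ⊆ U i) ∧ ∑ i, φs i = φ := by
  obtain ⟨t, χ, hχ, hχU, hsum⟩ := exists_smooth_partition (n := n)
    (K := tsupport (φ : Form n M (n + (n - 1)))) φ.2.1.2.2.isCompact hU hφU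
  refine ⟨t, fun i => ⟨fun z => (χ i z : ℂ) • φ.1 z, (smul_mem_testFormsIn φ.2 (hχ i)).1⟩,
    fun i => (smul_mem_testFormsIn φ.2 (hχ i)).2.trans (hχU i), ?_⟩
  apply Subtype.ext
  funext z
  rw [AddSubmonoidClass.coe_finsetSum, Finset.sum_apply]
  apply ContinuousAlternatingMap.ext
  intro m
  rw [ContinuousAlternatingMap.sum_apply]
  change ∑ i, (χ i z : ℂ) * φ.1 z m = _
  rw [← Finset.sum_mul]
  by_cases hz : z ∈ tsupport (φ : Form n M (n + (n - 1)))
  · have := hsum z hz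
    rw [← Complex.ofReal_sum, this, Complex.ofReal_one, one_mul]
  · have h0 : φ.1 z = 0 := image_eq_zero_of_notMem_tsupport hz
    rw [h0]
    exact mul_zero _

/-- The neighbourhoods on which the limit is known depend on `e` and `v`, while the functional does
not. So the form is cut into pieces small enough for the given `e` and `v`, and linearity of the
functional reassembles them. -/
theorem LocalModel.hasBoundaryLimit [T2Space M] [SigmaCompactSpace M] (hn : 1 ≤ n)
    (hL : LocalModel Ωs f e₀ J r O v₀ B k P) (hΩ : IsDomainWithGenericCorners n Ωs)
    (hf : MDifferentiableOn 𝓘(ℂ, Cn n) 𝓘(ℂ, ℂ) f (⋂ j, Ωs j)) (he : e ∈ holCharts n M)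
    (hv : PointsOutward Ωs e v) {V : Set M} (hVe : V ⊆ e₀.source) (hVB : V ⊆ e₀ ⁻¹' B)
    (φ : testFormsIn n V) (hφe : tsupport (φ : Form n M (n + (n - 1))) ⊆ e.source) :
    HasBoundaryLimit Ωs f e v φ
      (hL.functional hf (coeffMap hL.mem_holCharts hVe hVB φ)) := by
  have hloc : ∀ q : ↥(V ∩ e.source), ∃ U, IsOpen U ∧ (q : M) ∈ U ∧ ∀ φ ∈ testFormsIn n V,
      tsupport φ ⊆ U → ∀ u : TestFn B, (u : Cn n → ℂ) = topCoeff (chartForm e₀ φ) →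
      HasBoundaryLimit Ωs f e v φ (regularizedIntegral f e₀ J r k P u) := by
    intro q
    by_cases hq : (q : M) ∈ frontier (⋂ j, Ωs j)
    · obtain ⟨U, hU, hqU, h⟩ := hL.exists_nbhd_of_mem_frontier hn hΩ hf he hv hq q.2.2
        (hVe q.2.1) (hVB q.2.1)
      exact ⟨U, hU, hqU, fun φ hφ hφU u hu => h φ hφ.1 hφU u hu⟩
    · refine ⟨(frontier (⋂ j, Ωs j))ᶜ, isClosed_frontier.isOpen_compl, hq,
        fun φ hφ hφU u hu => hL.hasBoundaryLimit_of_disjoint hn hΩ hf hφ.1 (hφ.2.trans hVe)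
          ?_ (disjoint_left.2 hφU) hu⟩
      rintro _ ⟨z, hz, rfl⟩
      exact hVB (hφ.2 hz)
  choose U hU hqU h using hloc
  obtain ⟨t, φs, hφU, hφs⟩ := exists_sum_eq_of_cover φ hU
    (fun z hz => mem_iUnion.2 ⟨⟨z, φ.2.2 hz, hφe hz⟩, hqU _⟩)
  have hpt : ∀ z, φ.1 z = ∑ i, (φs i).1 z := fun z => by
    rw [← hφs, AddSubmonoidClass.coe_finsetSum, Finset.sum_apply]
  have hlim := hasBoundaryLimit_sum (Ωs := Ωs) (f := f) (e := e) (v := v) (φ := φ.1) Finset.univ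
    (fun z _ => hpt z) fun i _ => h i (φs i).1 (φs i).2 (hφU i)
      (coeffMap hL.mem_holCharts hVe hVB (φs i)) rfl
  have hval : hL.functional hf (coeffMap hL.mem_holCharts hVe hVB φ) =
      ∑ i, regularizedIntegral f e₀ J r k P (coeffMap hL.mem_holCharts hVe hVB (φs i)) := by
    rw [← hφs, map_sum, map_sum]
    rfl
  rw [hval]
  exact hlim

end Glue

/-! ### Gluing the local functionals into a current -/

section Current

variable {n : ℕ} {M : Type*} [TopologicalSpace M] [ChartedSpace (Cn n) M]
  [IsManifold 𝓘(ℂ, Cn n) ω M] {e : OpenPartialHomeomorph M (Cn n)} {N : ℕ}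
  {Ωs : Fin N → Set M} {f : M → ℂ}

/-- Genericity is used twice: the dual vectors provide both the antiholomorphic fields for the
regularization and an auxiliary outward vector, which has nothing to do with the one used for
shifting. The exponent of every r_j is the growth order `k`. -/
theorem exists_localModel [T2Space M] (hn : 1 ≤ n) (g : RiemannianMetricOn n M)
    (hΩ : IsDomainWithGenericCorners n Ωs) {C : ℝ≥0} {k : ℕ}
    (hf : ∀ z ∈ ⋂ j, Ωs j, ‖f z‖ₑ ≤ C / distTo g z (frontier (⋂ j, Ωs j)) ^ k) {q : M}
    (hq : q ∈ frontier (⋂ j, Ωs j)) :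
    ∃ (e : OpenPartialHomeomorph M (Cn n)) (J : Finset (Fin N)) (r : Fin N → M → ℝ) (O : Set M)
      (v : Cn n) (B : Set (Cn n)) (P : TestFn B →ₗ[ℂ] TestFn B),
      LocalModel Ωs f e J r O v B k P ∧ q ∈ e.source ∧ e q ∈ B := by
  have hop : ∀ j, IsOpen (Ωs j) := fun j => (hΩ.smoothlyBounded j).isOpen
  let e := chartAt (Cn n) q
  have he : e ∈ holCharts n M := IsManifold.chart_mem_maximalAtlas q
  have hqe : q ∈ e.source := mem_chart_source _ q
  obtain ⟨J, r, O, h, hqO, hqJ⟩ := exists_cornerNbhd hΩ (frontier_subset_closure hq)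
  obtain ⟨j₀, hj₀, -, -⟩ := h.exists_eq_zero hop hqO hq
  obtain ⟨w, hw⟩ := h.exists_isDualTo hΩ he hqe hqO hqJ
  obtain ⟨v, hv⟩ := hw.exists_pos
  have hO₁ : IsOpen (e.target ∩ e.symm ⁻¹' O) := e.symm.isOpen_inter_preimage h.isOpen
  have hqO₁ : e q ∈ e.target ∩ e.symm ⁻¹' O :=
    ⟨e.map_source hqe, by rw [mem_preimage, e.left_inv hqe]; exact hqO⟩
  obtain ⟨W, hWO, hWo, hqW, c, hc⟩ := exists_dualFields (r := inChartFamily r e J) hO₁ hqO₁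
    (fun j => contDiffOn_comp_symm he (h.contMDiffOn j j.2)) hw
  obtain ⟨A, hA⟩ := h.exists_growth g hop hqO hf
  have hA' : e.symm ⁻¹' {z | z ∈ (⋂ j, Ωs j) → ‖f z‖ * ∏ j ∈ J, |r j z| ^ k ≤ A} ∈ 𝓝 (e q) := by
    refine (e.continuousAt_symm (e.map_source hqe)).preimage_mem_nhds ?_
    rw [e.left_inv hqe]
    exact hA
  obtain ⟨B, hBV, hqB, hBO, hB⟩ := h.exists_cornerChart hn hΩ he hqe hqO hqJ ⟨j₀, hj₀⟩ hv
    (inter_mem (hWo.mem_nhds hqW) hA')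
  have hBW : B ⊆ W := fun y hy => (hBV hy).1
  have hcB : DualFields B c w (inChartFamily r e J) :=
    ⟨fun j l => (hc.contDiffOn j l).mono hBW, fun y hy => hc.dual y (hBW hy),
      fun y hy => hc.dual_ne y (hBW hy)⟩
  obtain ⟨P, hP₁, hP₂, hP₃⟩ := exists_regularization hB.stokes hcB (fun _ => k)
  refine ⟨e, J, r, O, v, B, P, ⟨he, h, hBO, hB, ⟨hP₁, hP₂, hP₃⟩, A, fun y hy hyΩ => ?_⟩, hqe, hqB⟩
  have h1 : ‖f (e.symm y)‖ * ∏ j ∈ J, |r j (e.symm y)| ^ k ≤ A := (hBV hy).2 hyΩ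
  rw [monomialFn, Finset.abs_prod]
  simp only [abs_pow]
  rw [Finset.prod_coe_sort J fun j => |r j (e.symm y)| ^ k]
  exact h1

/-- The coefficient is a fixed linear expression in first derivatives of the form; the loss of one
derivative raises the order of the current by one. -/
theorem exists_norm_iteratedFDeriv_topCoeff_le (n k : ℕ) : ∃ C : ℝ, 0 ≤ C ∧
    ∀ (η : Cn n → (Cn n) [⋀^Fin k]→L[ℝ] ℂ), ContDiff ℝ ∞ η → ∀ (y : Cn n) (i : ℕ),
      ‖iteratedFDeriv ℝ i (topCoeff η) y‖ ≤ C * ‖iteratedFDeriv ℝ (i + 1) η y‖ := by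
  let T : Fin (k + 1) → (Cn n) [⋀^Fin k]→L[ℝ] ℂ →L[ℝ] ℂ := fun j => ((-1 : ℝ) ^ (j : ℕ)) •
    ContinuousAlternatingMap.apply ℝ (Cn n) ℂ (fun a => realFrame n (j.succAbove a))
  refine ⟨∑ j, ‖T j‖ * ‖realFrame n j‖, by positivity, fun η hη y i => ?_⟩
  have hd : ∀ j : Fin (k + 1), ContDiff ℝ ∞ fun y => fderiv ℝ η y (realFrame n j) := fun j =>
    (hη.fderiv_right (by simp)).clm_apply contDiff_const
  have hT : topCoeff η = fun y => ∑ j, T j (fderiv ℝ η y (realFrame n j)) := by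
    funext y
    rw [topCoeff_eq_sum]
    simp [T]
  rw [hT, iteratedFDeriv_fun_sum_apply (f := fun j y => T j (fderiv ℝ η y (realFrame n j)))
    fun j _ => (((T j).contDiff.comp (hd j)).of_le
    (by exact_mod_cast le_top)).contDiffAt, Finset.sum_mul]
  refine (norm_sum_le _ _).trans (Finset.sum_le_sum fun j _ => ?_)
  calc _ ≤ ‖T j‖ * ‖iteratedFDeriv ℝ i (fun y => fderiv ℝ η y (realFrame n j)) y‖ :=
        (T j).norm_iteratedFDeriv_comp_left (hd j).contDiffAt (by exact_mod_cast le_top)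
    _ ≤ ‖T j‖ * (‖realFrame n j‖ * ‖iteratedFDeriv ℝ (i + 1) η y‖) := by
        gcongr
        exact norm_iteratedFDeriv_fderiv_apply_le hη.contDiffAt _ i
    _ = _ := by ring

/-- The boundary current near a boundary point. -/
theorem exists_localCurrent [T2Space M] [SigmaCompactSpace M] (hn : 1 ≤ n)
    (g : RiemannianMetricOn n M) (hΩ : IsDomainWithGenericCorners n Ωs)
    (hf : MDifferentiableOn 𝓘(ℂ, Cn n) 𝓘(ℂ, ℂ) f (⋂ j, Ωs j))
    (hgrowth : HasPolynomialGrowth g (⋂ j, Ωs j) f) {q : M} (hq : q ∈ frontier (⋂ j, Ωs j)) :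
    ∃ V : Set M, IsOpen V ∧ q ∈ V ∧ ∃ T : testFormsIn n V →ₗ[ℂ] ℂ,
      (∀ e ∈ holCharts n M, ∀ v, PointsOutward Ωs e v → ∀ φ : testFormsIn n V,
        tsupport (φ : Form n M (n + (n - 1))) ⊆ e.source → HasBoundaryLimit Ωs f e v φ (T φ)) ∧
      ∃ e ∈ holCharts n M, V ⊆ e.source ∧ ∀ K ⊆ V, IsCompact K →
        ∃ (m : ℕ) (C : ℝ), ∀ φ : testFormsIn n V, tsupport (φ : Form n M (n + (n - 1))) ⊆ K →
          ∀ A : ℝ, 0 ≤ A → (∀ y ∈ e '' K, ∀ i ≤ m,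
            ‖iteratedFDeriv ℝ i (Form.inChart e (φ : Form n M (n + (n - 1)))) y‖ ≤ A) →
          ‖T φ‖ ≤ C * A := by
  obtain ⟨C, k, hC⟩ := hgrowth
  obtain ⟨e, J, r, O, v, B, P, hL, hqe, hqB⟩ := exists_localModel hn g hΩ hC hq
  have hVe : e.source ∩ e ⁻¹' B ⊆ e.source := inter_subset_left
  have hVB : e.source ∩ e ⁻¹' B ⊆ e ⁻¹' B := inter_subset_right
  refine ⟨e.source ∩ e ⁻¹' B, e.isOpen_inter_preimage hL.chart.stokes.isOpen, ⟨hqe, hqB⟩,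
    hL.functional hf ∘ₗ coeffMap hL.mem_holCharts hVe hVB,
    fun e' he' v' hv' φ hφ => hL.hasBoundaryLimit hn hΩ hf he' hv' hVe hVB φ hφ,
    e, hL.mem_holCharts, hVe, fun K hK hKc => ?_⟩
  have hLc : IsCompact (e '' K) := hKc.image_of_continuousOn (e.continuousOn.mono (hK.trans hVe))
  have hLB : e '' K ⊆ B := by
    rintro _ ⟨z, hz, rfl⟩; exact hVB (hK hz)
  obtain ⟨m, C₁, h⟩ := hL.exists_bound hf hLc hLB
  obtain ⟨C₂, hC₂, hT⟩ := exists_norm_iteratedFDeriv_topCoeff_le n (n + (n - 1))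
  refine ⟨m + 1, C₁ * C₂, fun φ hφ A hA hjet => ?_⟩
  have hφe := φ.2.2.trans hVe
  have hcd : ContDiff ℝ ∞ (chartForm e φ.1) :=
    contDiff_chartForm φ.2.1.2.2 hφe (φ.2.1.1 e hL.mem_holCharts)
  rw [mul_assoc]
  refine h _ ((tsupport_topCoeff_chartForm_subset φ.2.1.2.2 hφe).trans (image_mono hφ)) _
    (by positivity) fun y hy i hi => (hT _ hcd y i).trans ?_
  gcongr
  have hyt : y ∈ e.target := hL.chart.subset_target (hLB hy)
  rw [((chartForm_eventuallyEq φ.1 hyt).iteratedFDeriv ℝ (i + 1)).eq_of_nhds]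
  exact hjet y hy (i + 1) (by omega)

theorem exists_boundaryCurrent [T2Space M] [SigmaCompactSpace M] (hn : 1 ≤ n)
    (g : RiemannianMetricOn n M) (hΩ : IsDomainWithGenericCorners n Ωs)
    (hf : MDifferentiableOn 𝓘(ℂ, Cn n) 𝓘(ℂ, ℂ) f (⋂ j, Ωs j))
    (hgrowth : HasPolynomialGrowth g (⋂ j, Ωs j) f) :
    ∃ T : testForms n M n (n - 1) →ₗ[ℂ] ℂ,
      (∀ K : Set M, IsCompact K → ∃ s : Finset (OpenPartialHomeomorph M (Cn n) × Set (Cn n)),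
        (∀ a ∈ s, a.1 ∈ holCharts n M ∧ IsCompact a.2 ∧ a.2 ⊆ a.1.target) ∧
        ∃ (m : ℕ) (C : ℝ), ∀ ψ : testForms n M n (n - 1),
          tsupport (ψ : Form n M (n + (n - 1))) ⊆ K → ∀ A : ℝ, 0 ≤ A →
          (∀ a ∈ s, ∀ y ∈ a.2, ∀ i ≤ m,
            ‖iteratedFDeriv ℝ i (Form.inChart a.1 (ψ : Form n M (n + (n - 1)))) y‖ ≤ A) →
          ‖T ψ‖ ≤ C * A) ∧
      ∀ e ∈ holCharts n M, ∀ v, PointsOutward Ωs e v → ∀ ψ : testForms n M n (n - 1),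
        tsupport (ψ : Form n M (n + (n - 1))) ⊆ e.source → HasBoundaryLimit Ωs f e v ψ (T ψ) := by
  classical
  have hcpt : IsCompact (frontier (⋂ j, Ωs j)) :=
    hΩ.isCompact_closure.of_isClosed_subset isClosed_frontier frontier_subset_closure
  choose V hV hqV T hlim e he hVe hbound using
    fun q : frontier (⋂ j, Ωs j) => exists_localCurrent hn g hΩ hf hgrowth q.2
  -- The functions sum to 1 only on ∂Ω. Finitely many suffice because ∂Ω is closed in the compact
  -- closure of Ω.
  obtain ⟨t, χ, hχ, hχV, hsum⟩ := exists_smooth_partition (n := n) hcpt hV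
    (fun z hz => mem_iUnion.2 ⟨⟨z, hz⟩, hqV _⟩)
  refine ⟨∑ i : t, T i ∘ₗ mulForm (χ i) (hχ i) (hχV i), fun K hK => ?_, fun e' he' v hv ψ hψ => ?_⟩
  · have hKi : ∀ i : t, tsupport (χ i) ∩ K ⊆ V i := fun i => inter_subset_left.trans (hχV i)
    have hKc : ∀ i : t, IsCompact (tsupport (χ i) ∩ K) := fun i =>
      hK.inter_left (isClosed_tsupport _)
    have hLc : ∀ i : t, IsCompact (e i '' (tsupport (χ i) ∩ K)) := fun i =>
      (hKc i).image_of_continuousOn ((e i).continuousOn.mono ((hKi i).trans (hVe i)))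
    have hLt : ∀ i : t, e i '' (tsupport (χ i) ∩ K) ⊆ (e i).target := by
      rintro i _ ⟨z, hz, rfl⟩
      exact (e i).map_source (hVe i (hKi i hz))
    choose m C hmC using fun i : t => hbound i (tsupport (χ i) ∩ K) (hKi i) (hKc i)
    choose D hD hjet using fun i : t => exists_jet_smul_bound
      (F := (Cn n) [⋀^Fin (n + (n - 1))]→L[ℝ] ℂ) (e i).open_target (hLc i) (hLt i)
      (contDiffOn_ofReal_comp_symm (he i) (hχ i)) (m i)
    -- One seminorm per piece of the partition, on the part of `K` where the piece lives; `D i` is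
    -- the Leibniz constant for multiplication by `χ i`.
    refine ⟨Finset.univ.image fun i : t => (e i, e i '' (tsupport (χ i) ∩ K)), ?_,
      Finset.univ.sup m, ∑ i, C i * D i, fun ψ hψ A hA hψA => ?_⟩
    · intro a ha
      obtain ⟨i, -, rfl⟩ := Finset.mem_image.1 ha
      exact ⟨he i, hLc i, hLt i⟩
    · rw [LinearMap.sum_apply, Finset.sum_mul]
      refine (norm_sum_le _ _).trans (Finset.sum_le_sum fun i _ => ?_)
      rw [mul_assoc]
      refine hmC i (mulForm (χ i) (hχ i) (hχV i) ψ) ?_ (D i * A) (mul_nonneg (hD i) hA) ?_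
      · refine subset_inter (mulForm (χ i) (hχ i) subset_rfl ψ).2.2 ?_
        exact (tsupport_smul_subset_right (fun z => (χ i z : ℂ)) ψ.1).trans hψ
      · intro y hy
        exact hjet i _ (ψ.2.1 (e i) (he i)) y hy A fun j hj => hψA (e i, _)
          (Finset.mem_image_of_mem _ (Finset.mem_univ i)) y hy j
          (hj.trans (Finset.le_sup (Finset.mem_univ i)))
  · rw [LinearMap.sum_apply]
    refine hasBoundaryLimit_sum Finset.univ (φs := fun i => (mulForm (χ i) (hχ i) (hχV i) ψ).1)
      (fun z hz => ?_) fun i _ => hlim i e' he' v hv _ ?_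
    · apply ContinuousAlternatingMap.ext
      intro w
      rw [ContinuousAlternatingMap.sum_apply]
      change _ = ∑ i, (χ i z : ℂ) * ψ.1 z w
      rw [← Finset.sum_mul, ← Complex.ofReal_sum, hsum z hz, Complex.ofReal_one, one_mul]
    · exact (tsupport_smul_subset_right (fun z => (χ i z : ℂ)) ψ.1).trans hψ

end Current

end BoundaryCurrent

end

theorem theorem1p1 (n : ℕ) (hn : 1 ≤ n)
    (M : Type*) [TopologicalSpace M] [T2Space M] [SigmaCompactSpace M]
    [ChartedSpace (Cn n) M] [IsManifold 𝓘(ℂ, Cn n) ω M]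
    (g : RiemannianMetricOn n M)
    {N : ℕ} (Ωs : Fin N → Set M) (hΩ : IsDomainWithGenericCorners n Ωs)
    (f : M → ℂ) (hf : MDifferentiableOn 𝓘(ℂ, Cn n) 𝓘(ℂ, ℂ) f (⋂ j, Ωs j))
    (hgrowth : HasPolynomialGrowth g (⋂ j, Ωs j) f) :
    ∃ bc : Current n M 0 1,
      ∀ e ∈ holCharts n M, ∀ ψ : testForms n M n (n - 1),
        tsupport (ψ : Form n M (n + (n - 1))) ⊆ e.source →
        ∀ v : Cn n, PointsOutward Ωs e v →
          (∀ᶠ ε : ℝ in 𝓝[>] 0, ∀ z ∈ frontier (⋂ j, Ωs j) ∩ tsupport (ψ : Form n M (n + (n - 1))),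
            e z - ε • v ∈ e.target ∧ e.symm (e z - ε • v) ∈ ⋂ j, Ωs j) ∧
          (∀ᶠ ε : ℝ in 𝓝[>] 0, BoundaryIntegrable Ωs e (shiftedForm e f v (ψ : Form n M (n + (n - 1))) ε)) ∧
          Tendsto (fun ε : ℝ => boundaryIntegral Ωs e (shiftedForm e f v (ψ : Form n M (n + (n - 1))) ε)) (𝓝[>] 0)
            (𝓝 (bc.toLinearMap ψ)) := by
  obtain ⟨T, hcont, hlim⟩ := exists_boundaryCurrent hn g hΩ hf hgrowth
  -- A current of bidegree (0,1) acts on `testForms n M (n - 0) (n - 1)`, and `n - 0` reduces to `n`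
  -- definitionally.
  refine ⟨⟨T, hcont⟩, fun e he ψ hψ v hv => ⟨?_, hlim e he v hv ψ hψ⟩⟩
  exact eventually_shift_mem hn hΩ he hv (ψ.2.2.2.isCompact.inter_left isClosed_frontier)
    (inter_subset_right.trans hψ) inter_subset_left
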